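/- Let $N\ge 0$ be an integer, $\mathbb T^N=\mathbb R^N/\mathbb Z^N$ with normalized Lebesgue measure $dx$, $T>0$ and $q\ge 2$ real. Let $u:[0,T]\times\mathbb T^N\to\mathbb R^N$ be a time-dependent vector field of class $C^1$ with $\operatorname{div}u_t=0$ for all $t$. For a smooth time-dependent divergence-free vector field $v$ on $[0,T]\times\mathbb T^N$ let $e_t(v)$ be the flow of $\dot v$, that is, $\frac{d}{dt}e_t(v)=\dot v_t(e_t(v))$, $e_0(v)=\mathrm{id}$, and put $L(u_t)f=\frac12\Delta f+u_t\cdot\nabla f$ and $$\mathcal E_q(u,v)=\frac1q\int_0^T\!\!\int_{\mathbb T^N}\Big\|\big[(\partial_t+L(u_t))e_t(v)\big]\big(e_t(v)^{-1}(x)\big)\Big\|^q\,dx\,dt .$$ Call $u$ a critical point of $\mathcal E_q$ if, for all smooth divergence-free time-dependent $v$ with $v_0=0$ and $v_T=0$, the derivative $\frac{d}{d\varepsilon}\big|_{\varepsilon=0}\mathcal E_q(u,\varepsilon v)$ exists and is $0$. Then $u$ is a critical point of $\mathcal E_q$ if and only if there is a function $P(t,x)$ such that $u$ solves the weighted porous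 media equation $$\partial_t\big(\|u\|^{q-2}u\big)=\Big(-u\cdot\nabla+\tfrac12\Delta\Big)\big(\|u\|^{q-2}u\big)+\nabla P$$ for all $t\in[0,T]$. Here $P(t,\cdot)\in L^2(\mathbb T^N)$, and $\Delta$ and $\nabla P$ are taken in the sense of distributions on $\mathbb T^N$ (the field $\|u\|^{q-2}u$ is $C^1$ but in general not $C^2$). If $\|u_t\|^{q-2}u_t$ is of class $C^2$ on $\mathbb T^N$ for every $t\in[0,T]$, then $u$ is a critical point if and only if the equation holds pointwise on $[0,T]\times\mathbb T^N$ for some $P$ with $P(t,\cdot)\in C^1(\mathbb T^N)$ for every $t$. -/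

import Mathlib

open Set MeasureTheory Laplacian
open scoped ContDiff Gradient

noncomputable section

namespace PorousVariational

/-- The space `ℝ^N` with its Euclidean norm. The torus is `ℝ^N / ℤ^N`: functions on it are
`ℤ^N`-periodic functions on `ℝ^N`, and a map of the torus into itself that is isotopic to the
identity is represented by its lift to `ℝ^N`. -/
abbrev E (N : ℕ) : Type := EuclideanSpace ℝ (Fin N)

/-- `f` is `ℤ^N`-periodic, that is, a function on the torus. -/
def IsPeriodic {N : ℕ} {F : Type} (f : E N → F) : Prop :=
  ∀ (x : E N) (i : Fin N), f (x + EuclideanSpace.single i (1 : ℝ)) = f x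

/-- The fundamental domain `[0,1)^N`. Lebesgue measure restricted to it is the normalized
Lebesgue measure of the torus. -/
def cell (N : ℕ) : Set (E N) := {x | ∀ i, x i ∈ Ico (0 : ℝ) 1}

/-- The divergence `∑ j, ∂_j f^j`. -/
def divergence {N : ℕ} (f : E N → E N) (x : E N) : ℝ :=
  ∑ j, (fderiv ℝ f x (EuclideanSpace.single j (1 : ℝ))) j

/-- `u` is a time-dependent divergence-free vector field of class `C^n` on `[0,T] × torus`. Being of
class `C^n` on the closed interval means that `u` is the restriction of a field that is `C^n` for
all times; the values at times outside `[0,T]` play no role. -/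
structure IsDivFreeField {N : ℕ} (T : ℝ) (n : ℕ∞) (u : ℝ → E N → E N) : Prop where
  contDiff : ContDiff ℝ n (fun p : ℝ × E N => u p.1 p.2)
  periodic : ∀ t, IsPeriodic (u t)
  div_eq_zero : ∀ t ∈ Icc 0 T, ∀ x, divergence (u t) x = 0

/-- `e` solves `∂_t e_t = (∂_t v_t)(e_t)`, `e_0 = id`. -/
def IsPerturbationFlow {N : ℕ} (v : ℝ → E N → E N) (e : ℝ → E N → E N) : Prop :=
  (∀ x, e 0 x = x) ∧
    ∀ t x, HasDerivAt (fun s => e s x) (deriv (fun s => v s (e t x)) t) t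

/-- The perturbation flow `e_t(v)`: the solution of the ordinary differential equation
`∂_t e_t = (∂_t v_t)(e_t)`, `e_0 = id` (it exists and is unique for smooth periodic `v`). -/
def perturbationFlow {N : ℕ} (v : ℝ → E N → E N) : ℝ → E N → E N :=
  Classical.epsilon (IsPerturbationFlow v)

/-- The operator `L(b) f = ½ Δ f + b · ∇ f`, for a vector field `b` and a vector-valued `f`. -/
def generator {N : ℕ} (b : E N → E N) (f : E N → E N) (x : E N) : E N :=
  (1 / 2 : ℝ) • (Δ f) x + fderiv ℝ f x (b x)

/-- `[(∂_t + L(u_t)) e_t](x)`. -/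
def materialDerivative {N : ℕ} (u e : ℝ → E N → E N) (t : ℝ) (x : E N) : E N :=
  deriv (fun s => e s x) t + generator (u t) (e t) x

/-- The energy functional `𝓔_q(u, v)` on the time interval `[0,T]`. -/
def energy {N : ℕ} (q T : ℝ) (u v : ℝ → E N → E N) : ℝ :=
  (1 / q) * ∫ t in (0 : ℝ)..T, ∫ x in cell N,
    ‖materialDerivative u (perturbationFlow v) t
      (Function.invFun (perturbationFlow v t) x)‖ ^ q

/-- `u` is a critical point of `𝓔_q`: for all smooth divergence-free `v` with `v_0 = v_T = 0`, the
derivative of `ε ↦ 𝓔_q(u, ε v)` at `0` exists and vanishes. -/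
def IsCriticalPoint {N : ℕ} (q T : ℝ) (u : ℝ → E N → E N) : Prop :=
  ∀ v : ℝ → E N → E N, IsDivFreeField T ⊤ v → (∀ x, v 0 x = 0) → (∀ x, v T x = 0) →
    HasDerivAt (fun ε : ℝ => energy q T u (fun t x => ε • v t x)) 0 0

/-- The weighted field `‖u‖^{q-2} u`. -/
def weighted {N : ℕ} (q : ℝ) (u : ℝ → E N → E N) (t : ℝ) (x : E N) : E N :=
  ‖u t x‖ ^ (q - 2) • u t x

/-- With `w = ‖u‖^{q-2} u`, the equation `∂_t w = (-u·∇ + ½Δ) w + ∇P` holds pointwise on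
`[0,T] × torus`, with a pressure that is `C^1` in space. -/
def IsClassicalSolution {N : ℕ} (q T : ℝ) (u : ℝ → E N → E N) (P : ℝ → E N → ℝ) : Prop :=
  ∀ t ∈ Icc 0 T, IsPeriodic (P t) ∧ ContDiff ℝ 1 (P t) ∧
    ∀ x, deriv (fun s => weighted q u s x) t =
      -(fderiv ℝ (weighted q u t) x (u t x)) + (1 / 2 : ℝ) • (Δ (weighted q u t)) x + ∇ (P t) x

/-- With `w = ‖u‖^{q-2} u`, the equation `∂_t w = (-u·∇ + ½Δ) w + ∇P` holds at every time of
`[0,T]`, where `Δ w` and `∇P` are distributional derivatives on the torus and the pressure is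
square integrable in space. The first derivatives of `w` are classical. -/
def IsWeakSolution {N : ℕ} (q T : ℝ) (u : ℝ → E N → E N) (P : ℝ → E N → ℝ) : Prop :=
  ∀ t ∈ Icc 0 T, IsPeriodic (P t) ∧ MemLp (P t) 2 (volume.restrict (cell N)) ∧
    ∀ φ : E N → E N, ContDiff ℝ ∞ φ → IsPeriodic φ →
      ∫ x in cell N, inner ℝ (deriv (fun s => weighted q u s x) t) (φ x) =
        -(∫ x in cell N, inner ℝ (fderiv ℝ (weighted q u t) x (u t x)) (φ x))
          + (1 / 2) * (∫ x in cell N, inner ℝ (weighted q u t x) ((Δ φ) x))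
          - ∫ x in cell N, P t x * divergence φ x

end PorousVariational

end

set_option linter.unusedSectionVars false

/-! For small `ε` the flow of `ε ∂_t v` is `e = id + ε S`, where `S` is a smooth function of `(x,
ε)` with values in `C([0,T], ℝ^N)`. Since `Δ id = 0` and `D id` is the identity, `(∂_t + L(u)) e = u
+ ε Q_ε`, where `Q_0 = ∂_t v + L(u) v` because `v_0 = 0`. The flow preserves volume, so composition
with `e⁻¹` drops out of the energy, which becomes `(1/q) ∫∫ ‖u + ε Q_ε‖^q`. Its derivative at `0` is
`∫∫ ⟨w, ∂_t v + L(u) v⟩` with `w = ‖u‖^{q-2} u` (`hasDerivAt_energy`).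

Integration by parts in time, where the boundary terms vanish, and in space, where `u·∇` is skew
because `div u = 0`, turns this into `-∫ M_t(v_t) dt`. Here `M_t` is the weak form of `∂_t w + u·∇w
- ½Δw` (`firstVariation_eq`). Green's identity puts only one space derivative on `w`, and `w` is
`C^1` because `x ↦ ‖x‖^{q-2} x` is `C^1` for `q ≥ 2`. The choice `v = a(t) φ(x)` and continuity of
`M_t(φ)` in `t` show that `u` is critical if and only if, for every `t` in `[0,T]`, `M_t` kills all
smooth divergence-free `φ` (`isCriticalPoint_iff_momentum`).

What remains is a de Rham theorem on the torus: functionals that kill divergence-free fields are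
gradients. In the weak case (`exists_pressure`) the functional is `g - ∑ ∂_j W_j` with `g`, `W_j`
continuous. Plane waves with amplitude orthogonal to `k` are divergence-free, so its symbol at
frequency `k` is a multiple of `k`. Dividing by `2πi k` gives the pressure coefficients. The
division absorbs the derivative in `∂_j W_j`, so they are square summable. In the classical case
(`IsOrthogonalToDivFree.exists_potential`) the functional is a continuous field `G`. It is
mollified; the mollified fields are curl-free and have potentials by the Poincaré lemma, and these
potentials converge to a potential of `G`. Testing against constant fields shows that the limit is
periodic. -/

noncomputable section

namespace PorousVariational

/-! ### Periodic functions, and integration by parts on the torus. -/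

section Cell

variable {N : ℕ}

/-- The lattice `ℤ^N` in `ℝ^N`. -/
abbrev intLattice (N : ℕ) : Submodule ℤ (E N) :=
  Submodule.span ℤ (range (EuclideanSpace.basisFun (Fin N) ℝ).toBasis)

theorem IsPeriodic.add_mem {F : Type} {f : E N → F} (hf : IsPeriodic f) {g : E N}
    (hg : g ∈ intLattice N) (x : E N) : f (x + g) = f x := by
  induction hg using Submodule.span_induction generalizing x with
  | mem y hy =>
    obtain ⟨i, rfl⟩ := hy
    simpa using hf x i
  | zero => simp
  | add y z _ _ hy hz => rw [← add_assoc, hz, hy]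
  | smul n y _ hy =>
    induction n using Int.induction_on generalizing x with
    | zero => simp
    | succ n ih => rw [add_smul, one_smul, ← add_assoc, hy, ih]
    | pred n ih => rw [sub_smul, one_smul, ← ih x, ← hy (x + _)]; congr 1; abel

theorem cell_eq_fundamentalDomain :
    cell N = ZSpan.fundamentalDomain (EuclideanSpace.basisFun (Fin N) ℝ).toBasis := by
  ext x; simp [cell]

theorem isAddFundamentalDomain_cell :
    IsAddFundamentalDomain (intLattice N) (cell N) volume := by
  rw [cell_eq_fundamentalDomain]; exact ZSpan.isAddFundamentalDomain _ _

theorem measurableSet_cell : MeasurableSet (cell N) := by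
  rw [cell_eq_fundamentalDomain]; exact ZSpan.fundamentalDomain_measurableSet _

/-- The closed unit cube. -/
def cube (N : ℕ) : Set (E N) := {x | ∀ i, x i ∈ Icc (0 : ℝ) 1}

theorem cell_subset_cube : cell N ⊆ cube N := fun _ hx i => Ico_subset_Icc_self (hx i)

theorem isCompact_cube : IsCompact (cube N) := by
  have h : IsCompact (Set.pi univ fun _ : Fin N => Icc (0 : ℝ) 1) :=
    isCompact_univ_pi fun _ => isCompact_Icc
  have : cube N = (EuclideanSpace.equiv (Fin N) ℝ).symm '' Set.pi univ fun _ => Icc (0 : ℝ) 1 := by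
    ext x
    rw [ContinuousLinearEquiv.image_symm_eq_preimage]
    simp only [cube, mem_preimage, Set.mem_pi, mem_univ, true_implies]
    rfl
  rw [this]
  exact h.image (EuclideanSpace.equiv (Fin N) ℝ).symm.continuous

instance isFiniteMeasure_restrict_cell : IsFiniteMeasure (volume.restrict (cell N)) :=
  ⟨by
    rw [Measure.restrict_apply_univ]
    exact (measure_mono cell_subset_cube).trans_lt isCompact_cube.measure_lt_top⟩

theorem exists_add_mem_cell (x : E N) : ∃ g ∈ intLattice N, x + g ∈ cell N := by
  obtain ⟨g, hg, -⟩ := ZSpan.exist_unique_vadd_mem_fundamentalDomain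
    (EuclideanSpace.basisFun (Fin N) ℝ).toBasis x
  refine ⟨g, g.2, ?_⟩
  rw [cell_eq_fundamentalDomain, add_comm]
  exact hg

theorem IsPeriodic.exists_mem_cell {F : Type} {f : E N → F} (hf : IsPeriodic f) (x : E N) :
    ∃ y ∈ cell N, f y = f x := by
  obtain ⟨g, hg, h⟩ := exists_add_mem_cell x
  exact ⟨_, h, hf.add_mem hg x⟩

theorem IsPeriodic.exists_bound {F : Type} [NormedAddCommGroup F] {f : E N → F}
    (hf : IsPeriodic f) (hc : Continuous f) : ∃ C, ∀ x, ‖f x‖ ≤ C := by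
  obtain ⟨C, hC⟩ := (isCompact_cube (N := N)).exists_bound_of_continuousOn hc.continuousOn
  refine ⟨C, fun x => ?_⟩
  obtain ⟨y, hy, h⟩ := hf.exists_mem_cell x
  rw [← h]
  exact hC y (cell_subset_cube hy)

/-- A jointly continuous family of periodic functions is bounded, locally uniformly in the
parameter. -/
theorem exists_bound_of_isPeriodic {F : Type} [NormedAddCommGroup F] {A : Type}
    [TopologicalSpace A] {f : A × E N → F} (hf : ∀ a, IsPeriodic fun x => f (a, x))
    (hc : Continuous f) {K : Set A} (hK : IsCompact K) : ∃ C, ∀ a ∈ K, ∀ x, ‖f (a, x)‖ ≤ C := by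
  obtain ⟨C, hC⟩ := (hK.prod (isCompact_cube (N := N))).exists_bound_of_continuousOn hc.continuousOn
  refine ⟨C, fun a ha x => ?_⟩
  obtain ⟨y, hy, h⟩ := (hf a).exists_mem_cell x
  rw [← h]
  exact hC (a, y) ⟨ha, cell_subset_cube hy⟩

theorem integrableOn_cell {F : Type} [NormedAddCommGroup F] {f : E N → F}
    (hc : ContinuousOn f (cube N)) : IntegrableOn f (cell N) :=
  (hc.integrableOn_compact isCompact_cube).mono_set cell_subset_cube

theorem integrable_cell {F : Type} [NormedAddCommGroup F] {f : E N → F}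
    (hc : Continuous f) : Integrable f (volume.restrict (cell N)) :=
  integrableOn_cell hc.continuousOn

instance vaddInvariantMeasure_intLattice :
    VAddInvariantMeasure (intLattice N) (E N) volume :=
  ⟨fun c s _ => measure_preimage_add volume (c : E N) s⟩

/-- A volume preserving bijection of `ℝ^N` commuting with integer translations preserves the
integral over the torus. -/
theorem setIntegral_cell_comp {F : Type} [NormedAddCommGroup F] [NormedSpace ℝ F]
    {e : E N → E N} {e' : E N → E N →L[ℝ] E N} (he : ∀ x, HasFDerivAt e (e' x) x)
    (hdet : ∀ x, |(e' x).det| = 1) (hbij : Function.Bijective e)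
    (hper : ∀ x i, e (x + EuclideanSpace.single i (1 : ℝ)) = e x + EuclideanSpace.single i (1 : ℝ))
    {g : E N → F} (hg : IsPeriodic g) :
    ∫ x in cell N, g (e x) = ∫ x in cell N, g x := by
  have hadd : ∀ k ∈ intLattice N, ∀ x, e (x + k) = e x + k := by
    intro k hk x
    have : IsPeriodic fun x => e x - x := fun x i => by
      simp only [hper]; abel
    have := this.add_mem hk x
    rw [sub_eq_sub_iff_add_eq_add] at this
    rw [← add_left_inj x, this]; abel
  -- Since `e` commutes with lattice translations, it maps one fundamental domain to another, and a
  -- periodic function has the same integral over both. The change of variables with unit Jacobian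
  -- then finishes.
  have hdom : IsAddFundamentalDomain (intLattice N) (e '' cell N) volume := by
    refine IsAddFundamentalDomain.mk' ?_ fun x => ?_
    · refine (measurableSet_cell.image_of_continuousOn_injOn ?_ hbij.1.injOn).nullMeasurableSet
      exact fun x _ => (he x).continuousAt.continuousWithinAt
    · obtain ⟨y, rfl⟩ := hbij.2 x
      have key : ∀ k : intLattice N, k +ᵥ e y ∈ e '' cell N ↔
          k +ᵥ y ∈ ZSpan.fundamentalDomain (EuclideanSpace.basisFun (Fin N) ℝ).toBasis := by
        intro k
        have h : k +ᵥ e y = e (k +ᵥ y) := by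
          rw [Submodule.vadd_def, Submodule.vadd_def, vadd_eq_add, vadd_eq_add, add_comm,
            add_comm _ y, hadd _ k.2]
        rw [h, hbij.1.mem_set_image, cell_eq_fundamentalDomain]
      simp only [key]
      exact ZSpan.exist_unique_vadd_mem_fundamentalDomain _ y
  rw [← hdom.setIntegral_eq isAddFundamentalDomain_cell (f := g) ?_,
    integral_image_eq_integral_abs_det_fderiv_smul volume measurableSet_cell
      (fun x _ => (he x).hasFDerivWithinAt) hbij.1.injOn]
  · simp [hdet]
  · intro k x
    rw [Submodule.vadd_def, vadd_eq_add, add_comm, hg.add_mem k.2]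

theorem setIntegral_cell_add {F : Type} [NormedAddCommGroup F] [NormedSpace ℝ F]
    {g : E N → F} (hg : IsPeriodic g) (y : E N) :
    ∫ x in cell N, g (x + y) = ∫ x in cell N, g x :=
  setIntegral_cell_comp (e := fun x => x + y) (e' := fun _ => ContinuousLinearMap.id ℝ (E N))
    (fun x => (hasFDerivAt_id x).add_const y) (fun x => by simp [ContinuousLinearMap.det])
    (AddGroup.addRight_bijective y) (fun x i => by abel) hg

theorem IsPeriodic.fderiv {F : Type} [NormedAddCommGroup F] [NormedSpace ℝ F] {f : E N → F}
    (hf : IsPeriodic f) : IsPeriodic (fderiv ℝ f) := by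
  intro x i
  rw [← fderiv_comp_add_right]
  congr 1
  exact funext fun y => hf y i

/-- By translation invariance `s ↦ ∫ h(x + s v) dx` is constant; differentiate under the integral at
`s = 0`. All integrations by parts on the torus rest on this. -/
theorem setIntegral_cell_fderiv {F : Type} [NormedAddCommGroup F] [NormedSpace ℝ F] {h : E N → F}
    (hh : ContDiff ℝ 1 h) (hp : IsPeriodic h) (v : E N) : ∫ x in cell N, fderiv ℝ h x v = 0 := by
  obtain ⟨C, hC⟩ := hp.fderiv.exists_bound (hh.continuous_fderiv one_ne_zero)
  have hd := (hasDerivAt_integral_of_dominated_loc_of_deriv_le (μ := volume.restrict (cell N))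
    (F := fun (s : ℝ) x => h (x + s • v)) (F' := fun (s : ℝ) x => fderiv ℝ h (x + s • v) v)
    (x₀ := 0) (bound := fun _ => C * ‖v‖) (s := univ) Filter.univ_mem
    (Filter.Eventually.of_forall fun s =>
      (integrable_cell (by have := hh.continuous; fun_prop)).aestronglyMeasurable)
    (integrable_cell (by have := hh.continuous; fun_prop))
    (integrable_cell (by
      have := hh.continuous_fderiv one_ne_zero
      fun_prop)).aestronglyMeasurable
    (Filter.Eventually.of_forall fun x s _ =>
      (ContinuousLinearMap.le_opNorm _ _).trans (by gcongr; exact hC _))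
    (integrable_const _)
    (Filter.Eventually.of_forall fun x s _ => by
      have h1 : HasFDerivAt h (_root_.fderiv ℝ h (x + s • v)) (x + s • v) :=
        (hh.differentiable one_ne_zero _).hasFDerivAt
      have h2 : HasDerivAt (fun s : ℝ => x + s • v) v s := by
        simpa using ((hasDerivAt_id s).smul_const v).const_add x
      exact h1.comp_hasDerivAt s h2)).2
  have hconst : (fun s : ℝ => ∫ x in cell N, h (x + s • v)) = fun _ => ∫ x in cell N, h x :=
    funext fun s => setIntegral_cell_add hp _
  rw [hconst] at hd
  simpa using hd.unique (hasDerivAt_const _ _)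

theorem continuous_divergence {b : E N → E N} (hb : ContDiff ℝ 1 b) :
    Continuous (divergence b) := by
  have := hb.continuous_fderiv one_ne_zero
  unfold divergence
  fun_prop

theorem sum_smul_single (y : E N) : ∑ j, y j • EuclideanSpace.single j (1 : ℝ) = y := by
  simpa using (EuclideanSpace.basisFun (Fin N) ℝ).sum_repr y

/-- Integration by parts on the torus: `∫ b·∇h = - ∫ h div b`. -/
theorem setIntegral_cell_fderiv_field {h : E N → ℝ} (hh : ContDiff ℝ 1 h) (hp : IsPeriodic h)
    {b : E N → E N} (hb : ContDiff ℝ 1 b) (hbp : IsPeriodic b) :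
    ∫ x in cell N, fderiv ℝ h x (b x) = -∫ x in cell N, h x * divergence b x := by
  have hcomp : ∀ j, ContDiff ℝ 1 fun x => b x j := fun j =>
    (EuclideanSpace.proj (𝕜 := ℝ) j).contDiff.comp hb
  have key : ∀ j, ∫ x in cell N, fderiv ℝ (fun x => h x * b x j) x (EuclideanSpace.single j 1) = 0 :=
    fun j => setIntegral_cell_fderiv (hh.mul (hcomp j)) (fun x i => by
      simp only [hp x i, hbp x i]) _
  have hs : ∑ j, ∫ x in cell N, fderiv ℝ (fun x => h x * b x j) x (EuclideanSpace.single j 1) = 0 :=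
    Finset.sum_eq_zero fun j _ => key j
  rw [← integral_finsetSum] at hs
  · have hpt : ∀ x, ∑ j, fderiv ℝ (fun x => h x * b x j) x (EuclideanSpace.single j 1) =
        fderiv ℝ h x (b x) + h x * divergence b x := by
      intro x
      have h1 : ∀ j, fderiv ℝ (fun x => h x * b x j) x (EuclideanSpace.single j 1) =
          b x j * fderiv ℝ h x (EuclideanSpace.single j 1) +
            h x * (fderiv ℝ b x (EuclideanSpace.single j 1)) j := by
        intro j
        have hbj : HasFDerivAt (fun x => b x j)
            ((EuclideanSpace.proj (𝕜 := ℝ) j).comp (fderiv ℝ b x)) x :=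
          (EuclideanSpace.proj (𝕜 := ℝ) j).hasFDerivAt.comp x
            (hb.differentiable one_ne_zero x).hasFDerivAt
        have hm : HasFDerivAt (fun x => h x * b x j) _ x :=
          (hh.differentiable one_ne_zero x).hasFDerivAt.mul hbj
        rw [hm.fderiv]
        simp [add_comm]
      simp_rw [h1, Finset.sum_add_distrib, ← Finset.mul_sum, divergence]
      congr 1
      conv_rhs => rw [← sum_smul_single (b x), map_sum]
      simp
    simp_rw [hpt] at hs
    rw [integral_add] at hs
    · linarith
    · have := hh.continuous_fderiv one_ne_zero
      have := hb.continuous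
      exact integrable_cell (by fun_prop)
    · exact integrable_cell (hh.continuous.mul (continuous_divergence hb))
  · intro j _
    have := (hh.mul (hcomp j)).continuous_fderiv one_ne_zero
    exact integrable_cell (by fun_prop)

theorem IsPeriodic.inner {f g : E N → E N} (hf : IsPeriodic f) (hg : IsPeriodic g) :
    IsPeriodic fun x => inner ℝ (f x) (g x) := fun x i => by simp only [hf x i, hg x i]

theorem IsPeriodic.fderiv_apply {F : Type} [NormedAddCommGroup F] [NormedSpace ℝ F] {f : E N → F}
    (hf : IsPeriodic f) {b : E N → E N} (hb : IsPeriodic b) :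
    IsPeriodic fun x => _root_.fderiv ℝ f x (b x) := fun x i => by
  simp only [hf.fderiv x i, hb x i]

/-- Skew-symmetry of `b·∇` for a divergence-free `b`. -/
theorem setIntegral_cell_inner_fderiv {f g : E N → E N} (hf : ContDiff ℝ 1 f) (hfp : IsPeriodic f)
    (hg : ContDiff ℝ 1 g) (hgp : IsPeriodic g) {b : E N → E N} (hb : ContDiff ℝ 1 b)
    (hbp : IsPeriodic b) (hdiv : ∀ x, divergence b x = 0) :
    ∫ x in cell N, inner ℝ (fderiv ℝ f x (b x)) (g x) =
      -∫ x in cell N, inner ℝ (f x) (fderiv ℝ g x (b x)) := by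
  have h := setIntegral_cell_fderiv_field (hf.inner ℝ hg) (hfp.inner hgp) hb hbp
  have hpt : ∀ x, fderiv ℝ (fun x => (inner ℝ (f x) (g x) : ℝ)) x (b x) =
      inner ℝ (f x) (fderiv ℝ g x (b x)) + inner ℝ (fderiv ℝ f x (b x)) (g x) := fun x =>
    fderiv_inner_apply ℝ (hf.differentiable one_ne_zero x) (hg.differentiable one_ne_zero x) _
  have c1 := hf.continuous_fderiv one_ne_zero
  have c2 := hg.continuous_fderiv one_ne_zero
  have c3 := hb.continuous
  have c4 := hf.continuous
  have c5 := hg.continuous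
  simp_rw [hpt, hdiv] at h
  rw [integral_add (integrable_cell (by fun_prop)) (integrable_cell (by fun_prop))] at h
  simp only [mul_zero, integral_zero, neg_zero] at h
  linarith

theorem divergence_const (v : E N) (x : E N) : divergence (fun _ => v) x = 0 := by
  simp [divergence]

theorem isPeriodic_const {F : Type} (v : F) : IsPeriodic fun _ : E N => v := fun _ _ => rfl

theorem laplacian_eq_sum_fderiv {F : Type} [NormedAddCommGroup F] [NormedSpace ℝ F] {f : E N → F}
    {x : E N} (hf : ContDiffAt ℝ 2 f x) : (Δ f) x =
      ∑ j, fderiv ℝ (fun y => fderiv ℝ f y (EuclideanSpace.single j (1 : ℝ))) x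
        (EuclideanSpace.single j (1 : ℝ)) := by
  rw [InnerProductSpace.laplacian_eq_iteratedFDeriv_orthonormalBasis f (EuclideanSpace.basisFun (Fin N) ℝ)]
  refine Finset.sum_congr rfl fun j _ => ?_
  have hd : DifferentiableAt ℝ (fderiv ℝ f) x :=
    (hf.fderiv_right (m := 1) (by norm_num)).differentiableAt one_ne_zero
  rw [iteratedFDeriv_two_apply, fderiv_clm_apply hd (differentiableAt_const _)]
  simp

theorem continuous_laplacian {F : Type} [NormedAddCommGroup F] [NormedSpace ℝ F] {f : E N → F}
    (hf : ContDiff ℝ 2 f) : Continuous (Δ f) := by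
  have : Δ f = fun x => ∑ j, fderiv ℝ (fun y => fderiv ℝ f y (EuclideanSpace.single j (1 : ℝ))) x
        (EuclideanSpace.single j (1 : ℝ)) := funext fun x => laplacian_eq_sum_fderiv hf.contDiffAt
  rw [this]
  refine continuous_finsetSum _ fun j _ => ?_
  have h1 : ContDiff ℝ 1 fun y => fderiv ℝ f y (EuclideanSpace.single j (1 : ℝ)) :=
    (hf.fderiv_right (m := 1) (by norm_num)).clm_apply contDiff_const
  have := h1.continuous_fderiv one_ne_zero
  fun_prop

theorem IsPeriodic.laplacian {F : Type} [NormedAddCommGroup F] [NormedSpace ℝ F] {f : E N → F}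
    (hf : ContDiff ℝ 2 f) (hp : IsPeriodic f) : IsPeriodic (Δ f) := by
  intro x i
  rw [laplacian_eq_sum_fderiv hf.contDiffAt, laplacian_eq_sum_fderiv hf.contDiffAt]
  exact Finset.sum_congr rfl fun j _ =>
    (hp.fderiv_apply (isPeriodic_const _)).fderiv_apply (isPeriodic_const _) x i

/-- Green's identity `∫ ⟨f, Δφ⟩ = - ∑ j, ∫ ⟨∂_j f, ∂_j φ⟩` on the torus. -/
theorem setIntegral_cell_inner_laplacian {f φ : E N → E N} (hf : ContDiff ℝ 1 f)
    (hfp : IsPeriodic f) (hφ : ContDiff ℝ 2 φ) (hφp : IsPeriodic φ) :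
    ∫ x in cell N, inner ℝ (f x) ((Δ φ) x) =
      -∑ j, ∫ x in cell N, inner ℝ (fderiv ℝ f x (EuclideanSpace.single j (1 : ℝ)))
        (fderiv ℝ φ x (EuclideanSpace.single j (1 : ℝ))) := by
  have h1 : ∀ j, ContDiff ℝ 1 fun y => fderiv ℝ φ y (EuclideanSpace.single j (1 : ℝ)) := fun j =>
    (hφ.fderiv_right (m := 1) (by norm_num)).clm_apply contDiff_const
  simp_rw [laplacian_eq_sum_fderiv hφ.contDiffAt, inner_sum]
  rw [integral_finsetSum, ← Finset.sum_neg_distrib]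
  · refine Finset.sum_congr rfl fun j _ => ?_
    have := setIntegral_cell_inner_fderiv hf hfp (h1 j) (hφp.fderiv_apply (isPeriodic_const _))
      contDiff_const (isPeriodic_const (EuclideanSpace.single j (1 : ℝ))) (divergence_const _)
    rw [this, neg_neg]
  · intro j _
    have := (h1 j).continuous_fderiv one_ne_zero
    have := hf.continuous
    exact integrable_cell (by fun_prop)

theorem setIntegral_cell_laplacian_inner {f φ : E N → E N} (hf : ContDiff ℝ 2 f)
    (hfp : IsPeriodic f) (hφ : ContDiff ℝ 2 φ) (hφp : IsPeriodic φ) :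
    ∫ x in cell N, inner ℝ ((Δ f) x) (φ x) = ∫ x in cell N, inner ℝ (f x) ((Δ φ) x) := by
  have h := setIntegral_cell_inner_laplacian (hφ.of_le one_le_two) hφp hf hfp
  rw [setIntegral_cell_inner_laplacian (hf.of_le one_le_two) hfp hφ hφp]
  simp_rw [real_inner_comm _ (φ _)] at h
  rw [h]
  simp_rw [real_inner_comm]

end Cell

/-! ### Smoothness of superposition operators on spaces of curves. -/

section Nemytskii

variable {K : Type} [TopologicalSpace K] [CompactSpace K]
  {V F : Type} [NormedAddCommGroup V] [NormedSpace ℝ V] [NormedAddCommGroup F] [NormedSpace ℝ F]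

/-- Pointwise application of a curve of continuous linear maps to a curve of vectors. -/
def applyCurve : C(K, V →L[ℝ] F) →L[ℝ] C(K, V) →L[ℝ] C(K, F) :=
  LinearMap.mkContinuous₂
    (LinearMap.mk₂ ℝ (fun (A : C(K, V →L[ℝ] F)) (γ : C(K, V)) =>
      (⟨fun t => A t (γ t), by fun_prop⟩ : C(K, F)))
      (fun _ _ _ => by ext; simp) (fun _ _ _ => by ext; simp)
      (fun _ _ _ => by ext; simp) (fun _ _ _ => by ext; simp)) 1
    (fun A γ => by
      rw [one_mul, ContinuousMap.norm_le _ (by positivity)]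
      exact fun t => (ContinuousLinearMap.le_opNorm _ _).trans
        (mul_le_mul (A.norm_coe_le_norm t) (γ.norm_coe_le_norm t) (norm_nonneg _) (norm_nonneg A)))

@[simp]
theorem applyCurve_apply (A : C(K, V →L[ℝ] F)) (γ : C(K, V)) (t : K) :
    applyCurve A γ t = A t (γ t) := rfl

theorem norm_applyCurve_le (A : C(K, V →L[ℝ] F)) : ‖applyCurve A‖ ≤ ‖A‖ := by
  refine ContinuousLinearMap.opNorm_le_bound _ (norm_nonneg A) fun γ => ?_
  rw [ContinuousMap.norm_le _ (by positivity)]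
  exact fun t => (ContinuousLinearMap.le_opNorm _ _).trans
        (mul_le_mul (A.norm_coe_le_norm t) (γ.norm_coe_le_norm t) (norm_nonneg _) (norm_nonneg A))

/-- The superposition operator `γ ↦ (t ↦ g (τ t, γ t))` on curves. -/
def superposition (τ : C(K, ℝ)) (g : C(ℝ × V, F)) (γ : C(K, V)) : C(K, F) :=
  g.comp (τ.prodMk γ)

theorem continuous_superposition (τ : C(K, ℝ)) (g : C(ℝ × V, F)) :
    Continuous (superposition τ g) := by
  refine (ContinuousMap.continuous_postcomp g).comp ?_
  refine (LipschitzWith.of_dist_le_mul (K := 1) fun γ η => ?_).continuous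
  rw [NNReal.coe_one, one_mul, ContinuousMap.dist_le dist_nonneg]
  intro t
  simpa [Prod.dist_eq] using ContinuousMap.dist_apply_le_dist t

/-- The derivative in the second variable of a `C^1` function on `ℝ × V`. -/
def sndDeriv (g : C(ℝ × V, F)) (hg : ContDiff ℝ 1 g) : C(ℝ × V, V →L[ℝ] F) :=
  ⟨fun p => (fderiv ℝ g p).comp (ContinuousLinearMap.inr ℝ ℝ V),
    (hg.continuous_fderiv one_ne_zero).clm_comp continuous_const⟩

theorem hasFDerivAt_snd {g : C(ℝ × V, F)} (hg : ContDiff ℝ 1 g) (t : ℝ) (x : V) :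
    HasFDerivAt (fun y => g (t, y)) (sndDeriv g hg (t, x)) x :=
  (hg.differentiable one_ne_zero (t, x)).hasFDerivAt.comp x (hasFDerivAt_prodMk_right t x)

/-- The mean value inequality at each time gives the estimate, and it is uniform in time because the
superposition operator of the derivative is continuous in the sup norm. -/
theorem hasFDerivAt_superposition (τ : C(K, ℝ)) {g : C(ℝ × V, F)} (hg : ContDiff ℝ 1 g)
    (γ : C(K, V)) :
    HasFDerivAt (superposition τ g) (applyCurve (superposition τ (sndDeriv g hg) γ)) γ := by
  rw [hasFDerivAt_iff_isLittleO, Asymptotics.isLittleO_iff]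
  intro c hc
  have hcont := (continuous_superposition τ (sndDeriv g hg)).continuousAt (x := γ)
  obtain ⟨δ, hδ, hball⟩ := Metric.continuousAt_iff.1 hcont c hc
  -- Shifting `γ` by a constant curve `k` turns continuity in the sup norm into a bound at all times
  -- at once.
  have hder : ∀ t : K, ∀ k : V, ‖k‖ < δ →
      ‖sndDeriv g hg (τ t, γ t + k) - sndDeriv g hg (τ t, γ t)‖ ≤ c := by
    intro t k hk
    have h1 : dist (γ + ContinuousMap.const K k) γ < δ := by
      rw [dist_eq_norm, add_sub_cancel_left]
      exact ((ContinuousMap.norm_le _ (norm_nonneg k)).2 fun _ => le_rfl).trans_lt hk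
    have h2 := (hball h1).le
    rw [dist_eq_norm] at h2
    exact (ContinuousMap.norm_coe_le_norm
      (superposition τ (sndDeriv g hg) (γ + ContinuousMap.const K k) -
        superposition τ (sndDeriv g hg) γ) t).trans h2
  filter_upwards [Metric.ball_mem_nhds γ hδ] with η hη
  rw [ContinuousMap.norm_le _ (by positivity)]
  intro t
  have hηt : ‖η t - γ t‖ < δ := by
    rw [Metric.mem_ball, dist_eq_norm] at hη
    exact (ContinuousMap.norm_coe_le_norm (η - γ) t).trans_lt hη
  have := (convex_ball (γ t) δ).norm_image_sub_le_of_norm_hasFDerivWithin_le'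
    (f := fun y => g (τ t, y)) (f' := fun y => sndDeriv g hg (τ t, y))
    (φ := sndDeriv g hg (τ t, γ t)) (C := c) (x := γ t) (y := η t)
    (fun y _ => (hasFDerivAt_snd hg _ y).hasFDerivWithinAt)
    (fun y hy => by
      have := hder t (y - γ t) (by rwa [← dist_eq_norm])
      rwa [add_sub_cancel] at this)
    (Metric.mem_ball_self hδ) (by rwa [Metric.mem_ball, dist_eq_norm])
  refine (le_of_eq ?_).trans (this.trans ?_)
  · rfl
  · gcongr
    exact ContinuousMap.norm_coe_le_norm (η - γ) t

theorem contDiff_sndDeriv {g : C(ℝ × V, F)} (hg : ContDiff ℝ ∞ g) :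
    ContDiff ℝ ∞ (sndDeriv g (hg.of_le (by simp))) :=
  (hg.fderiv_right (m := ∞) (by simp)).clm_comp contDiff_const

/-- The derivative is again a superposition operator, followed by the bounded linear map
`applyCurve`. The codomain changes from `F` to `V →L[ℝ] F`, hence the generalization in the
induction. -/
theorem contDiff_superposition (τ : C(K, ℝ)) {g : C(ℝ × V, F)} (hg : ContDiff ℝ ∞ g) (n : ℕ) :
    ContDiff ℝ n (superposition τ g) := by
  induction n generalizing F with
  | zero => exact contDiff_zero.2 (continuous_superposition τ g)
  | succ n ih =>
    push_cast
    rw [contDiff_succ_iff_fderiv]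
    have hg1 : ContDiff ℝ 1 g := hg.of_le (by simp)
    have hd := hasFDerivAt_superposition τ hg1
    refine ⟨fun γ => (hd γ).differentiableAt, by simp, ?_⟩
    have : fderiv ℝ (superposition τ g) =
        fun γ => applyCurve (superposition τ (sndDeriv g hg1) γ) := funext fun γ => (hd γ).fderiv
    rw [this]
    exact applyCurve.contDiff.comp (ih (contDiff_sndDeriv hg))

end Nemytskii

/-! ### The equation `γ = x + ε ∫ f(s, γ_s) ds` and its dependence on `(x, ε)`. -/

section IntegralEquation

variable {V : Type} [NormedAddCommGroup V] [NormedSpace ℝ V]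

/-- The primitive vanishing at `0` of a curve on `[0,T]`. -/
def primitive {T : ℝ} (hT : 0 ≤ T) : C(Icc 0 T, V) →L[ℝ] C(Icc 0 T, V) :=
  LinearMap.mkContinuous
    { toFun := fun γ => ⟨fun t => ∫ s in (0 : ℝ)..t, IccExtend hT γ s, by
        have h : Continuous (IccExtend hT γ) := γ.continuous.Icc_extend'
        exact (intervalIntegral.continuous_primitive (fun a b => h.intervalIntegrable a b) 0).comp
          continuous_subtype_val⟩
      map_add' := fun γ η => by
        ext t
        exact intervalIntegral.integral_add
          (γ.continuous.Icc_extend'.intervalIntegrable _ _)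
          (η.continuous.Icc_extend'.intervalIntegrable _ _)
      map_smul' := fun c γ => by
        ext t
        exact intervalIntegral.integral_smul c _ } T
    (fun γ => by
      rw [ContinuousMap.norm_le _ (by positivity)]
      intro t
      have := intervalIntegral.norm_integral_le_of_norm_le_const (a := 0) (b := t) (C := ‖γ‖)
        (f := IccExtend hT γ) fun s _ => γ.norm_coe_le_norm _
      refine this.trans ?_
      rw [sub_zero, abs_of_nonneg t.2.1, mul_comm]
      gcongr
      exact t.2.2)

theorem primitive_apply {T : ℝ} (hT : 0 ≤ T) (γ : C(Icc 0 T, V)) (t : Icc 0 T) :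
    primitive hT γ t = ∫ s in (0 : ℝ)..t, IccExtend hT γ s := rfl

theorem norm_primitive_le {T : ℝ} (hT : 0 ≤ T) : ‖primitive (V := V) hT‖ ≤ T :=
  LinearMap.mkContinuous_norm_le _ hT _

/-- The inclusion of `[0,T]` into `ℝ`. -/
def timeCurve (T : ℝ) : C(Icc 0 T, ℝ) := ⟨Subtype.val, continuous_subtype_val⟩

/-- Constant curves. -/
def constCurve (T : ℝ) : V →L[ℝ] C(Icc 0 T, V) :=
  LinearMap.mkContinuous
    { toFun := fun x => ContinuousMap.const _ x
      map_add' := fun _ _ => rfl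
      map_smul' := fun _ _ => rfl } 1
    (fun x => by
      rw [one_mul, ContinuousMap.norm_le _ (norm_nonneg x)]
      exact fun _ => le_rfl)

@[simp]
theorem constCurve_apply (T : ℝ) (x : V) (t : Icc 0 T) : constCurve T x t = x := rfl

variable {T : ℝ} (hT : 0 ≤ T) {f : C(ℝ × V, V)} (hf : ContDiff ℝ ∞ f)

theorem norm_superposition_sub_le {κ : ℝ} (hf1 : ContDiff ℝ 1 f)
    (hκ : ∀ t ∈ Icc 0 T, ∀ x, ‖sndDeriv f hf1 (t, x)‖ ≤ κ) (γ η : C(Icc 0 T, V)) :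
    ‖superposition (timeCurve T) f γ - superposition (timeCurve T) f η‖ ≤ κ * ‖γ - η‖ := by
  by_cases hne : Nonempty (Icc (0 : ℝ) T)
  · have h0 : 0 ≤ κ := (norm_nonneg _).trans (hκ _ hne.some.2 0)
    rw [ContinuousMap.norm_le _ (by positivity)]
    intro t
    refine (convex_univ.norm_image_sub_le_of_norm_hasFDerivWithin_le
      (f := fun y => f (t, y)) (f' := fun y => sndDeriv f hf1 (t, y)) (C := κ) (x := η t) (y := γ t)
      (fun y _ => (hasFDerivAt_snd hf1 _ y).hasFDerivWithinAt) (fun y _ => hκ t t.2 y)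
      (mem_univ _) (mem_univ _)).trans ?_
    gcongr
    exact ContinuousMap.norm_coe_le_norm (γ - η) t
  · have : Subsingleton C(Icc (0 : ℝ) T, V) := ⟨fun a b => ContinuousMap.ext fun t => (hne ⟨t⟩).elim⟩
    rw [Subsingleton.elim γ η]; simp

/-- The right-hand side is a contraction with factor `|ε| T κ`. This uniqueness identifies solutions
with the implicit function and gives equivariance of the flow under integer translations. -/
theorem eq_of_integral_equation {κ : ℝ} (hf1 : ContDiff ℝ 1 f)
    (hκ : ∀ t ∈ Icc 0 T, ∀ x, ‖sndDeriv f hf1 (t, x)‖ ≤ κ) {ε : ℝ} (hε : |ε| * (T * κ) < 1)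
    {c γ η : C(Icc 0 T, V)} (hγ : γ = c + ε • primitive hT (superposition (timeCurve T) f γ))
    (hη : η = c + ε • primitive hT (superposition (timeCurve T) f η)) : γ = η := by
  have h1 : ‖γ - η‖ ≤ |ε| * (T * κ) * ‖γ - η‖ := by
    have : γ - η = ε • primitive hT (superposition (timeCurve T) f γ -
        superposition (timeCurve T) f η) := by
      rw [map_sub, smul_sub]
      nth_rewrite 1 [hγ]
      nth_rewrite 1 [hη]
      abel
    nth_rewrite 1 [this]
    rw [norm_smul, Real.norm_eq_abs, mul_assoc]
    gcongr
    refine (ContinuousLinearMap.le_opNorm _ _).trans ?_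
    rw [mul_assoc]
    exact mul_le_mul (norm_primitive_le hT) (norm_superposition_sub_le hf1 hκ γ η)
      (norm_nonneg _) hT
  have h2 : ‖γ - η‖ ≤ 0 := by nlinarith [norm_nonneg (γ - η)]
  exact sub_eq_zero.1 (norm_le_zero_iff.1 h2)

/-- Smooth dependence on parameters of the solution `γ` of `γ = x + ε ∫ f(s, γ_s) ds`. -/
theorem contDiffAt_of_integral_equation [CompleteSpace V] (hf : ContDiff ℝ ∞ f) {κ : ℝ}
    (hκ : ∀ t ∈ Icc 0 T, ∀ x, ‖sndDeriv f (hf.of_le (by simp)) (t, x)‖ ≤ κ)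
    {γ : V × ℝ → C(Icc 0 T, V)}
    (hγ : ∀ p, γ p = constCurve T p.1 + p.2 • primitive hT (superposition (timeCurve T) f (γ p)))
    {p : V × ℝ} (hp : |p.2| * (T * κ) < 1) {n : ℕ} (hn : n ≠ 0) : ContDiffAt ℝ n γ p := by
  have hf1 : ContDiff ℝ 1 f := hf.of_le (by simp)
  -- Solutions are the zeros of `Φ`, to which the implicit function theorem is applied at `(p, γ
  -- p)`. The partial derivative in the curve is `1 - A` with `‖A‖ ≤ |ε| T κ < 1`, invertible by the
  -- Neumann series.
  set Φ : (V × ℝ) × C(Icc 0 T, V) → C(Icc 0 T, V) := fun z =>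
    z.2 - constCurve T z.1.1 - z.1.2 • primitive hT (superposition (timeCurve T) f z.2) with hΦ
  have hn' : (n : WithTop ℕ∞) ≠ 0 := by exact_mod_cast hn
  have hcd : ContDiff ℝ n Φ := by
    have := (contDiff_superposition (timeCurve T) hf n).comp
      (contDiff_snd : ContDiff ℝ n (Prod.snd : (V × ℝ) × C(Icc 0 T, V) → _))
    have h2 := (primitive (V := V) hT).contDiff (n := n) |>.comp this
    have h3 := (constCurve (V := V) T).contDiff (n := n) |>.comp
      ((contDiff_fst (E := V) (F := ℝ)).comp
        (contDiff_fst : ContDiff ℝ n (Prod.fst : (V × ℝ) × C(Icc 0 T, V) → _)))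
    exact (contDiff_snd.sub h3).sub ((contDiff_snd.comp contDiff_fst).smul h2)
  set A : C(Icc 0 T, V) →L[ℝ] C(Icc 0 T, V) :=
    p.2 • (primitive hT).comp (applyCurve (superposition (timeCurve T) (sndDeriv f hf1) (γ p)))
    with hA
  have hAn : ‖A‖ < 1 := by
    by_cases hne : Nonempty (Icc (0 : ℝ) T)
    · have h0 : 0 ≤ κ := (norm_nonneg _).trans (hκ _ hne.some.2 0)
      refine lt_of_le_of_lt ?_ hp
      refine (ContinuousLinearMap.opNorm_smul_le _ _).trans ?_
      rw [Real.norm_eq_abs]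
      gcongr
      refine (ContinuousLinearMap.opNorm_comp_le _ _).trans ?_
      refine mul_le_mul (norm_primitive_le hT) ((norm_applyCurve_le _).trans ?_)
        (norm_nonneg _) hT
      rw [ContinuousMap.norm_le _ h0]
      exact fun t => hκ t t.2 _
    · exact absurd ⟨0, le_rfl, hT⟩ hne
  have hpart : (fderiv ℝ Φ (p, γ p)).comp (ContinuousLinearMap.inr ℝ (V × ℝ) C(Icc 0 T, V)) =
      1 - A := by
    have h1 : HasFDerivAt (fun η => Φ (p, η))
        ((fderiv ℝ Φ (p, γ p)).comp (ContinuousLinearMap.inr ℝ (V × ℝ) C(Icc 0 T, V))) (γ p) :=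
      (hcd.differentiable hn' (p, γ p)).hasFDerivAt.comp (γ p) (hasFDerivAt_prodMk_right p (γ p))
    have h2 : HasFDerivAt (fun η => Φ (p, η)) (1 - A) (γ p) :=
      (((hasFDerivAt_id (𝕜 := ℝ) (γ p)).sub_const (constCurve T p.1)).sub
        (((primitive hT).hasFDerivAt.comp (γ p)
          (hasFDerivAt_superposition (timeCurve T) hf1 (γ p))).const_smul p.2) :)
    exact h1.unique h2
  have hinv : ((fderiv ℝ Φ (p, γ p)).comp
      (ContinuousLinearMap.inr ℝ (V × ℝ) C(Icc 0 T, V))).IsInvertible := by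
    rw [hpart]
    exact ⟨ContinuousLinearEquiv.unitsEquiv ℝ _ (Units.oneSub A hAn), rfl⟩
  have hzero : Φ (p, γ p) = 0 := by
    simp only [hΦ]
    nth_rewrite 1 [hγ p]
    abel
  have cdf : ContDiffAt ℝ n Φ (p, γ p) := hcd.contDiffAt
  refine (cdf.contDiffAt_implicitFunction hn' hinv).congr_of_eventuallyEq ?_
  -- No continuity of `γ` is assumed: near `p` the implicit function solves the same integral
  -- equation, so it equals `γ` by uniqueness.
  have hopen : ∀ᶠ q : V × ℝ in nhds p, |q.2| * (T * κ) < 1 :=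
    ContinuousAt.eventually_lt (by fun_prop) continuousAt_const hp
  filter_upwards [cdf.eventually_apply_implicitFunction hn' hinv, hopen] with q hq hq2
  refine eq_of_integral_equation hT hf1 hκ hq2 (hγ q) ?_
  rw [hzero] at hq
  exact sub_eq_zero.1 ((sub_sub _ _ _).symm.trans hq)

end IntegralEquation

/-! ### Global existence for periodic velocities. -/

section GlobalFlow

variable {N : ℕ}

/-- Periodicity makes `f` bounded and Lipschitz in space, uniformly over compact time intervals, so
Picard–Lindelöf applies on every `[-(n+1), n+1]`; uniqueness glues the solutions. -/
theorem exists_solution_of_isPeriodic {f : C(ℝ × E N, E N)} (hf : ContDiff ℝ 1 f)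
    (hp : ∀ t, IsPeriodic fun x => f (t, x)) (x : E N) :
    ∃ α : ℝ → E N, α 0 = x ∧ ∀ t, HasDerivAt α (f (t, α t)) t := by
  have hb : ∀ n : ℕ, ∃ C, ∀ t ∈ Icc (-(n + 1 : ℝ)) (n + 1), ∀ x, ‖f (t, x)‖ ≤ C := fun n =>
    exists_bound_of_isPeriodic hp f.continuous isCompact_Icc
  have hps : ∀ t, IsPeriodic fun x => sndDeriv f hf (t, x) := fun t => by
    have : (fun x => sndDeriv f hf (t, x)) = fderiv ℝ fun x => f (t, x) :=
      funext fun x => ((hasFDerivAt_snd hf t x).fderiv).symm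
    rw [this]
    exact (hp t).fderiv
  have hl : ∀ n : ℕ, ∃ K : NNReal, ∀ t ∈ Icc (-(n + 1 : ℝ)) (n + 1),
      LipschitzWith K fun x => f (t, x) := fun n => by
    obtain ⟨C, hC⟩ := exists_bound_of_isPeriodic hps (sndDeriv f hf).continuous
      (isCompact_Icc (a := -(n + 1 : ℝ)) (b := n + 1))
    refine ⟨C.toNNReal, fun t ht => ?_⟩
    rw [← lipschitzOnWith_univ]
    refine convex_univ.lipschitzOnWith_of_nnnorm_hasFDerivWithin_le
      (fun y _ => (hasFDerivAt_snd hf t y).hasFDerivWithinAt) fun y _ => ?_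
    rw [← NNReal.coe_le_coe, coe_nnnorm]
    exact (hC t ht y).trans (Real.le_coe_toNNReal C)
  choose K hK using hl
  have hsol : ∀ n : ℕ, ∃ α : ℝ → E N, α 0 = x ∧
      ∀ t ∈ Ioo (-(n + 1 : ℝ)) (n + 1), HasDerivAt α (f (t, α t)) t := by
    intro n
    obtain ⟨C, hC⟩ := hb n
    have h0 : (0 : ℝ) ∈ Icc (-(n + 1 : ℝ)) (n + 1) := ⟨by linarith [n.cast_nonneg (α := ℝ)],
      by linarith [n.cast_nonneg (α := ℝ)]⟩
    -- The radius `C (n + 1)` is speed bound times half-length of the interval, so the solution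
    -- cannot leave the ball.
    have hpl : IsPicardLindelof (fun t y => f (t, y)) (⟨0, h0⟩ : Icc (-(n + 1 : ℝ)) (n + 1)) x
        (C.toNNReal * (n + 1)) 0 C.toNNReal (K n) :=
      { lipschitzOnWith := fun t ht => (hK n t ht).lipschitzOnWith
        continuousOn := fun y _ => (f.continuous.comp (by fun_prop)).continuousOn
        norm_le := fun t ht y _ => (hC t ht y).trans (Real.le_coe_toNNReal C)
        mul_max_le := by simp }
    obtain ⟨α, hα0, hα⟩ := hpl.exists_eq_forall_mem_Icc_hasDerivWithinAt₀
    exact ⟨α, hα0, fun t ht =>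
      (hα t (Ioo_subset_Icc_self ht)).hasDerivAt (Icc_mem_nhds ht.1 ht.2)⟩
  choose α hα0 hα using hsol
  have hmem : ∀ (n : ℕ) (s : ℝ), |s| < n + 1 → s ∈ Ioo (-(n + 1 : ℝ)) (n + 1) :=
    fun n s hs => abs_lt.1 hs
  have hle : ∀ n m : ℕ, n ≤ m → ∀ s : ℝ, |s| < n + 1 → α n s = α m s := by
    intro n m hnm s hs
    have hnm' : (n : ℝ) ≤ m := by exact_mod_cast hnm
    have hsub : Ioo (-(n + 1 : ℝ)) (n + 1) ⊆ Ioo (-(m + 1 : ℝ)) (m + 1) :=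
      Ioo_subset_Ioo (by linarith) (by linarith)
    exact ODE_solution_unique_of_mem_Ioo (v := fun t y => f (t, y)) (s := fun _ => univ) (K := K n)
      (fun t ht => (hK n t (Ioo_subset_Icc_self ht)).lipschitzOnWith)
      (hmem n 0 (by rw [abs_zero]; positivity))
      (fun t ht => ⟨hα n t ht, mem_univ _⟩) (fun t ht => ⟨hα m t (hsub ht), mem_univ _⟩)
      ((hα0 n).trans (hα0 m).symm) (hmem n s hs)
  have heq : ∀ n m : ℕ, ∀ s : ℝ, |s| < n + 1 → |s| < m + 1 → α n s = α m s := by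
    intro n m s hn hm
    rcases le_total n m with h | h
    · exact hle n m h s hn
    · exact (hle m n h s hm).symm
  -- The index `⌊|t|⌋₊` is admissible since `|t| < ⌊|t|⌋₊ + 1`; near `t` all admissible indices give
  -- the same value.
  refine ⟨fun t => α ⌊|t|⌋₊ t, hα0 _, fun t => ?_⟩
  have ht := Nat.lt_floor_add_one |t|
  refine (hα ⌊|t|⌋₊ t (hmem _ t ht)).congr_of_eventuallyEq ?_
  filter_upwards [continuous_abs.continuousAt.eventually_lt continuousAt_const ht] with s hs
  exact heq _ _ s (Nat.lt_floor_add_one |s|) hs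

end GlobalFlow

/-! ### Liouville's formula for determinants. -/

section Liouville

/-- The determinant as a continuous multilinear function of the rows. -/
def detMultilinear (N : ℕ) : ContinuousMultilinearMap ℝ (fun _ : Fin N => Fin N → ℝ) ℝ :=
  { (Matrix.detRowAlternating (n := Fin N) (R := ℝ)).toMultilinearMap with
    cont := (Continuous.matrix_det continuous_id : Continuous (Matrix.det (n := Fin N) (R := ℝ))) }

/-- The determinant is multilinear in the rows, and row `i` of `A * M` is `∑ k, A i k • M k`. After
substitution into row `i`, every term with `k ≠ i` has a repeated row and vanishes. -/
theorem hasDerivAt_det {N : ℕ} {M : ℝ → Matrix (Fin N) (Fin N) ℝ} {A : Matrix (Fin N) (Fin N) ℝ}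
    {t : ℝ} (hM : ∀ i j, HasDerivAt (fun s => M s i j) ((A * M t) i j) t) :
    HasDerivAt (fun s => (M s).det) (A.trace * (M t).det) t := by
  have h1 : HasDerivAt (fun s => (fun i => M s i : Fin N → Fin N → ℝ))
      (fun i j => (A * M t) i j) t :=
    hasDerivAt_pi.2 fun i => hasDerivAt_pi.2 fun j => hM i j
  have h2 := ((detMultilinear N).hasFDerivAt (fun i => M t i)).comp_hasDerivAt t h1
  refine h2.congr_deriv ?_
  rw [ContinuousMultilinearMap.linearDeriv_apply, Matrix.trace, Finset.sum_mul]
  refine Finset.sum_congr rfl fun i _ => ?_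
  have hrow : (fun j => (A * M t) i j) = ∑ k, A i k • (fun j => M t k j) := by
    ext j
    simp [Matrix.mul_apply, Finset.sum_apply]
  change Matrix.detRowAlternating (Function.update (fun i => M t i) i (fun j => (A * M t) i j)) = _
  rw [hrow, AlternatingMap.map_update_sum, Finset.sum_eq_single i]
  · rw [AlternatingMap.map_update_smul]
    change A i i • Matrix.detRowAlternating (Function.update (fun i => M t i) i (M t i)) = _
    rw [Function.update_eq_self i (fun i => M t i)]
    rfl
  · intro k _ hk
    rw [AlternatingMap.map_update_smul]
    change A i k • Matrix.detRowAlternating (Function.update (fun i => M t i) i (M t k)) = _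
    rw [AlternatingMap.map_update_self _ _ (Ne.symm hk), smul_zero]
  · simp

theorem det_eq_of_trace_eq_zero {N : ℕ} {M A : ℝ → Matrix (Fin N) (Fin N) ℝ} {T : ℝ}
    (hM : ∀ t ∈ Icc 0 T, ∀ i j, HasDerivAt (fun s => M s i j) ((A t * M t) i j) t)
    (hA : ∀ t ∈ Icc 0 T, (A t).trace = 0) {t : ℝ} (ht : t ∈ Icc 0 T) :
    (M t).det = (M 0).det := by
  have hd : ∀ t ∈ Icc 0 T, HasDerivAt (fun s => (M s).det) 0 t := fun t ht => by
    have := hasDerivAt_det (hM t ht)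
    rwa [hA t ht, zero_mul] at this
  exact constant_of_has_deriv_right_zero (fun t ht => (hd t ht).continuousAt.continuousWithinAt)
    (fun t ht => (hd t (Ico_subset_Icc_self ht)).hasDerivWithinAt) t ht

end Liouville

/-! ### Partial derivatives in time and space. -/

section TimeDerivative

variable {V W : Type} [NormedAddCommGroup V] [NormedSpace ℝ V] [NormedAddCommGroup W]
  [NormedSpace ℝ W]

theorem hasDerivAt_fst {w : ℝ × V → W} (hw : ContDiff ℝ 1 w) (t : ℝ) (x : V) :
    HasDerivAt (fun s => w (s, x)) (fderiv ℝ w (t, x) (1, 0)) t := by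
  have := (hw.differentiable one_ne_zero (t, x)).hasFDerivAt.comp_hasDerivAt t
    ((hasDerivAt_id t).prodMk (hasDerivAt_const t x))
  exact this

theorem hasFDerivAt_prod_snd {w : ℝ × V → W} (hw : ContDiff ℝ 1 w) (t : ℝ) (x : V) :
    HasFDerivAt (fun y => w (t, y)) ((fderiv ℝ w (t, x)).comp (ContinuousLinearMap.inr ℝ ℝ V)) x :=
  (hw.differentiable one_ne_zero (t, x)).hasFDerivAt.comp x (hasFDerivAt_prodMk_right t x)

theorem contDiff_deriv_fst {w : ℝ × V → W} {n m : WithTop ℕ∞} (hw : ContDiff ℝ n w)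
    (h : m + 1 ≤ n) : ContDiff ℝ m fun p : ℝ × V => deriv (fun s => w (s, p.2)) p.1 := by
  have h1 : ContDiff ℝ 1 w := hw.of_le (le_trans (by simp) h)
  have : (fun p : ℝ × V => deriv (fun s => w (s, p.2)) p.1) = fun p => fderiv ℝ w p (1, 0) :=
    funext fun p => (hasDerivAt_fst h1 p.1 p.2).deriv
  rw [this]
  exact (hw.fderiv_right h).clm_apply contDiff_const

/-- Time and space derivatives commute. -/
theorem hasDerivAt_fderiv_snd {w : ℝ × V → W} (hw : ContDiff ℝ 2 w) (t : ℝ) (x h : V) :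
    HasDerivAt (fun s => fderiv ℝ (fun y => w (s, y)) x h)
      (fderiv ℝ (fun y => deriv (fun s => w (s, y)) t) x h) t := by
  have h1 : ContDiff ℝ 1 w := hw.of_le one_le_two
  have h2 : ContDiff ℝ 1 (fderiv ℝ w) := hw.fderiv_right (by norm_num)
  have e1 : (fun s => fderiv ℝ (fun y => w (s, y)) x h) = fun s => fderiv ℝ w (s, x) (0, h) := by
    funext s
    rw [(hasFDerivAt_prod_snd h1 s x).fderiv]
    simp
  have e2 : (fun y => deriv (fun s => w (s, y)) t) = fun y => fderiv ℝ w (t, y) (1, 0) :=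
    funext fun y => (hasDerivAt_fst h1 t y).deriv
  have e3 : HasFDerivAt (fun y => fderiv ℝ w (t, y) (1, 0)) _ x :=
    (hasFDerivAt_prod_snd h2 t x).clm_apply (hasFDerivAt_const (1, 0) x)
  rw [e1, e2, e3.fderiv]
  have e4 : HasDerivAt (fun s => fderiv ℝ w (s, x) (0, h)) _ t :=
    (hasDerivAt_fst h2 t x).clm_apply (hasDerivAt_const t (0, h))
  refine e4.congr_deriv ?_
  have hsymm : IsSymmSndFDerivAt ℝ w (t, x) :=
    hw.contDiffAt.isSymmSndFDerivAt (by simp)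
  simpa using hsymm.eq (1, 0) (0, h)

end TimeDerivative

/-! ### The velocity `∂_t v` and the existence of its flow. -/

section Velocity

variable {N : ℕ} {T : ℝ} {v : ℝ → E N → E N}

/-- The time derivative of a time-dependent field. -/
def velocity {n : ℕ∞} (hv : IsDivFreeField T n v) (hn : 1 ≤ n) : C(ℝ × E N, E N) :=
  ⟨fun p => deriv (fun s => v s p.2) p.1,
    (contDiff_deriv_fst (w := fun p : ℝ × E N => v p.1 p.2) (n := n) (m := 0)
      hv.contDiff (by rw [zero_add]; exact_mod_cast hn)).continuous⟩

theorem velocity_apply (hv : IsDivFreeField T ⊤ v) (t : ℝ) (x : E N) :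
    velocity hv le_top (t, x) = deriv (fun s => v s x) t := rfl

theorem contDiff_velocity (hv : IsDivFreeField T ⊤ v) : ContDiff ℝ ∞ (velocity hv le_top) :=
  contDiff_deriv_fst (w := fun p : ℝ × E N => v p.1 p.2) hv.contDiff (by simp)

theorem isPeriodic_velocity (hv : IsDivFreeField T ⊤ v) (t : ℝ) :
    IsPeriodic fun x => velocity hv le_top (t, x) := by
  intro x i
  simp only [velocity_apply]
  congr 1
  exact funext fun s => hv.periodic s x i

/-- The divergence of `v_s` is known to vanish only for `s` in `[0,T]`. Its time derivative is
therefore computed within the closed interval, where derivatives are unique because `T > 0`; this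
covers the endpoints. -/
theorem divergence_velocity (hT : 0 < T) (hv : IsDivFreeField T ⊤ v) {t : ℝ} (ht : t ∈ Icc 0 T)
    (x : E N) : divergence (fun x => velocity hv le_top (t, x)) x = 0 := by
  have hd : HasDerivAt (fun s => divergence (v s) x)
      (divergence (fun x => velocity hv le_top (t, x)) x) t := by
    have := HasDerivAt.fun_sum (u := Finset.univ) fun j (_ : j ∈ Finset.univ) =>
      (EuclideanSpace.proj (𝕜 := ℝ) j).hasFDerivAt.comp_hasDerivAt t
        (hasDerivAt_fderiv_snd (w := fun p : ℝ × E N => v p.1 p.2)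
        (hv.contDiff.of_le (WithTop.coe_le_coe.2 le_top)) t x
        (EuclideanSpace.single j (1 : ℝ)))
    exact this
  have h0 : HasDerivWithinAt (fun s => divergence (v s) x) 0 (Icc 0 T) t :=
    (hasDerivWithinAt_const t (Icc 0 T) (0 : ℝ)).congr (fun s hs => hv.div_eq_zero s hs x)
      (hv.div_eq_zero t ht x)
  exact (uniqueDiffOn_Icc hT t ht).eq_deriv _ hd.hasDerivWithinAt h0

/-- The choice operator returns a genuine flow as soon as one exists; uniqueness is not needed here.
-/
theorem isPerturbationFlow_perturbationFlow (hv : IsDivFreeField T ⊤ v) (ε : ℝ) :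
    IsPerturbationFlow (fun t x => ε • v t x) (perturbationFlow fun t x => ε • v t x) := by
  refine Classical.epsilon_spec (p := IsPerturbationFlow fun t x => ε • v t x) ?_
  have hf1 : ContDiff ℝ 1 (velocity hv le_top) := (contDiff_velocity hv).of_le (by simp)
  choose e he0 he using fun x => exists_solution_of_isPeriodic (f := ε • velocity hv le_top)
    (hf1.const_smul ε) (fun t x i => by
      simpa using congrArg (ε • ·) (isPeriodic_velocity hv t x i)) x
  refine ⟨fun t x => e x t, he0, fun t x => (he x t).congr_deriv ?_⟩
  have : HasDerivAt (fun s => v s (e x t)) (velocity hv le_top (t, e x t)) t :=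
    (hasDerivAt_fst (w := fun p : ℝ × E N => v p.1 p.2)
      (hv.contDiff.of_le (by exact_mod_cast le_top)) t (e x t)).differentiableAt.hasDerivAt
  exact (this.fun_const_smul ε).deriv.symm

end Velocity

/-! ### The flow `e = id + ε S`: smoothness, volume preservation, bijectivity. -/

section FlowCurve

variable {N : ℕ} {T : ℝ} {v : ℝ → E N → E N} (hT : 0 < T) (hv : IsDivFreeField T ⊤ v)

theorem hasDerivAt_perturbationFlow (ε t : ℝ) (x : E N) :
    HasDerivAt (fun s => perturbationFlow (fun t x => ε • v t x) s x)
      (ε • velocity hv le_top (t, perturbationFlow (fun t x => ε • v t x) t x)) t := by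
  refine ((isPerturbationFlow_perturbationFlow hv ε).2 t x).congr_deriv ?_
  set y := perturbationFlow (fun t x => ε • v t x) t x
  have : HasDerivAt (fun s => v s y) (velocity hv le_top (t, y)) t :=
    (hasDerivAt_fst (w := fun p : ℝ × E N => v p.1 p.2)
      (hv.contDiff.of_le (by exact_mod_cast le_top)) t y).differentiableAt.hasDerivAt
  exact (this.fun_const_smul ε).deriv

include hv in
theorem perturbationFlow_zero (ε : ℝ) (x : E N) :
    perturbationFlow (fun t x => ε • v t x) 0 x = x :=
  (isPerturbationFlow_perturbationFlow hv ε).1 x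

/-- The trajectory on `[0,T]` of the point `p.1` under the flow of the field `p.2 • v`. -/
def flowCurve (p : E N × ℝ) : C(Icc 0 T, E N) :=
  ⟨fun t => perturbationFlow (fun t x => p.2 • v t x) t p.1,
    (continuous_iff_continuousAt.2 fun t =>
      (hasDerivAt_perturbationFlow hv p.2 t p.1).continuousAt).comp continuous_subtype_val⟩

theorem flowCurve_apply (p : E N × ℝ) (t : Icc 0 T) :
    flowCurve hv p t = perturbationFlow (fun t x => p.2 • v t x) t p.1 := rfl

/-- The curve `S` with `flowCurve p = p.1 + p.2 • S`. -/
def flowSlope (p : E N × ℝ) : C(Icc 0 T, E N) :=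
  primitive hT.le (superposition (timeCurve T) (velocity hv le_top) (flowCurve hv p))

theorem flowCurve_eq (p : E N × ℝ) :
    flowCurve hv p = constCurve T p.1 + p.2 • flowSlope hT hv p := by
  ext1 t
  rw [ContinuousMap.add_apply, constCurve_apply, ContinuousMap.smul_apply, flowSlope,
    primitive_apply, flowCurve_apply, ← intervalIntegral.integral_smul]
  have hc : Continuous fun s => perturbationFlow (fun t x => p.2 • v t x) s p.1 :=
    continuous_iff_continuousAt.2 fun t => (hasDerivAt_perturbationFlow hv p.2 t p.1).continuousAt
  have h := intervalIntegral.integral_eq_sub_of_hasDerivAt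
    (fun s _ => hasDerivAt_perturbationFlow hv p.2 s p.1)
    (((velocity hv le_top).continuous.comp (continuous_id.prodMk hc)).const_smul p.2
      |>.intervalIntegrable 0 t)
  rw [perturbationFlow_zero hv] at h
  have h2 : (∫ s in (0 : ℝ)..t, p.2 • IccExtend hT.le (superposition (timeCurve T)
      (velocity hv le_top) (flowCurve hv p)) s) = ∫ s in (0 : ℝ)..t, p.2 • velocity hv le_top
        (s, perturbationFlow (fun t x => p.2 • v t x) s p.1) := by
    refine intervalIntegral.integral_congr fun s hs => ?_
    rw [uIcc_of_le t.2.1] at hs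
    have hs' : s ∈ Icc 0 T := ⟨hs.1, hs.2.trans t.2.2⟩
    rw [IccExtend_of_mem hT.le _ hs']
    rfl
  rw [h2]
  erw [h]
  abel

/-- At `ε = 0` trajectories are constant, so the slope is `∫_0^t ∂_s v(s, x) ds`. -/
theorem flowSlope_zero (x : E N) (t : Icc 0 T) : flowSlope hT hv (x, 0) t = v t x - v 0 x := by
  have hconst : flowCurve hv (x, 0) = constCurve T x := by
    ext1 s
    refine (congrArg (fun c : C(Icc 0 T, E N) => c s) (flowCurve_eq hT hv (x, 0))).trans ?_
    change x + (0 : ℝ) • flowSlope hT hv (x, 0) s = x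
    rw [zero_smul, add_zero]
  rw [flowSlope, primitive_apply, hconst]
  have h1 : ContDiff ℝ 1 fun p : ℝ × E N => v p.1 p.2 :=
    hv.contDiff.of_le (by exact_mod_cast le_top)
  have h := intervalIntegral.integral_eq_sub_of_hasDerivAt (a := 0) (b := t)
    (f := fun s => v s x) (f' := fun s => velocity hv le_top (s, x))
    (fun s _ => (hasDerivAt_fst h1 s x).differentiableAt.hasDerivAt)
    (((velocity hv le_top).continuous.comp (by fun_prop)).intervalIntegrable 0 t)
  rw [← h]
  refine intervalIntegral.integral_congr fun s hs => ?_
  rw [uIcc_of_le t.2.1] at hs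
  have hs' : s ∈ Icc 0 T := ⟨hs.1, hs.2.trans t.2.2⟩
  rw [IccExtend_of_mem hT.le _ hs']
  rfl

theorem exists_bound_sndDeriv_velocity : ∃ κ : ℝ, 0 ≤ κ ∧ ∀ t ∈ Icc 0 T, ∀ x,
    ‖sndDeriv (velocity hv le_top) ((contDiff_velocity hv).of_le (by simp)) (t, x)‖ ≤ κ := by
  have hf : ContDiff ℝ 1 (velocity hv le_top) := (contDiff_velocity hv).of_le (by simp)
  have hps : ∀ t, IsPeriodic fun x => sndDeriv (velocity hv le_top) hf (t, x) := fun t => by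
    have : (fun x => sndDeriv (velocity hv le_top) hf (t, x)) =
        fderiv ℝ fun x => velocity hv le_top (t, x) :=
      funext fun x => ((hasFDerivAt_snd hf t x).fderiv).symm
    rw [this]
    exact (isPeriodic_velocity hv t).fderiv
  obtain ⟨C, hC⟩ := exists_bound_of_isPeriodic hps (sndDeriv _ hf).continuous
      (isCompact_Icc (a := (0 : ℝ)) (b := T))
  exact ⟨max C 0, le_max_right _ _, fun t ht x => (hC t ht x).trans (le_max_left _ _)⟩

variable {κ : ℝ} (hκ : ∀ t ∈ Icc 0 T, ∀ x,
    ‖sndDeriv (velocity hv le_top) ((contDiff_velocity hv).of_le (by simp)) (t, x)‖ ≤ κ)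

include hT hκ

theorem contDiffAt_flowCurve {p : E N × ℝ} (hp : |p.2| * (T * κ) < 1) {n : ℕ} (hn : n ≠ 0) :
    ContDiffAt ℝ n (flowCurve hv) p :=
  contDiffAt_of_integral_equation hT.le (contDiff_velocity hv) hκ (flowCurve_eq hT hv) hp hn

theorem contDiffAt_flowSlope {p : E N × ℝ} (hp : |p.2| * (T * κ) < 1) {n : ℕ} (hn : n ≠ 0) :
    ContDiffAt ℝ n (flowSlope hT hv) p :=
  (primitive (V := E N) hT.le).contDiff.contDiffAt.comp p
    ((contDiff_superposition (timeCurve T) (contDiff_velocity hv) n).contDiffAt.comp p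
      (contDiffAt_flowCurve hT hv hκ hp hn))

/-- By periodicity of the velocity, the translated trajectory solves the integral equation of the
translated starting point; apply uniqueness. -/
theorem flowCurve_add_single {ε : ℝ} (hε : |ε| * (T * κ) < 1) (x : E N) (i : Fin N) :
    flowCurve hv (x + EuclideanSpace.single i (1 : ℝ), ε) =
      flowCurve hv (x, ε) + constCurve T (EuclideanSpace.single i (1 : ℝ)) := by
  refine eq_of_integral_equation hT.le _ hκ hε (flowCurve_eq hT hv _) ?_
  have h : superposition (timeCurve T) (velocity hv le_top)
      (flowCurve hv (x, ε) + constCurve T (EuclideanSpace.single i (1 : ℝ))) =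
      superposition (timeCurve T) (velocity hv le_top) (flowCurve hv (x, ε)) := by
    ext1 t
    exact isPeriodic_velocity hv t _ i
  rw [h]
  nth_rewrite 1 [flowCurve_eq hT hv]
  rw [flowSlope, map_add]
  abel

/-- The variational equation for the derivative of the flow in the space variable. -/
theorem fderiv_flowCurve_eq {ε : ℝ} (hε : |ε| * (T * κ) < 1) (x h : E N) :
    fderiv ℝ (flowCurve hv) (x, ε) (h, 0) = constCurve T h + ε • primitive hT.le
      (applyCurve (superposition (timeCurve T) (sndDeriv (velocity hv le_top)
        ((contDiff_velocity hv).of_le (by simp))) (flowCurve hv (x, ε)))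
        (fderiv ℝ (flowCurve hv) (x, ε) (h, 0))) := by
  have hf1 : ContDiff ℝ 1 (velocity hv le_top) := (contDiff_velocity hv).of_le (by simp)
  have hd : HasFDerivAt (flowCurve hv) (fderiv ℝ (flowCurve hv) (x, ε)) (x, ε) :=
    ((contDiffAt_flowCurve hT hv hκ (p := (x, ε)) hε
      one_ne_zero).differentiableAt (by simp)).hasFDerivAt
  have h1 : HasFDerivAt (fun y => flowCurve hv (y, ε))
      ((fderiv ℝ (flowCurve hv) (x, ε)).comp (ContinuousLinearMap.inl ℝ (E N) ℝ)) x :=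
    HasFDerivAt.comp (g := flowCurve hv) (f := fun y => (y, ε)) x hd
      (hasFDerivAt_prodMk_left x ε)
  have h3 := (hasFDerivAt_superposition (timeCurve T) hf1 (flowCurve hv (x, ε))).comp x h1
  have h4 := ((primitive (V := E N) hT.le).hasFDerivAt
    (x := superposition (timeCurve T) (velocity hv le_top) (flowCurve hv (x, ε)))).comp x h3
  have h5 := ((constCurve (V := E N) T).hasFDerivAt (x := x)).add (h4.const_smul ε)
  have h6 : (fun y => flowCurve hv (y, ε)) = _ := funext fun y => flowCurve_eq hT hv (y, ε)
  rw [h6] at h1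
  exact congrArg (fun L : E N →L[ℝ] C(Icc 0 T, E N) => L h) (h1.unique h5)

/-- The derivative in space of the flow. -/
theorem hasFDerivAt_flow {ε : ℝ} (hε : |ε| * (T * κ) < 1) (t : Icc 0 T) (x : E N) :
    HasFDerivAt (perturbationFlow (fun t x => ε • v t x) t)
      (((ContinuousMap.evalCLM ℝ t).comp (fderiv ℝ (flowCurve hv) (x, ε))).comp
        (ContinuousLinearMap.inl ℝ (E N) ℝ)) x :=
  HasFDerivAt.comp (g := fun p => flowCurve hv p t) (f := fun y => (y, ε)) x
    ((ContinuousMap.evalCLM ℝ t : C(Icc 0 T, E N) →L[ℝ] E N).hasFDerivAt.comp (x, ε)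
      ((contDiffAt_flowCurve hT hv hκ (p := (x, ε)) hε
        one_ne_zero).differentiableAt (by simp)).hasFDerivAt) (hasFDerivAt_prodMk_left x ε)

/-- By the variational equation the Jacobian matrix solves `M' = A M`, where `tr A = ε div ∂_t v =
0` along the trajectory and `M 0 = 1`. Liouville's formula keeps the determinant constant. -/
theorem det_fderiv_flow {ε : ℝ} (hε : |ε| * (T * κ) < 1) (t : Icc 0 T) (x : E N) :
    (((ContinuousMap.evalCLM ℝ t).comp (fderiv ℝ (flowCurve hv) (x, ε))).comp
        (ContinuousLinearMap.inl ℝ (E N) ℝ)).det = 1 := by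
  have hf1 : ContDiff ℝ 1 (velocity hv le_top) := (contDiff_velocity hv).of_le (by simp)
  set D : E N → C(Icc 0 T, E N) := fun h => fderiv ℝ (flowCurve hv) (x, ε) (h, 0) with hD
  set B : C(Icc 0 T, E N →L[ℝ] E N) := superposition (timeCurve T) (sndDeriv (velocity hv le_top)
    hf1) (flowCurve hv (x, ε)) with hB
  -- `J` extends the derivative of the flow from `[0,T]` to all real times, so that two-sided
  -- derivatives exist at the endpoints as well.
  set J : ℝ → E N → E N := fun s h => h + ε • ∫ r in (0 : ℝ)..s,
    IccExtend hT.le (applyCurve B (D h)) r with hJ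
  have hJD : ∀ s : Icc 0 T, ∀ h, D h s = J s h := fun s h =>
    congrArg (fun c : C(Icc 0 T, E N) => c s) (fderiv_flowCurve_eq hT hv hκ hε x h)
  have hJd : ∀ s (hs : s ∈ Icc 0 T), ∀ h,
      HasDerivAt (fun r => J r h) (ε • B ⟨s, hs⟩ (J s h)) s := by
    intro s hs h
    have hc : Continuous (IccExtend hT.le (applyCurve B (D h))) :=
      (applyCurve B (D h)).continuous.Icc_extend'
    have := intervalIntegral.integral_hasDerivAt_right (hc.intervalIntegrable 0 s)
      (hc.stronglyMeasurableAtFilter _ _) hc.continuousAt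
    have := (this.const_smul ε).const_add h
    rw [IccExtend_of_mem hT.le _ hs, applyCurve_apply, hJD] at this
    exact this
  set M : ℝ → Matrix (Fin N) (Fin N) ℝ := fun s => Matrix.of fun i j =>
    (J s (EuclideanSpace.single j (1 : ℝ))) i with hM
  set A : ℝ → Matrix (Fin N) (Fin N) ℝ := fun s => Matrix.of fun i j =>
    (ε • (IccExtend hT.le B s) (EuclideanSpace.single j (1 : ℝ))) i with hA
  have hdet := det_eq_of_trace_eq_zero (M := M) (A := A) (T := T) ?_ ?_ t.2
  · have h0 : M 0 = 1 := by
      ext i j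
      simp [hM, hJ, Matrix.one_apply]
    rw [h0, Matrix.det_one] at hdet
    rw [← hdet, ContinuousLinearMap.det,
      ← LinearMap.det_toMatrix (EuclideanSpace.basisFun (Fin N) ℝ).toBasis]
    congr 1
    ext i j
    rw [LinearMap.toMatrix_apply]
    simp only [hM, Matrix.of_apply, ← hJD]
    simp [hD]
  · intro s hs i j
    have := (EuclideanSpace.proj (𝕜 := ℝ) i).hasFDerivAt.comp_hasDerivAt s
      (hJd s hs (EuclideanSpace.single j (1 : ℝ)))
    refine this.congr_deriv ?_
    conv_lhs => rw [← sum_smul_single (J s (EuclideanSpace.single j (1 : ℝ)))]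
    simp only [Matrix.mul_apply, hA, hM, Matrix.of_apply, IccExtend_of_mem hT.le _ hs, map_sum,
      map_smul, Finset.smul_sum, smul_eq_mul, PiLp.proj_apply, PiLp.smul_apply]
    exact Finset.sum_congr rfl fun k _ => by ring
  · intro s hs
    have := divergence_velocity hT hv hs (flowCurve hv (x, ε) ⟨s, hs⟩)
    rw [divergence] at this
    simp only [(hasFDerivAt_snd hf1 s _).fderiv] at this
    simp only [Matrix.trace, hA, Matrix.diag_apply, Matrix.of_apply, IccExtend_of_mem hT.le _ hs,
      PiLp.smul_apply, ← Finset.smul_sum]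
    rw [smul_eq_zero]
    exact Or.inr this

/-- The derivative stays within `1/2` of the identity, so the flow map differs from the identity by
a `1/2`-Lipschitz map. It is then injective and surjective on all of `ℝ^N`. -/
theorem bijective_flow (hκ0 : 0 ≤ κ) {ε : ℝ} (hε : |ε| * (T * κ) ≤ 1 / 4) (t : Icc 0 T) :
    Function.Bijective (perturbationFlow (fun t x => ε • v t x) t) := by
  have hε1 : |ε| * (T * κ) < 1 := by linarith
  have hJ : ∀ x h, ‖(fderiv ℝ (flowCurve hv) (x, ε) (h, 0)) t - h‖ ≤ 1 / 2 * ‖h‖ := by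
    intro x h
    set D := fderiv ℝ (flowCurve hv) (x, ε) (h, 0) with hD
    -- Combined with `‖D‖ ≤ ‖D - h‖ + ‖h‖`, this gives `‖D - h‖ ≤ ‖h‖ / 3`, better than the required
    -- `1/2`.
    have h1 : ‖D - constCurve T h‖ ≤ 1 / 4 * ‖D‖ := by
      have h2 : D - constCurve T h = _ :=
        sub_eq_of_eq_add' (fderiv_flowCurve_eq hT hv hκ hε1 x h)
      rw [h2, norm_smul, Real.norm_eq_abs]
      calc _ ≤ |ε| * (T * (κ * ‖D‖)) := by
            gcongr
            refine (ContinuousLinearMap.le_opNorm _ _).trans ?_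
            refine mul_le_mul (norm_primitive_le hT.le) ?_ (norm_nonneg _) hT.le
            refine (ContinuousLinearMap.le_opNorm _ _).trans ?_
            gcongr
            refine (norm_applyCurve_le _).trans ?_
            rw [ContinuousMap.norm_le _ hκ0]
            exact fun s => hκ s s.2 _
        _ = |ε| * (T * κ) * ‖D‖ := by ring
        _ ≤ _ := by gcongr
    have h3 : ‖constCurve T h‖ ≤ ‖h‖ :=
      (ContinuousMap.norm_le _ (norm_nonneg h)).2 fun _ => le_rfl
    have h4 : ‖D‖ ≤ ‖D - constCurve T h‖ + ‖constCurve T h‖ := by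
      simpa using norm_add_le (D - constCurve T h) (constCurve T h)
    have h5 : ‖D t - h‖ ≤ ‖D - constCurve T h‖ :=
      ContinuousMap.norm_coe_le_norm (D - constCurve T h) t
    have := norm_nonneg h
    linarith
  have happ : ApproximatesLinearOn (perturbationFlow (fun t x => ε • v t x) t)
      ((ContinuousLinearEquiv.refl ℝ (E N) : E N ≃L[ℝ] E N) : E N →L[ℝ] E N) univ (1 / 2) := by
    intro x _ y _
    refine convex_univ.norm_image_sub_le_of_norm_hasFDerivWithin_le'
      (fun z _ => (hasFDerivAt_flow hT hv hκ hε1 t z).hasFDerivWithinAt) (fun z _ => ?_)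
      (mem_univ y) (mem_univ x)
    refine ContinuousLinearMap.opNorm_le_bound _ (by positivity) fun h => ?_
    simpa using hJ z h
  -- The subsingleton alternative is `N = 0`, where the identity has norm `0`, not `1`.
  have hc : Subsingleton (E N) ∨ (1 / 2 : NNReal) <
      ‖((ContinuousLinearEquiv.refl ℝ (E N)).symm : E N →L[ℝ] E N)‖₊⁻¹ := by
    rcases subsingleton_or_nontrivial (E N) with h | h
    · exact Or.inl h
    · right
      have : ‖((ContinuousLinearEquiv.refl ℝ (E N)).symm : E N →L[ℝ] E N)‖₊ = 1 := by
        rw [← NNReal.coe_inj]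
        exact ContinuousLinearMap.norm_id
      rw [this, inv_one]
      exact NNReal.half_lt_self one_ne_zero
  exact ⟨injOn_univ.1 (happ.injOn hc), happ.surjective hc⟩

theorem flow_add_single {ε : ℝ} (hε : |ε| * (T * κ) < 1) (t : Icc 0 T) (x : E N) (i : Fin N) :
    perturbationFlow (fun t x => ε • v t x) t (x + EuclideanSpace.single i (1 : ℝ)) =
      perturbationFlow (fun t x => ε • v t x) t x + EuclideanSpace.single i (1 : ℝ) :=
  congrArg (fun c : C(Icc 0 T, E N) => c t) (flowCurve_add_single hT hv hκ hε x i)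

/-- The flow preserves the volume of the torus. -/
theorem setIntegral_cell_invFun_flow (hκ0 : 0 ≤ κ) {ε : ℝ} (hε : |ε| * (T * κ) ≤ 1 / 4)
    (t : Icc 0 T) {H : E N → ℝ} (hH : IsPeriodic H) :
    ∫ x in cell N, H (Function.invFun (perturbationFlow (fun t x => ε • v t x) t) x) =
      ∫ x in cell N, H x := by
  have hε1 : |ε| * (T * κ) < 1 := by linarith
  have hbij := bijective_flow hT hv hκ hκ0 hε t
  set e := perturbationFlow (fun t x => ε • v t x) t with he
  have hl : Function.LeftInverse (Function.invFun e) e := Function.leftInverse_invFun hbij.1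
  have hr : Function.RightInverse (Function.invFun e) e := Function.rightInverse_invFun hbij.2
  have hp : IsPeriodic fun x => H (Function.invFun e x) := by
    intro x i
    have : Function.invFun e (x + EuclideanSpace.single i (1 : ℝ)) =
        Function.invFun e x + EuclideanSpace.single i (1 : ℝ) := by
      apply hbij.1
      rw [hr, he, flow_add_single hT hv hκ hε1, ← he, hr]
    simp only [this, hH _ i]
  have := setIntegral_cell_comp (fun x => hasFDerivAt_flow hT hv hκ hε1 t x)
    (fun x => by rw [det_fderiv_flow hT hv hκ hε1, abs_one]) hbij
    (fun x i => flow_add_single hT hv hκ hε1 t x i) hp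
  rw [← this]
  exact integral_congr_ae (Filter.Eventually.of_forall fun x => congrArg H (hl x))

end FlowCurve

/-! ### Expansion `(∂_t + L(u)) e = u + ε Q` of the material derivative. -/

section FirstVariation

variable {N : ℕ}

/-- The derivative of a curve-valued map in the direction `w` of the space variable. -/
def spaceDeriv {K : Type} [TopologicalSpace K] [CompactSpace K] (S : E N × ℝ → C(K, E N)) (w : E N)
    (p : E N × ℝ) : C(K, E N) := fderiv ℝ S p (w, 0)

theorem hasFDerivAt_eval {K : Type} [TopologicalSpace K] [CompactSpace K]
    {S : E N × ℝ → C(K, E N)} {x : E N} {ε : ℝ} (hS : DifferentiableAt ℝ S (x, ε)) (t : K) :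
    HasFDerivAt (fun y => S (y, ε) t) (((ContinuousMap.evalCLM ℝ t).comp
      (fderiv ℝ S (x, ε))).comp (ContinuousLinearMap.inl ℝ (E N) ℝ)) x :=
  HasFDerivAt.comp (g := fun p => S p t) (f := fun y => (y, ε)) x
    ((ContinuousMap.evalCLM ℝ t : C(K, E N) →L[ℝ] E N).hasFDerivAt.comp (x, ε) hS.hasFDerivAt)
    (hasFDerivAt_prodMk_left x ε)

theorem fderiv_eval {K : Type} [TopologicalSpace K] [CompactSpace K]
    {S : E N × ℝ → C(K, E N)} {x : E N} {ε : ℝ} (hS : DifferentiableAt ℝ S (x, ε)) (t : K)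
    (w : E N) : fderiv ℝ (fun y => S (y, ε) t) x w = spaceDeriv S w (x, ε) t := by
  rw [(hasFDerivAt_eval hS t).fderiv]
  rfl

theorem contDiffAt_spaceDeriv {K : Type} [TopologicalSpace K] [CompactSpace K]
    {S : E N × ℝ → C(K, E N)} {p : E N × ℝ} {m n : WithTop ℕ∞} (hS : ContDiffAt ℝ n S p)
    (h : m + 1 ≤ n) (w : E N) : ContDiffAt ℝ m (spaceDeriv S w) p :=
  (hS.fderiv_right h).clm_apply contDiffAt_const

theorem contDiffAt_eval {K : Type} [TopologicalSpace K] [CompactSpace K]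
    {S : E N × ℝ → C(K, E N)} {x : E N} {ε : ℝ} {n : WithTop ℕ∞} (hS : ContDiffAt ℝ n S (x, ε))
    (t : K) : ContDiffAt ℝ n (fun y => S (y, ε) t) x :=
  ContDiffAt.comp (g := fun p => S p t) (f := fun y => (y, ε)) x
    ((ContinuousMap.evalCLM ℝ t : C(K, E N) →L[ℝ] E N).contDiff.contDiffAt.comp (x, ε) hS)
    (contDiffAt_id.prodMk contDiffAt_const)

variable {T : ℝ} {v u : ℝ → E N → E N} (hT : 0 < T) (hv : IsDivFreeField T ⊤ v)

/-- The field `Q` with `(∂_t + L(u_t)) e_t(ε v) = u + ε Q`, at the point `(t,x)` of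
`[0,T] × ℝ^N`. -/
def flowRemainder (u : ℝ → E N → E N) (ε : ℝ) (x : E N) (t : Icc 0 T) : E N :=
  velocity hv le_top (t, flowCurve hv (x, ε) t) +
    ((1 / 2 : ℝ) • (∑ j, spaceDeriv (spaceDeriv (flowSlope hT hv) (EuclideanSpace.single j (1 : ℝ)))
      (EuclideanSpace.single j (1 : ℝ)) (x, ε) t) + spaceDeriv (flowSlope hT hv) (u t x) (x, ε) t)

variable {κ : ℝ} (hκ : ∀ t ∈ Icc 0 T, ∀ x,
    ‖sndDeriv (velocity hv le_top) ((contDiff_velocity hv).of_le (by simp)) (t, x)‖ ≤ κ)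

include hκ in
-- In `e = id + ε S` the identity has zero Laplacian and contributes exactly `u` through `u·∇`;
-- every other term has a factor `ε`.
theorem materialDerivative_flow {ε : ℝ} (hε : |ε| * (T * κ) < 1) (t : Icc 0 T) (x : E N) :
    materialDerivative u (perturbationFlow fun t x => ε • v t x) t x =
      u t x + ε • flowRemainder hT hv u ε x t := by
  have hS : ∀ y, ContDiffAt ℝ 3 (flowSlope hT hv) (y, ε) := fun y =>
    contDiffAt_flowSlope hT hv hκ (p := (y, ε)) hε (n := 3) (by norm_num)
  have he : perturbationFlow (fun t x => ε • v t x) t =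
      fun y => y + ε • flowSlope hT hv (y, ε) t := by
    funext y
    exact congrArg (fun c : C(Icc 0 T, E N) => c t) (flowCurve_eq hT hv (y, ε))
  have hd : ∀ y w, fderiv ℝ (perturbationFlow (fun t x => ε • v t x) t) y w =
      w + ε • spaceDeriv (flowSlope hT hv) w (y, ε) t := by
    intro y w
    have hSd := (hS y).differentiableAt (by norm_num)
    have h : HasFDerivAt (fun y => y + ε • flowSlope hT hv (y, ε) t) _ y :=
      (hasFDerivAt_id y).add ((hasFDerivAt_eval hSd t).const_smul ε)
    rw [he, h.fderiv]
    rfl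
  have hl : (Δ (perturbationFlow (fun t x => ε • v t x) t)) x = ε • ∑ j,
      spaceDeriv (spaceDeriv (flowSlope hT hv) (EuclideanSpace.single j (1 : ℝ)))
      (EuclideanSpace.single j (1 : ℝ)) (x, ε) t := by
    rw [laplacian_eq_sum_fderiv, Finset.smul_sum]
    · refine Finset.sum_congr rfl fun j _ => ?_
      simp only [hd]
      have h1 := (contDiffAt_spaceDeriv (hS x) (m := 2) (by norm_num)
        (EuclideanSpace.single j (1 : ℝ))).differentiableAt (by norm_num)
      have h : HasFDerivAt (fun y => EuclideanSpace.single j (1 : ℝ) + ε •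
          spaceDeriv (flowSlope hT hv) (EuclideanSpace.single j (1 : ℝ)) (y, ε) t) _ x :=
        ((hasFDerivAt_eval h1 t).const_smul ε).const_add _
      rw [h.fderiv]
      rfl
    · rw [he]
      exact contDiffAt_id.add (((contDiffAt_eval (hS x) t).of_le (by norm_num)).const_smul ε)
  rw [materialDerivative, generator, (hasDerivAt_perturbationFlow hv ε t x).deriv, hl, hd,
    flowRemainder, flowCurve_apply]
  module

include hκ in
theorem flowRemainder_zero (h0 : ∀ x, v 0 x = 0) (t : Icc 0 T) (x : E N) :
    flowRemainder hT hv u 0 x t = deriv (fun s => v s x) t + generator (u t) (v t) x := by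
  have hε : |(0 : ℝ)| * (T * κ) < 1 := by simp
  have hS : ∀ y, ContDiffAt ℝ 3 (flowSlope hT hv) (y, 0) := fun y =>
    contDiffAt_flowSlope hT hv hκ (p := (y, 0)) hε (n := 3) (by norm_num)
  have hvS : v t = fun y => flowSlope hT hv (y, 0) t := by
    funext y
    rw [flowSlope_zero, h0, sub_zero]
  have hd : ∀ y w, fderiv ℝ (v t) y w = spaceDeriv (flowSlope hT hv) w (y, 0) t := by
    intro y w
    rw [hvS]
    exact fderiv_eval ((hS y).differentiableAt (by norm_num)) t w
  have hl : (Δ (v t)) x = ∑ j,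
      spaceDeriv (spaceDeriv (flowSlope hT hv) (EuclideanSpace.single j (1 : ℝ)))
      (EuclideanSpace.single j (1 : ℝ)) (x, 0) t := by
    rw [laplacian_eq_sum_fderiv]
    · refine Finset.sum_congr rfl fun j _ => ?_
      simp only [hd]
      exact fderiv_eval ((contDiffAt_spaceDeriv (hS x) (m := 2) (by norm_num)
        (EuclideanSpace.single j (1 : ℝ))).differentiableAt (by norm_num)) t _
    · rw [hvS]
      exact (contDiffAt_eval (hS x) t).of_le (by norm_num)
  have hγ : flowCurve hv (x, 0) t = x := by
    refine (congrArg (fun c : C(Icc 0 T, E N) => c t) (flowCurve_eq hT hv (x, 0))).trans ?_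
    change x + (0 : ℝ) • flowSlope hT hv (x, 0) t = x
    rw [zero_smul, add_zero]
  rw [flowRemainder, generator, hl, hd, hγ, velocity_apply]

include hκ in
-- The curve-valued derivatives are continuous in `(x, ε)`, and evaluation of a curve at a time is
-- jointly continuous. This supplies both the uniform bound and the continuity at `ε = 0` needed to
-- differentiate the energy.
theorem continuousAt_flowRemainder (hu : IsDivFreeField T 1 u) {ε : ℝ} (hε : |ε| * (T * κ) < 1)
    (x : E N) (t : Icc 0 T) :
    ContinuousAt (fun z : ℝ × E N × Icc (0 : ℝ) T => flowRemainder hT hv u z.1 z.2.1 z.2.2)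
      (ε, x, t) := by
  have hS : ContDiffAt ℝ 3 (flowSlope hT hv) (x, ε) :=
    contDiffAt_flowSlope hT hv hκ (p := (x, ε)) hε (n := 3) (by norm_num)
  have hγ : ContinuousAt (flowCurve hv) (x, ε) :=
    (contDiffAt_flowCurve hT hv hκ (p := (x, ε)) hε (n := 1) (by norm_num)).continuousAt
  have hp : ContinuousAt (fun z : ℝ × E N × Icc (0 : ℝ) T => (z.2.1, z.1)) (ε, x, t) := by fun_prop
  have ht : ContinuousAt (fun z : ℝ × E N × Icc (0 : ℝ) T => z.2.2) (ε, x, t) := by fun_prop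
  have heval : ∀ {g : E N × ℝ → C(Icc (0 : ℝ) T, E N)}, ContinuousAt g (x, ε) →
      ContinuousAt (fun z : ℝ × E N × Icc (0 : ℝ) T => g (z.2.1, z.1) z.2.2) (ε, x, t) := by
    intro g hg
    have h1 : ContinuousAt (fun z : ℝ × E N × Icc (0 : ℝ) T => (g (z.2.1, z.1), z.2.2)) (ε, x, t) :=
      (ContinuousAt.comp (f := fun z : ℝ × E N × Icc (0 : ℝ) T => (z.2.1, z.1))
        (x := (ε, x, t)) (g := g) hg hp).prodMk ht
    exact (ContinuousEval.continuous_eval (F := C(Icc (0 : ℝ) T, E N))).continuousAt.comp h1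
  have hu' : Continuous fun z : ℝ × E N × Icc (0 : ℝ) T => u z.2.2 z.2.1 :=
    hu.contDiff.continuous.comp
      (f := fun z : ℝ × E N × Icc (0 : ℝ) T => ((z.2.2 : ℝ), z.2.1)) (by fun_prop)
  unfold flowRemainder
  refine ContinuousAt.add ?_ (ContinuousAt.add (ContinuousAt.fun_const_smul ?_ _) ?_)
  · refine (velocity hv le_top).continuous.continuousAt.comp ?_
    exact (continuous_subtype_val.continuousAt.comp ht).prodMk (heval hγ)
  · refine tendsto_finsetSum _ fun j _ => heval ?_
    exact (contDiffAt_spaceDeriv (contDiffAt_spaceDeriv hS (m := 2) (by norm_num) _) (m := 1)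
      (by norm_num) _).continuousAt
  · have h1 : ContinuousAt (fderiv ℝ (flowSlope hT hv)) (x, ε) :=
      (hS.fderiv_right (m := 2) (by norm_num)).continuousAt
    have h2 : ContinuousAt (fun z : ℝ × E N × Icc (0 : ℝ) T =>
        fderiv ℝ (flowSlope hT hv) (z.2.1, z.1)) (ε, x, t) :=
      ContinuousAt.comp (f := fun z : ℝ × E N × Icc (0 : ℝ) T => (z.2.1, z.1)) h1 hp
    have h3 := h2.clm_apply (hu'.continuousAt.prodMk (continuousAt_const (y := (0 : ℝ))))
    exact (ContinuousEval.continuous_eval (F := C(Icc (0 : ℝ) T, E N))).continuousAt.comp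
      (h3.prodMk ht)

include hT hκ in
theorem isPeriodic_materialDerivative_flow (hu : IsDivFreeField T 1 u) {ε : ℝ}
    (hε : |ε| * (T * κ) < 1) (t : Icc 0 T) :
    IsPeriodic (materialDerivative u (perturbationFlow fun t x => ε • v t x) t) := by
  intro x i
  set e := perturbationFlow fun t x => ε • v t x with he
  have hadd : ∀ y, e t (y + EuclideanSpace.single i (1 : ℝ)) =
    e t y + EuclideanSpace.single i (1 : ℝ) := fun y => flow_add_single hT hv hκ hε t y i
  have hper : IsPeriodic (fderiv ℝ (e t)) := by
    intro y k
    rw [← fderiv_comp_add_right]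
    have : (fun y => e t (y + EuclideanSpace.single k (1 : ℝ))) =
        fun y => e t y + EuclideanSpace.single k (1 : ℝ) :=
      funext fun y => flow_add_single hT hv hκ hε t y k
    rw [this, fderiv_add_const]
  have hcd : ∀ y, ContDiffAt ℝ 2 (e t) y := fun y =>
    contDiffAt_eval (contDiffAt_flowCurve hT hv hκ (p := (y, ε)) hε (n := 2) (by norm_num)) t
  have hl : (Δ (e t)) (x + EuclideanSpace.single i (1 : ℝ)) = (Δ (e t)) x := by
    rw [laplacian_eq_sum_fderiv (hcd _), laplacian_eq_sum_fderiv (hcd _)]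
    refine Finset.sum_congr rfl fun j _ => ?_
    have : IsPeriodic fun y => fderiv ℝ (e t) y (EuclideanSpace.single j (1 : ℝ)) := fun y k => by
      simp only [hper y k]
    rw [this.fderiv x i]
  rw [materialDerivative, materialDerivative, generator, generator, hl, hper x i,
    hu.periodic t x i, he, (hasDerivAt_perturbationFlow hv ε t _).deriv,
    (hasDerivAt_perturbationFlow hv ε t _).deriv, ← he, hadd]
  congr 2
  exact isPeriodic_velocity hv t _ i

end FirstVariation

/-! ### Differentiation of the energy at `ε = 0`. -/

section EnergyDerivative

/-- The difference quotient at `0` is `g` itself, so continuity of the remainder in `ε` is enough.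
-/
theorem hasDerivAt_smul_of_continuousAt {V : Type} [NormedAddCommGroup V] [NormedSpace ℝ V]
    {g : ℝ → V} (hg : ContinuousAt g 0) : HasDerivAt (fun ε => ε • g ε) (g 0) 0 := by
  rw [hasDerivAt_iff_tendsto_slope]
  refine (hg.tendsto.mono_left nhdsWithin_le_nhds).congr' ?_
  filter_upwards [self_mem_nhdsWithin] with ε hε
  have : ε ≠ 0 := hε
  simp [slope_def_module, smul_smul, this]

/-- Mean value inequality on the ball of radius `R`, where the gradient of `‖x‖ ^ q` has norm `q ‖x‖
^ (q - 1)`. -/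
theorem norm_rpow_sub_norm_rpow_le {V : Type} [NormedAddCommGroup V] [InnerProductSpace ℝ V]
    {q : ℝ} (hq : 1 < q) {R : ℝ} {a b : V} (ha : ‖a‖ ≤ R) (hb : ‖b‖ ≤ R) :
    |‖b‖ ^ q - ‖a‖ ^ q| ≤ q * R ^ (q - 1) * ‖b - a‖ := by
  have := (convex_closedBall (0 : V) R).norm_image_sub_le_of_norm_hasFDerivWithin_le
    (f := fun x : V => ‖x‖ ^ q) (f' := fun x => (q * ‖x‖ ^ (q - 2)) • innerSL ℝ x)
    (C := q * R ^ (q - 1)) (x := a) (y := b)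
    (fun x _ => (hasFDerivAt_norm_rpow x hq).hasFDerivWithinAt) (fun x hx => ?_)
    (by simpa using ha) (by simpa using hb)
  · simpa using this
  · have hx' : ‖x‖ ≤ R := by simpa using hx
    have hq0 : 0 ≤ q := by linarith
    rw [norm_smul, innerSL_apply_norm, Real.norm_of_nonneg (by positivity), mul_assoc]
    gcongr
    rcases (norm_nonneg x).eq_or_lt with h | h
    · rw [← h, mul_zero]
      exact Real.rpow_nonneg ((norm_nonneg a).trans ha) _
    · have : ‖x‖ ^ (q - 2) * ‖x‖ = ‖x‖ ^ (q - 1) := by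
        rw [← Real.rpow_add_one h.ne']; congr 1; ring
      rw [this]
      exact Real.rpow_le_rpow h.le hx' (by linarith)

/-- The integrand need not be differentiable at `ε ≠ 0`, so the dominated differentiation theorem is
used in the form that asks for a Lipschitz bound relative to the base point `0` only. -/
theorem hasDerivAt_integral_norm_rpow {α : Type} [MeasurableSpace α] {μ : Measure α}
    [IsFiniteMeasure μ] {V : Type} [NormedAddCommGroup V] [InnerProductSpace ℝ V] {q : ℝ}
    (hq : 1 < q) {a : α → V} {Q : ℝ → α → V} {δ U C : ℝ} (hδ : 0 < δ) (hδ1 : δ ≤ 1)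
    (hmeas : ∀ ε, |ε| < δ → AEStronglyMeasurable (Q ε) μ) (ham : AEStronglyMeasurable a μ)
    (hU : ∀ᵐ z ∂μ, ‖a z‖ ≤ U) (hC : ∀ᵐ z ∂μ, ∀ ε, |ε| < δ → ‖Q ε z‖ ≤ C)
    (hQ : ∀ᵐ z ∂μ, ContinuousAt (fun ε => Q ε z) 0) :
    HasDerivAt (fun ε : ℝ => ∫ z, ‖a z + ε • Q ε z‖ ^ q ∂μ)
      (∫ z, q * (‖a z‖ ^ (q - 2) * inner ℝ (a z) (Q 0 z)) ∂μ) 0 := by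
  have hq0 : 0 ≤ q := by linarith
  have hF : ∀ ε, |ε| < δ → AEStronglyMeasurable (fun z => ‖a z + ε • Q ε z‖ ^ q) μ := fun ε hε =>
    (Real.continuous_rpow_const hq0).comp_aestronglyMeasurable
      ((ham.add ((hmeas ε hε).const_smul ε)).norm)
  have hball : Metric.ball (0 : ℝ) δ ∈ nhds (0 : ℝ) := Metric.ball_mem_nhds _ hδ
  have hmem : ∀ ε ∈ Metric.ball (0 : ℝ) δ, |ε| < δ := fun ε hε => by simpa using hε
  have h0 : |(0 : ℝ)| < δ := by simpa using hδ
  have hm' : AEStronglyMeasurable (fun z => q * (‖a z‖ ^ (q - 2) * inner ℝ (a z) (Q 0 z))) μ := by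
    refine AEStronglyMeasurable.const_mul (AEStronglyMeasurable.mul ?_ ?_) q
    · exact ((ham.norm.aemeasurable).pow_const (q - 2)).aestronglyMeasurable
    · exact ham.inner (hmeas 0 h0)
  have key := hasFDerivAt_integral_of_dominated_loc_of_lip' (𝕜 := ℝ) (μ := μ)
    (F := fun (ε : ℝ) z => ‖a z + ε • Q ε z‖ ^ q)
    (F' := fun z => ContinuousLinearMap.toSpanSingleton ℝ
      (q * (‖a z‖ ^ (q - 2) * inner ℝ (a z) (Q 0 z))))
    (x₀ := 0) (bound := fun _ => q * (U + C) ^ (q - 1) * C) hball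
    (fun ε hε => hF ε (hmem ε hε)) ?_ ?_ ?_ (integrable_const _) ?_
  · have h2 := key.2.hasDerivAt
    refine h2.congr_deriv ?_
    rw [ContinuousLinearMap.integral_apply key.1]
    simp
  · refine Integrable.of_bound (hF 0 h0) (U ^ q) ?_
    filter_upwards [hU] with z hz
    rw [zero_smul, add_zero, Real.norm_of_nonneg (by positivity)]
    exact Real.rpow_le_rpow (norm_nonneg _) hz hq0
  · exact (ContinuousLinearMap.toSpanSingletonLE ℝ ℝ ℝ).continuous_of_finiteDimensional
      |>.comp_aestronglyMeasurable hm'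
  · filter_upwards [hU, hC] with z hz hzC ε hε
    have hε' := hmem ε hε
    have hC0 : 0 ≤ C := (norm_nonneg _).trans (hzC 0 h0)
    have h1 : ‖ε • Q ε z‖ ≤ |ε| * C := by
      rw [norm_smul, Real.norm_eq_abs]
      gcongr
      exact hzC ε hε'
    have h2 : |ε| * C ≤ C := mul_le_of_le_one_left hC0 (hε'.le.trans hδ1)
    have h3 := norm_rpow_sub_norm_rpow_le hq (R := U + C) (a := a z) (b := a z + ε • Q ε z)
      (by linarith) ((norm_add_le _ _).trans (by linarith))
    rw [add_sub_cancel_left] at h3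
    rw [Real.norm_eq_abs, zero_smul, add_zero, sub_zero, Real.norm_eq_abs]
    refine h3.trans ?_
    have h4 : 0 ≤ q * (U + C) ^ (q - 1) := by
      have : 0 ≤ U := (norm_nonneg _).trans hz
      positivity
    calc _ ≤ q * (U + C) ^ (q - 1) * (|ε| * C) := by gcongr
      _ = _ := by ring
  · filter_upwards [hQ] with z hz
    have h1 : HasDerivAt (fun ε : ℝ => a z + ε • Q ε z) (Q 0 z) 0 :=
      (hasDerivAt_smul_of_continuousAt hz).const_add _
    have h2 := (hasFDerivAt_norm_rpow (a z + (0 : ℝ) • Q 0 z) hq).comp_hasDerivAt 0 h1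
    have h3 := h2.hasFDerivAt
    refine h3.congr_fderiv ?_
    ext
    simp [mul_assoc]

variable {N : ℕ} {T : ℝ}

/-- The measure of `[0,T] × torus`. -/
abbrev spaceTime (N : ℕ) (T : ℝ) : Measure (ℝ × E N) :=
  (volume.restrict (Ioc 0 T)).prod (volume.restrict (cell N))

theorem ae_spaceTime {p : ℝ × E N → Prop} (h : ∀ t ∈ Icc 0 T, ∀ x ∈ cube N, p (t, x)) :
    ∀ᵐ z ∂spaceTime N T, p z := by
  rw [spaceTime, Measure.prod_restrict]
  filter_upwards [ae_restrict_mem (measurableSet_Ioc.prod measurableSet_cell)] with z hz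
  exact h z.1 (Ioc_subset_Icc_self hz.1) z.2 (cell_subset_cube hz.2)

theorem integrable_spaceTime {F : Type} [NormedAddCommGroup F] {f : ℝ × E N → F}
    (hf : Continuous f) : Integrable f (spaceTime N T) := by
  rw [spaceTime, Measure.prod_restrict]
  refine (hf.continuousOn.integrableOn_compact
    ((isCompact_Icc (a := (0 : ℝ)) (b := T)).prod (isCompact_cube (N := N)))).mono_set ?_
  exact prod_mono Ioc_subset_Icc_self cell_subset_cube

theorem integral_spaceTime (hT : 0 ≤ T) {f : ℝ × E N → ℝ} (hf : Continuous f) :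
    ∫ z, f z ∂spaceTime N T = ∫ t in (0 : ℝ)..T, ∫ x in cell N, f (t, x) := by
  rw [integral_prod _ (integrable_spaceTime hf), intervalIntegral.integral_of_le hT]

theorem continuous_weighted {q : ℝ} (hq : 2 ≤ q) {u : ℝ → E N → E N}
    (hu : Continuous fun p : ℝ × E N => u p.1 p.2) :
    Continuous fun p : ℝ × E N => weighted q u p.1 p.2 :=
  (hu.norm.rpow_const fun _ => Or.inr (by linarith)).smul hu

/-- The value of the first variation of the energy in the direction `v`. -/
def firstVariation (q T : ℝ) (u v : ℝ → E N → E N) : ℝ :=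
  ∫ t in (0 : ℝ)..T, ∫ x in cell N,
    inner ℝ (weighted q u t x) (deriv (fun s => v s x) t + generator (u t) (v t) x)

/-- Volume preservation removes the inverse flow, leaving `(1/q) ∫∫ ‖u + ε Q_ε‖^q` for small `ε`. Of
the boundary conditions only `v_0 = 0` matters here: it identifies `Q_0` with `∂_t v + L(u) v`. -/
theorem hasDerivAt_energy {q : ℝ} (hq : 2 ≤ q) (hT : 0 < T) {u v : ℝ → E N → E N}
    (hu : IsDivFreeField T 1 u) (hv : IsDivFreeField T ⊤ v) (h0 : ∀ x, v 0 x = 0) :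
    HasDerivAt (fun ε : ℝ => energy q T u fun t x => ε • v t x) (firstVariation q T u v) 0 := by
  obtain ⟨κ, hκ0, hκ⟩ := exists_bound_sndDeriv_velocity hv
  -- For `|ε| ≤ δ` this gives `|ε| T κ ≤ 1/4`, the range in which the flow is known to be bijective;
  -- the summand `1` covers `T κ = 0` and makes `δ ≤ 1`.
  set δ : ℝ := 1 / (4 * (T * κ + 1)) with hδ
  have hTκ : 0 ≤ T * κ := by positivity
  have hδ0 : 0 < δ := by positivity
  have hδ1 : δ ≤ 1 := by
    rw [hδ, div_le_one (by positivity)]; linarith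
  have hsmall : ∀ ε, |ε| ≤ δ → |ε| * (T * κ) ≤ 1 / 4 := fun ε hε => by
    calc |ε| * (T * κ) ≤ δ * (T * κ) := by gcongr
      _ ≤ δ * (T * κ + 1) := by gcongr; linarith
      _ = 1 / 4 := by rw [hδ]; field_simp
  have hsmall1 : ∀ ε, |ε| ≤ δ → |ε| * (T * κ) < 1 := fun ε hε => by linarith [hsmall ε hε]
  -- Times outside `[0,T]` are projected to it, so that `Q ε` is continuous on all of `ℝ × ℝ^N`.
  set Q : ℝ → ℝ × E N → E N := fun ε z =>
    flowRemainder hT hv u ε z.2 (projIcc 0 T hT.le z.1) with hQ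
  have hproj : Continuous (projIcc 0 T hT.le) := continuous_projIcc
  have hQc : ∀ ε, |ε| ≤ δ → ∀ z, ContinuousAt (fun y : ℝ × (ℝ × E N) => Q y.1 y.2) (ε, z) := by
    intro ε hε z
    have := continuousAt_flowRemainder hT hv hκ hu (hsmall1 ε hε) z.2 (projIcc 0 T hT.le z.1)
    exact ContinuousAt.comp (f := fun y : ℝ × (ℝ × E N) =>
      (y.1, y.2.2, projIcc 0 T hT.le y.2.1)) (x := (ε, z)) this (by fun_prop)
  have hQz : ∀ ε, |ε| ≤ δ → Continuous (Q ε) := fun ε hε =>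
    continuous_iff_continuousAt.2 fun z =>
      ContinuousAt.comp (f := fun z : ℝ × E N => (ε, z)) (x := z) (hQc ε hε z) (by fun_prop)
  have huc : Continuous fun z : ℝ × E N => u z.1 z.2 := hu.contDiff.continuous
  have hcompact : IsCompact (Icc 0 T ×ˢ cube N) := isCompact_Icc.prod isCompact_cube
  obtain ⟨U, hU⟩ := hcompact.exists_bound_of_continuousOn huc.continuousOn
  obtain ⟨C, hC⟩ := ((isCompact_Icc (a := -δ) (b := δ)).prod hcompact).exists_bound_of_continuousOn
    (f := fun y : ℝ × (ℝ × E N) => Q y.1 y.2)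
    fun y hy => (hQc y.1 (abs_le.2 hy.1) y.2).continuousWithinAt
  have hq1 : 1 < q := by linarith
  have hmain := hasDerivAt_integral_norm_rpow (μ := spaceTime N T) hq1
    (a := fun z => u z.1 z.2) (Q := Q) (U := U) (C := C) hδ0 hδ1
    (fun ε hε => (integrable_spaceTime (hQz ε hε.le)).aestronglyMeasurable)
    (integrable_spaceTime huc).aestronglyMeasurable
    (ae_spaceTime fun t ht x hx => hU (t, x) ⟨ht, hx⟩)
    (ae_spaceTime fun t ht x hx ε hε => hC (ε, (t, x)) ⟨abs_le.1 hε.le, ht, hx⟩)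
    (Filter.Eventually.of_forall fun z => ContinuousAt.comp (f := fun ε : ℝ => (ε, z)) (x := 0)
      (hQc 0 (by simpa using hδ0.le) z) (by fun_prop))
  have hEq : ∀ ε, |ε| ≤ δ → (energy q T u fun t x => ε • v t x) =
      (1 / q) * ∫ z, ‖u z.1 z.2 + ε • Q ε z‖ ^ q ∂spaceTime N T := by
    intro ε hε
    rw [energy, integral_spaceTime hT.le]
    · congr 1
      refine intervalIntegral.integral_congr fun t ht => ?_
      rw [uIcc_of_le hT.le] at ht
      have h1 := setIntegral_cell_invFun_flow hT hv hκ hκ0 (hsmall ε hε) ⟨t, ht⟩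
        (H := fun x => ‖materialDerivative u (perturbationFlow fun t x => ε • v t x) t x‖ ^ q)
        (fun x i => by
          simp only [isPeriodic_materialDerivative_flow hT hv hκ hu (hsmall1 ε hε) ⟨t, ht⟩ x i])
      refine h1.trans (integral_congr_ae (Filter.Eventually.of_forall fun x => ?_))
      simp only [hQ, projIcc_of_mem hT.le ht]
      rw [← materialDerivative_flow hT hv hκ (hsmall1 ε hε) ⟨t, ht⟩ x]
    · exact ((huc.add ((hQz ε hε).const_smul ε)).norm).rpow_const fun _ => Or.inr (by linarith)
  have hev : (fun ε : ℝ => energy q T u fun t x => ε • v t x) =ᶠ[nhds 0]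
      fun ε => (1 / q) * ∫ z, ‖u z.1 z.2 + ε • Q ε z‖ ^ q ∂spaceTime N T := by
    filter_upwards [Metric.closedBall_mem_nhds (0 : ℝ) hδ0] with ε hε
    exact hEq ε (by simpa using hε)
  refine ((hmain.const_mul (1 / q)).congr_of_eventuallyEq hev).congr_deriv ?_
  have hQ0 := hQz 0 (by simpa using hδ0.le)
  have hwc := continuous_weighted hq huc
  rw [integral_const_mul, ← mul_assoc, one_div_mul_cancel (by linarith), one_mul,
    integral_spaceTime hT.le, firstVariation]
  · refine intervalIntegral.integral_congr fun t ht => ?_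
    rw [uIcc_of_le hT.le] at ht
    refine integral_congr_ae (Filter.Eventually.of_forall fun x => ?_)
    simp only [hQ, projIcc_of_mem hT.le ht]
    rw [flowRemainder_zero hT hv hκ h0, weighted, real_inner_smul_left]
  · simp only [← real_inner_smul_left]
    exact hwc.inner hQ0

end EnergyDerivative

/-! ### Regularity of `x ↦ ‖x‖^p x`. -/

section NormPower

variable {V : Type} [NormedAddCommGroup V] [InnerProductSpace ℝ V]

/-- Away from the origin every real exponent is allowed, through `‖x‖^p = (‖x‖²)^{p/2}`. The
exponent `q - 2` may be at most `1`, where differentiability at the origin is not available. -/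
theorem hasFDerivAt_norm_rpow_of_ne_zero {x : V} (hx : x ≠ 0) (p : ℝ) :
    HasFDerivAt (fun x : V => ‖x‖ ^ p) ((p * ‖x‖ ^ (p - 2)) • innerSL ℝ x) x := by
  apply HasStrictFDerivAt.hasFDerivAt
  convert! (hasStrictFDerivAt_norm_sq x).rpow_const (p := p / 2) (by simp [hx]) using 0
  simp_rw [← Real.rpow_natCast_mul (norm_nonneg _), ← Nat.cast_smul_eq_nsmul ℝ, smul_smul]
  ring_nf

/-- The derivative is `‖x‖^p id + B x` with `‖B x‖ ≤ p ‖x‖^p`; for `p > 0` both terms tend to `0` at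
the origin, where the derivative is `0`. -/
theorem contDiff_norm_rpow_smul {p : ℝ} (hp : 0 ≤ p) : ContDiff ℝ 1 fun x : V => ‖x‖ ^ p • x := by
  -- The case `p = 0` is separate because there the map is the identity, whose derivative at the
  -- origin is not `0`.
  rcases hp.eq_or_lt with rfl | hp
  · simpa using contDiff_fun_id
  set B : V → V →L[ℝ] V := fun x => ((p * ‖x‖ ^ (p - 2)) • innerSL ℝ x).smulRight x with hB
  have hBn : ∀ x, ‖B x‖ ≤ p * ‖x‖ ^ p := by
    intro x
    rcases eq_or_ne x 0 with rfl | hx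
    · simp [hB, hp.ne']
    · rw [hB, ContinuousLinearMap.norm_smulRight_apply, norm_smul, innerSL_apply_norm,
        Real.norm_of_nonneg (by positivity), mul_assoc, mul_assoc, ← pow_two]
      refine le_of_eq ?_
      congr 1
      rw [← Real.rpow_natCast ‖x‖ 2, ← Real.rpow_add (norm_pos_iff.2 hx)]
      norm_num
  have hpow : Continuous fun x : V => ‖x‖ ^ p := continuous_norm.rpow_const fun _ => Or.inr hp.le
  rw [contDiff_one_iff_hasFDerivAt]
  refine ⟨fun x => ‖x‖ ^ p • ContinuousLinearMap.id ℝ V + B x, ?_, fun x => ?_⟩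
  · refine (hpow.smul continuous_const).add (continuous_iff_continuousAt.2 fun x => ?_)
    rcases eq_or_ne x 0 with rfl | hx
    · have h0 : B 0 = 0 := by simp [hB]
      rw [ContinuousAt, h0]
      refine squeeze_zero_norm hBn ?_
      have : Filter.Tendsto (fun x : V => p * ‖x‖ ^ p) (nhds 0) _ :=
        (continuous_const.mul hpow).tendsto 0
      simpa [hp.ne'] using this
    · have h1 : ContinuousAt (fun x : V => ‖x‖ ^ (p - 2)) x :=
        continuous_norm.continuousAt.rpow_const (Or.inl (norm_ne_zero_iff.2 hx))
      have h2 : ContinuousAt (fun x : V => (p * ‖x‖ ^ (p - 2)) • innerSL ℝ x) x :=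
        (continuousAt_const.mul h1).smul (innerSL ℝ).continuous.continuousAt
      exact ((ContinuousLinearMap.smulRightL ℝ V V).continuous.continuousAt.comp h2).clm_apply
        continuousAt_id
  · rcases eq_or_ne x 0 with rfl | hx
    · have h0 : ‖(0 : V)‖ ^ p • ContinuousLinearMap.id ℝ V + B 0 = 0 := by simp [hB, hp.ne']
      simp only [h0, hasFDerivAt_iff_isLittleO]
      have h1 : (fun x : V => ‖x‖ ^ p) =o[nhds 0] fun _ => (1 : ℝ) := by
        rw [Asymptotics.isLittleO_one_iff]
        simpa [hp.ne'] using hpow.tendsto 0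
      have := h1.smul_isBigO (Asymptotics.isBigO_refl (fun x : V => x) (nhds 0))
      simpa using this
    · exact (hasFDerivAt_norm_rpow_of_ne_zero hx p).smul (hasFDerivAt_id x)

variable {N : ℕ} {q T : ℝ} {u : ℝ → E N → E N}

theorem contDiff_weighted (hq : 2 ≤ q) (hu : IsDivFreeField T 1 u) :
    ContDiff ℝ 1 fun p : ℝ × E N => weighted q u p.1 p.2 :=
  (contDiff_norm_rpow_smul (V := E N) (p := q - 2) (by linarith)).comp hu.contDiff

theorem isPeriodic_weighted (hu : IsDivFreeField T 1 u) (t : ℝ) : IsPeriodic (weighted q u t) := by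
  intro x i
  rw [weighted, weighted, hu.periodic t x i]

end NormPower

/-! ### Continuous fields orthogonal to divergence-free fields are gradients. -/

section GradientFields

variable {N : ℕ}

theorem ball_half_subset_cell :
    Metric.ball (WithLp.toLp 2 fun _ => (1 / 2 : ℝ)) (1 / 2) ⊆ cell N := by
  intro x hx i
  have h1 := PiLp.norm_apply_le (x - WithLp.toLp 2 fun _ => (1 / 2 : ℝ)) i
  rw [Metric.mem_ball, dist_eq_norm] at hx
  have h2 := abs_lt.1 (h1.trans_lt hx)
  simp only [PiLp.sub_apply] at h2
  constructor <;> linarith [h2.1, h2.2]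

theorem measureReal_cell_pos : 0 < volume.real (cell N) := by
  refine ENNReal.toReal_pos (ne_of_gt ?_)
    (ne_of_lt ((measure_mono cell_subset_cube).trans_lt isCompact_cube.measure_lt_top))
  exact (Metric.measure_ball_pos volume _ (by norm_num)).trans_le
    (measure_mono ball_half_subset_cell)

/-- A nonnegative continuous function on the torus with zero integral vanishes. -/
theorem eq_zero_of_setIntegral_cell {h : E N → ℝ} (hc : Continuous h) (hp : IsPeriodic h)
    (h0 : ∀ x, 0 ≤ h x) (hi : ∫ x in cell N, h x = 0) (x : E N) : h x = 0 := by
  -- Translation moves `x` to the centre of the cell, an interior point, where vanishing almost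
  -- everywhere gives vanishing by continuity.
  set c : E N := WithLp.toLp 2 fun _ => (1 / 2 : ℝ) with hcdef
  have hc' : Continuous fun y => h (y + (x - c)) := by fun_prop
  have hi' : ∫ y in cell N, h (y + (x - c)) = 0 := by rw [setIntegral_cell_add hp, hi]
  have hae := (setIntegral_eq_zero_iff_of_nonneg_ae
    (Filter.Eventually.of_forall fun y => h0 (y + (x - c))) (integrable_cell hc')).1 hi'
  have hae' := ae_restrict_of_ae_restrict_of_subset ball_half_subset_cell hae
  have := Measure.eqOn_open_of_ae_eq hae' Metric.isOpen_ball hc'.continuousOn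
    continuousOn_const (Metric.mem_ball_self (x := c) (by norm_num))
  simpa using this

theorem divergence_smul_const {c : E N → ℝ} {x : E N} (hc : DifferentiableAt ℝ c x) (a : E N) :
    divergence (fun y => c y • a) x = fderiv ℝ c x a := by
  rw [divergence]
  simp only [(hc.hasFDerivAt.smul_const a).fderiv]
  conv_rhs => rw [← sum_smul_single a, map_sum]
  simp [mul_comm]

theorem divergence_sub {f g : E N → E N} {x : E N} (hf : DifferentiableAt ℝ f x)
    (hg : DifferentiableAt ℝ g x) :
    divergence (fun y => f y - g y) x = divergence f x - divergence g x := by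
  simp only [divergence, fderiv_fun_sub hf hg, ← Finset.sum_sub_distrib]
  rfl

/-- `G` is orthogonal to the smooth divergence-free fields on the torus. -/
def IsOrthogonalToDivFree (G : E N → E N) : Prop :=
  ∀ φ : E N → E N, ContDiff ℝ ∞ φ → IsPeriodic φ → (∀ x, divergence φ x = 0) →
    ∫ x in cell N, inner ℝ (G x) (φ x) = 0

/-- Let `ψ = ⟨∂_b G, a⟩ - ⟨∂_a G, b⟩`. The field `∂_b ψ a - ∂_a ψ b` is divergence-free by symmetry
of second derivatives, and pairing it with `G` gives `-∫ ψ²` after integration by parts. Hence `ψ =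
0`. -/
theorem IsOrthogonalToDivFree.fderiv_symm {G : E N → E N} (hG : IsOrthogonalToDivFree G)
    (hs : ContDiff ℝ ∞ G) (hp : IsPeriodic G) (x a b : E N) :
    inner ℝ (fderiv ℝ G x b) a = inner ℝ (fderiv ℝ G x a) b := by
  have hd : ∀ {F : Type} [NormedAddCommGroup F] [NormedSpace ℝ F] {f : E N → F},
      ContDiff ℝ ∞ f → ∀ v, ContDiff ℝ ∞ fun y => fderiv ℝ f y v := fun hf v =>
    (hf.fderiv_right (m := ∞) (by simp)).clm_apply contDiff_const
  have hle : (1 : WithTop ℕ∞) ≤ ∞ := by simp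
  set ψ : E N → ℝ := fun y => inner ℝ (fderiv ℝ G y b) a - inner ℝ (fderiv ℝ G y a) b with hψ
  have hψs : ContDiff ℝ ∞ ψ :=
    ((hd hs b).inner ℝ contDiff_const).sub ((hd hs a).inner ℝ contDiff_const)
  have hψp : IsPeriodic ψ := fun y i => by simp only [hψ, hp.fderiv y i]
  have hψ1 : ContDiff ℝ 1 ψ := hψs.of_le hle
  have hψ2 : ContDiff ℝ 2 ψ := hψs.of_le (WithTop.coe_le_coe.2 le_top)
  have hG1 : ContDiff ℝ 1 G := hs.of_le hle
  have hdψ : ∀ v, Differentiable ℝ fun y => fderiv ℝ ψ y v := fun v =>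
    ((hd hψs v).of_le hle).differentiable one_ne_zero
  have hpd : ∀ v : E N, IsPeriodic fun y => fderiv ℝ ψ y v := fun v =>
    hψp.fderiv_apply (isPeriodic_const v)
  have h1 := hG (fun y => fderiv ℝ ψ y b • a - fderiv ℝ ψ y a • b)
    (((hd hψs b).smul contDiff_const).sub ((hd hψs a).smul contDiff_const))
    (fun y i => by simp only [hψp.fderiv y i]) (fun y => by
      rw [divergence_sub ((hdψ b y).smul_const a) ((hdψ a y).smul_const b),
        divergence_smul_const (hdψ b y), divergence_smul_const (hdψ a y)]
      have hsymm : IsSymmSndFDerivAt ℝ ψ y :=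
        hψ2.contDiffAt.isSymmSndFDerivAt (by simp)
      have hdd : DifferentiableAt ℝ (fderiv ℝ ψ) y :=
        ((hψ2.fderiv_right (m := 1) (by norm_num)).differentiable one_ne_zero) y
      rw [fderiv_clm_apply hdd (differentiableAt_const _),
        fderiv_clm_apply hdd (differentiableAt_const _)]
      have := hsymm.eq a b
      simp [this])
  have hibp : ∀ v w : E N, ∫ y in cell N, inner ℝ (G y) (fderiv ℝ ψ y v • w) =
      -∫ y in cell N, inner ℝ (fderiv ℝ G y v) w * ψ y := by
    intro v w
    have hsm : ContDiff ℝ 1 fun y => ψ y • w := hψ1.smul contDiff_const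
    have hsp : IsPeriodic fun y => ψ y • w := fun y i => by simp only [hψp y i]
    have h2 := setIntegral_cell_inner_fderiv hG1 hp hsm hsp contDiff_const (isPeriodic_const v) (divergence_const v)
    have h3 : ∀ y, fderiv ℝ (fun y => ψ y • w) y v = fderiv ℝ ψ y v • w := fun y => by
      rw [((hψ1.differentiable one_ne_zero y).hasFDerivAt.smul_const w).fderiv]
      rfl
    simp only [h3, inner_smul_right] at h2 ⊢
    rw [eq_neg_iff_add_eq_zero, add_comm, ← eq_neg_iff_add_eq_zero, ← h2]
    exact integral_congr_ae (Filter.Eventually.of_forall fun y => mul_comm _ _)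
  have c1 := hG1.continuous
  have c2 := hψ1.continuous_fderiv one_ne_zero
  have c3 := hG1.continuous_fderiv one_ne_zero
  have c4 := hψ1.continuous
  simp only [inner_sub_right] at h1
  rw [integral_sub (integrable_cell (by fun_prop)) (integrable_cell (by fun_prop)), hibp, hibp,
    neg_sub_neg, ← integral_sub (integrable_cell (by fun_prop)) (integrable_cell (by fun_prop))]
    at h1
  have h4 : ∫ y in cell N, ψ y * ψ y = 0 := by
    rw [← neg_eq_zero, ← integral_neg, ← h1]
    refine integral_congr_ae (Filter.Eventually.of_forall fun y => ?_)
    simp only [hψ]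
    ring
  have h5 := eq_zero_of_setIntegral_cell (h := fun y => ψ y * ψ y) (c4.mul c4)
    (fun y i => by simp only [hψp y i]) (fun y => mul_self_nonneg _) h4 x
  exact sub_eq_zero.1 (mul_self_eq_zero.1 h5)

/-- Poincaré lemma on `ℝ^N`. The normalization at `0` makes potentials of approximating fields
converge; periodicity is proved only for their limit. -/
theorem IsOrthogonalToDivFree.exists_potential_of_smooth {G : E N → E N}
    (hG : IsOrthogonalToDivFree G) (hs : ContDiff ℝ ∞ G) (hp : IsPeriodic G) :
    ∃ P : E N → ℝ, P 0 = 0 ∧ ∀ x, HasFDerivAt P (innerSL ℝ (G x)) x := by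
  have hG1 : ContDiff ℝ 1 G := hs.of_le (by simp)
  have hd : ∀ x, HasFDerivAt (fun x => innerSL ℝ (G x)) ((innerSL ℝ).comp (fderiv ℝ G x)) x :=
    fun x => (innerSL ℝ).hasFDerivAt.comp x (hG1.differentiable one_ne_zero x).hasFDerivAt
  obtain ⟨P, hP⟩ := convex_univ.exists_forall_hasFDerivAt_of_fderiv_symmetric isOpen_univ
    (fun x _ => (hd x).differentiableAt.differentiableWithinAt) (fun x _ a b => by
      rw [(hd x).fderiv]
      simpa using (hG.fderiv_symm hs hp x a b).symm)
  exact ⟨fun x => P x - P 0, sub_self _, fun x => (hP x (mem_univ x)).sub_const _⟩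

theorem IsPeriodic.exists_dist_le {G : E N → E N} (hc : Continuous G) (hp : IsPeriodic G) {ε : ℝ}
    (hε : 0 < ε) : ∃ δ > 0, ∀ x y, dist y x < δ → dist (G y) (G x) ≤ ε := by
  obtain ⟨δ, hδ, h⟩ := Metric.mem_uniformity_dist.1
    ((isCompact_cube (N := N)).uniformContinuousAt_of_continuousAt G (fun x _ => hc.continuousAt)
      (Metric.dist_mem_uniformity hε))
  refine ⟨δ, hδ, fun x y hxy => ?_⟩
  obtain ⟨g, hg, hx⟩ := exists_add_mem_cell x
  have := h (a := x + g) (b := y + g) (by rwa [dist_add_right, dist_comm]) (cell_subset_cube hx)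
  simp only [hp.add_mem hg] at this
  rw [dist_comm]
  exact le_of_lt this

theorem divergence_comp_add {φ : E N → E N} (y x : E N) :
    divergence (fun x => φ (x + y)) x = divergence φ (x + y) := by
  simp only [divergence, fderiv_comp_add_right]

open scoped Convolution in
-- Mollification averages translates of `G`, and a translate of a divergence-free test field is
-- again one, so orthogonality survives by Fubini.
theorem IsOrthogonalToDivFree.exists_smooth_approx {G : E N → E N} (hG : IsOrthogonalToDivFree G)
    (hc : Continuous G) (hp : IsPeriodic G) {ε : ℝ} (hε : 0 < ε) :
    ∃ G' : E N → E N, IsOrthogonalToDivFree G' ∧ ContDiff ℝ ∞ G' ∧ IsPeriodic G' ∧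
      ∀ x, dist (G' x) (G x) ≤ ε := by
  obtain ⟨δ, hδ, hdist⟩ := hp.exists_dist_le hc hε
  set ρ : ContDiffBump (0 : E N) := ⟨δ / 2, δ, by positivity, by linarith⟩
  set r : E N → ℝ := ρ.normed volume with hr
  have hrc : Continuous r := ρ.continuous_normed
  set G' : E N → E N := r ⋆[ContinuousLinearMap.lsmul ℝ ℝ, volume] G with hG'
  have hG'a : ∀ x, G' x = ∫ y, r y • G (x - y) := fun x => rfl
  refine ⟨G', ?_, ?_, ?_, fun x => ?_⟩
  · intro φ hφ hφp hφd
    obtain ⟨C, hC⟩ := hp.exists_bound hc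
    obtain ⟨D, hD⟩ := hφp.exists_bound hφ.continuous
    have hφc := hφ.continuous
    have hri : Integrable r := ρ.integrable_normed
    have hint : Integrable (Function.uncurry fun x y => r y * inner ℝ (G (x - y)) (φ x))
        ((volume.restrict (cell N)).prod volume) := by
      refine Integrable.mono' ((integrable_const (C * D)).mul_prod hri.norm) ?_ ?_
      · exact Continuous.aestronglyMeasurable (by unfold Function.uncurry; fun_prop)
      · refine Filter.Eventually.of_forall fun z => ?_
        rw [Function.uncurry, norm_mul, mul_comm]
        gcongr
        have hC0 : 0 ≤ C := (norm_nonneg _).trans (hC 0)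
        exact (norm_inner_le_norm _ _).trans
          (mul_le_mul (hC _) (hD _) (norm_nonneg _) hC0)
    have h1 : ∀ x, inner ℝ (G' x) (φ x) = ∫ y, r y * inner ℝ (G (x - y)) (φ x) := by
      intro x
      have hi : Integrable fun y => r y • G (x - y) := by
        refine Integrable.mono' (hri.norm.mul_const C)
          (Continuous.aestronglyMeasurable (by fun_prop))
          (Filter.Eventually.of_forall fun y => ?_)
        rw [norm_smul]
        gcongr
        exact hC _
      rw [hG'a, real_inner_comm, ← integral_inner hi]
      simp only [inner_smul_right, real_inner_comm]
    simp only [h1]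
    rw [integral_integral_swap hint]
    refine integral_eq_zero_of_ae (Filter.Eventually.of_forall fun y => ?_)
    simp only [integral_const_mul, Pi.zero_apply]
    refine mul_eq_zero_of_right _ ?_
    have h2 := setIntegral_cell_add (g := fun x => inner ℝ (G (x - y)) (φ x))
      (fun x i => by simp only [add_sub_right_comm, hp _ i, hφp x i]) y
    rw [← h2]
    simp only [add_sub_cancel_right]
    exact hG _ (hφ.comp (contDiff_id.add contDiff_const))
      (fun x i => by simp only [add_right_comm x _ y, hφp _ i])
      (fun x => by rw [divergence_comp_add, hφd])
  · exact ρ.hasCompactSupport_normed.contDiff_convolution_left _ ρ.contDiff_normed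
      hc.locallyIntegrable
  · intro x i
    simp only [hG'a, add_sub_right_comm, hp _ i]
  · exact ρ.dist_normed_convolution_le hc.aestronglyMeasurable fun y hy => hdist x y hy

/-- A continuous field on the torus orthogonal to the divergence-free fields is a gradient. -/
theorem IsOrthogonalToDivFree.exists_potential {G : E N → E N} (hG : IsOrthogonalToDivFree G)
    (hc : Continuous G) (hp : IsPeriodic G) :
    ∃ P : E N → ℝ, IsPeriodic P ∧ ContDiff ℝ 1 P ∧ ∀ x, ∇ P x = G x := by
  have happ : ∀ n : ℕ, ∃ G' : E N → E N, IsOrthogonalToDivFree G' ∧ ContDiff ℝ ∞ G' ∧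
      IsPeriodic G' ∧ ∀ x, dist (G' x) (G x) ≤ 1 / (n + 1 : ℝ) := fun n =>
    hG.exists_smooth_approx hc hp (by positivity)
  choose g hgo hgs hgp hgd using happ
  choose p hp0 hpd using fun n => (hgo n).exists_potential_of_smooth (hgs n) (hgp n)
  have hunif : TendstoUniformly (fun n x => innerSL ℝ (g n x)) (fun x => innerSL ℝ (G x))
      Filter.atTop := by
    rw [Metric.tendstoUniformly_iff]
    intro ε hε
    obtain ⟨n, hn⟩ := exists_nat_one_div_lt hε
    filter_upwards [Filter.eventually_ge_atTop n] with m hm x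
    rw [dist_eq_norm, ← map_sub, innerSL_apply_norm, ← dist_eq_norm, dist_comm]
    exact ((hgd m x).trans (Nat.one_div_le_one_div hm)).trans_lt hn
  -- Uniform convergence of the gradients and agreement of the potentials at `0` give convergence at
  -- every point.
  have hcau : ∀ x, Cauchy (Filter.map (fun n => p n x) Filter.atTop) := fun x =>
    cauchy_map_of_uniformCauchySeqOn_fderiv (𝕜 := ℝ) isOpen_univ isPreconnected_univ
      (tendstoUniformlyOn_univ.2 hunif).uniformCauchySeqOn (fun n y _ => hpd n y)
      (mem_univ (0 : E N)) (mem_univ x) (by simp only [hp0]; exact (tendsto_const_nhds (x := (0 : ℝ))).cauchy_map)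
  choose P hP using fun x => cauchy_map_iff_exists_tendsto.1 (hcau x)
  have hPd : ∀ x, HasFDerivAt P (innerSL ℝ (G x)) x :=
    hasFDerivAt_of_tendstoUniformly hunif hpd hP
  have hP1 : ContDiff ℝ 1 P :=
    contDiff_one_iff_hasFDerivAt.2 ⟨_, (innerSL ℝ).continuous.comp hc, hPd⟩
  refine ⟨P, ?_, hP1, fun x => ?_⟩
  -- As `∇P` is periodic, `P` gains a constant `c i` along each period, so `P - ⟨c, x⟩` is periodic
  -- and its derivative along `c` has integral zero. Since `G` is orthogonal to the constant field
  -- `c`, this forces `‖c‖² = 0`.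
  · have hconst : ∀ i x, P (x + EuclideanSpace.single i (1 : ℝ)) - P x =
        P (EuclideanSpace.single i (1 : ℝ)) - P 0 := by
      intro i x
      have h0 : ∀ y, HasFDerivAt (fun y => P (y + EuclideanSpace.single i (1 : ℝ)) - P y)
          (0 : E N →L[ℝ] ℝ) y := by
        intro y
        have h1 := ((hPd (y + EuclideanSpace.single i (1 : ℝ))).comp y
          ((hasFDerivAt_id y).add_const _)).sub (hPd y)
        refine h1.congr_fderiv ?_
        rw [hp y i]
        simp
      have := is_const_of_fderiv_eq_zero (fun y => (h0 y).differentiableAt)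
        (fun y => (h0 y).fderiv) x 0
      simpa using this
    set c : E N := WithLp.toLp 2 fun i => P (EuclideanSpace.single i (1 : ℝ)) - P 0 with hcdef
    have hci : ∀ i, c i = P (EuclideanSpace.single i (1 : ℝ)) - P 0 := fun i => rfl
    have hper : IsPeriodic fun x => P x - inner ℝ c x := by
      intro x i
      have h1 := hconst i x
      have h2 : inner ℝ c (EuclideanSpace.single i (1 : ℝ)) = c i := by
        rw [EuclideanSpace.inner_single_right]; simp
      simp only [inner_add_right, h2, hci]
      linarith
    have hzero : c = 0 := by
      have hd : ∀ x, HasFDerivAt (fun x => P x - inner ℝ c x) (innerSL ℝ (G x) - innerSL ℝ c) x :=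
        fun x => (hPd x).sub (innerSL ℝ c).hasFDerivAt
      have h1 := setIntegral_cell_fderiv (hP1.sub (contDiff_const.inner ℝ contDiff_id)) hper c
      have h2 := hG (fun _ => c) contDiff_const (isPeriodic_const c) (divergence_const c)
      have h3 : ∀ x, fderiv ℝ (fun x => P x - inner ℝ c x) x c =
          inner ℝ (G x) c - inner ℝ c c := fun x => by rw [(hd x).fderiv]; rfl
      simp only [id] at h1
      simp only [h3] at h1
      rw [integral_sub (integrable_cell (by fun_prop)) (integrable_const _), h2] at h1
      simp only [integral_const, smul_eq_mul, zero_sub, neg_eq_zero, mul_eq_zero,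
        measureReal_restrict_apply_univ] at h1
      exact inner_self_eq_zero.1 (h1.resolve_left measureReal_cell_pos.ne')
    intro x i
    have h1 := hconst i x
    rw [← hci, hzero] at h1
    exact sub_eq_zero.1 h1
  · exact (hasGradientAt_iff_hasFDerivAt.2 (hPd x)).gradient

end GradientFields

/-! ### Parseval and Riesz–Fischer, transported to the unit cell. -/

section FourierSeries

variable {N : ℕ}

/-- Haar measure of total mass one on `ℝ / ℤ`. -/
local instance measureSpaceUnitAddCircle : MeasureSpace UnitAddCircle := ⟨AddCircle.haarAddCircle⟩

local instance isAddHaarMeasureUnitAddCircle :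
    Measure.IsAddHaarMeasure (volume : Measure UnitAddCircle) :=
  inferInstanceAs (Measure.IsAddHaarMeasure AddCircle.haarAddCircle)

/-- The projection of `ℝ^N` onto the torus. -/
def toTorus (x : E N) : UnitAddTorus (Fin N) := fun i => (x i : UnitAddCircle)

/-- The representative of a point of the torus in the unit cell. -/
def ofTorus (y : UnitAddTorus (Fin N)) : E N :=
  WithLp.toLp 2 fun i => (AddCircle.measurableEquivIco 1 0 (y i) : ℝ)

theorem measurable_ofTorus : Measurable (ofTorus (N := N)) := by
  refine (WithLp.measurable_toLp 2 (Fin N → ℝ)).comp (measurable_pi_lambda _ fun i => ?_)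
  exact measurable_subtype_coe.comp
    ((AddCircle.measurableEquivIco 1 0).measurable.comp (measurable_pi_apply i))

theorem ofTorus_toTorus {x : E N} (hx : x ∈ cell N) : ofTorus (toTorus x) = x := by
  ext i
  have h : x i ∈ Ico (0 : ℝ) (0 + 1) := by simpa using hx i
  change ((AddCircle.equivIco 1 0 (x i : UnitAddCircle) : Ico (0 : ℝ) (0 + 1)) : ℝ) = x i
  rw [AddCircle.equivIco_coe_eq h]

theorem measurePreserving_toTorus :
    MeasurePreserving (toTorus (N := N)) (volume.restrict (cell N)) volume := by
  have h1 : ∀ _ : Fin N, MeasurePreserving ((↑) : ℝ → UnitAddCircle)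
      (volume.restrict (Ico (0 : ℝ) 1)) volume := by
    intro _
    have h := AddCircle.measurePreserving_mk 1 0
    rw [zero_add, AddCircle.volume_eq_smul_haarAddCircle, ENNReal.ofReal_one, one_smul,
      ← Measure.restrict_congr_set (Ico_ae_eq_Ioc (μ := volume))] at h
    exact h
  have h2 := measurePreserving_pi _ _ h1
  rw [← Measure.restrict_pi_pi] at h2
  have h3 := (PiLp.volume_preserving_ofLp (Fin N)).restrict_preimage
    (s := univ.pi fun _ : Fin N => Ico (0 : ℝ) 1) (MeasurableSet.univ_pi fun _ => measurableSet_Ico)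
  have h4 : (WithLp.ofLp : E N → Fin N → ℝ) ⁻¹' (univ.pi fun _ => Ico (0 : ℝ) 1) = cell N := by
    ext x
    simp [cell]
  rw [h4] at h3
  exact h2.comp h3

theorem measurePreserving_ofTorus :
    MeasurePreserving (ofTorus (N := N)) volume (volume.restrict (cell N)) := by
  refine ⟨measurable_ofTorus, ?_⟩
  rw [← measurePreserving_toTorus.map_eq,
    Measure.map_map measurable_ofTorus measurePreserving_toTorus.measurable]
  have h : (ofTorus ∘ toTorus : E N → E N) =ᵐ[volume.restrict (cell N)] id := by
    filter_upwards [ae_restrict_mem measurableSet_cell] with x hx using ofTorus_toTorus hx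
  rw [Measure.map_congr h, Measure.map_id]

theorem setIntegral_cell_toTorus {F : Type} [NormedAddCommGroup F] [NormedSpace ℝ F]
    {f : UnitAddTorus (Fin N) → F} (hf : AEStronglyMeasurable f volume) :
    ∫ x in cell N, f (toTorus x) = ∫ y, f y := by
  rw [← measurePreserving_toTorus.map_eq, integral_map measurePreserving_toTorus.aemeasurable]
  rwa [measurePreserving_toTorus.map_eq]

/-- The real linear form `x ↦ k · x`. -/
def latticeForm (k : Fin N → ℤ) : E N →L[ℝ] ℝ := ∑ i, (k i : ℝ) • EuclideanSpace.proj i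

theorem latticeForm_apply (k : Fin N → ℤ) (x : E N) : latticeForm k x = ∑ i, k i * x i := by
  simp [latticeForm]

/-- The character `x ↦ exp (2πi k·x)` of the torus. -/
def character (k : Fin N → ℤ) (x : E N) : ℂ :=
  Complex.exp ((latticeForm k x : ℂ) * (2 * Real.pi * Complex.I))

theorem character_eq_mFourier (k : Fin N → ℤ) (x : E N) :
    character k x = UnitAddTorus.mFourier k (toTorus x) := by
  simp only [character, UnitAddTorus.mFourier, toTorus, ContinuousMap.coe_mk, fourier_coe_apply,
    ← Complex.exp_sum, latticeForm_apply]
  congr 1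
  push_cast
  rw [Finset.sum_mul]
  refine Finset.sum_congr rfl fun i _ => ?_
  rw [div_one]
  ring

theorem character_neg (k : Fin N → ℤ) (x : E N) :
    character (-k) x = (starRingEnd ℂ) (character k x) := by
  rw [character_eq_mFourier, UnitAddTorus.mFourier_neg, character_eq_mFourier]

theorem contDiff_character (k : Fin N → ℤ) : ContDiff ℝ ∞ (character k) :=
  ((Complex.ofRealCLM.contDiff.comp (latticeForm k).contDiff).mul contDiff_const).cexp

theorem isPeriodic_character (k : Fin N → ℤ) : IsPeriodic (character k) := by
  intro x i
  rw [character_eq_mFourier, character_eq_mFourier]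
  congr 1
  funext j
  rcases eq_or_ne j i with rfl | h
  · simp [toTorus]
  · simp [toTorus, h]

theorem hasFDerivAt_character (k : Fin N → ℤ) (x : E N) :
    HasFDerivAt (character k) ((latticeForm k).smulRight
      (2 * Real.pi * Complex.I * character k x)) x := by
  have h := ((Complex.ofRealCLM.comp (latticeForm k)).hasFDerivAt (x := x)).mul_const
    (2 * Real.pi * Complex.I) |>.cexp
  refine h.congr_fderiv ?_
  ext v
  simp [character]
  ring

theorem fderiv_character (k : Fin N → ℤ) (x v : E N) : fderiv ℝ (character k) x v =
    latticeForm k v * (2 * Real.pi * Complex.I) * character k x := by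
  rw [(hasFDerivAt_character k x).fderiv]
  simp
  ring

/-- The Fourier coefficient of a function on the torus. -/
def cellCoeff (f : E N → ℂ) (k : Fin N → ℤ) : ℂ := ∫ x in cell N, character (-k) x * f x

theorem memLp_comp_ofTorus {f : E N → ℂ} (hf : MemLp f 2 (volume.restrict (cell N))) :
    MemLp (f ∘ ofTorus) 2 volume := hf.comp_measurePreserving measurePreserving_ofTorus

/-- Only the values on the cell enter, so no periodicity of `f` is required. -/
theorem cellCoeff_eq {f : E N → ℂ} (hf : MemLp f 2 (volume.restrict (cell N)))
    (k : Fin N → ℤ) : cellCoeff f k = UnitAddTorus.mFourierCoeff (memLp_comp_ofTorus hf).toLp k := by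
  have hm := memLp_comp_ofTorus hf
  rw [UnitAddTorus.mFourierCoeff, integral_congr_ae (g := fun y => UnitAddTorus.mFourier (-k) y •
    (f ∘ ofTorus) y) (by filter_upwards [hm.coeFn_toLp] with y hy; rw [hy]),
    ← setIntegral_cell_toTorus]
  · refine setIntegral_congr_fun measurableSet_cell fun x hx => ?_
    simp only [Function.comp, ofTorus_toTorus hx, character_eq_mFourier, smul_eq_mul]
  · exact (UnitAddTorus.mFourier (-k)).continuous.aestronglyMeasurable.smul hm.aestronglyMeasurable

/-- Parseval's identity on the torus. -/
theorem hasSum_cellCoeff {f g : E N → ℂ} (hf : MemLp f 2 (volume.restrict (cell N)))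
    (hg : MemLp g 2 (volume.restrict (cell N))) :
    HasSum (fun k => (starRingEnd ℂ) (cellCoeff f k) * cellCoeff g k)
      (∫ x in cell N, (starRingEnd ℂ) (f x) * g x) := by
  have hfm := memLp_comp_ofTorus hf
  have hgm := memLp_comp_ofTorus hg
  have h := UnitAddTorus.hasSum_prod_mFourierCoeff hfm.toLp hgm.toLp
  simp only [← cellCoeff_eq hf, ← cellCoeff_eq hg] at h
  convert h using 1
  rw [integral_congr_ae (g := fun y => (starRingEnd ℂ) ((f ∘ ofTorus) y) * (g ∘ ofTorus) y) (by
    filter_upwards [hfm.coeFn_toLp, hgm.coeFn_toLp] with y h1 h2; rw [h1, h2]),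
    ← setIntegral_cell_toTorus]
  · refine setIntegral_congr_fun measurableSet_cell fun x hx => ?_
    simp only [Function.comp, ofTorus_toTorus hx]
  · exact (Complex.continuous_conj.comp_aestronglyMeasurable hfm.aestronglyMeasurable).mul
      hgm.aestronglyMeasurable

theorem summable_sq_cellCoeff {f : E N → ℂ} (hf : MemLp f 2 (volume.restrict (cell N))) :
    Summable fun k => ‖cellCoeff f k‖ ^ 2 := by
  have := (hasSum_cellCoeff hf hf).summable.norm
  simpa [sq] using this

/-- Riesz-Fischer theorem on the torus. -/
theorem exists_cellCoeff_eq {p : (Fin N → ℤ) → ℂ} (hp : Memℓp p 2) :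
    ∃ P : E N → ℂ, IsPeriodic P ∧ MemLp P 2 (volume.restrict (cell N)) ∧ cellCoeff P = p := by
  set Q := (UnitAddTorus.mFourierBasis (d := Fin N)).repr.symm ⟨p, hp⟩ with hQ
  have hQm : MemLp (fun x : E N => Q (toTorus x)) 2 (volume.restrict (cell N)) :=
    (Lp.memLp Q).comp_measurePreserving measurePreserving_toTorus
  refine ⟨fun x => Q (toTorus x), fun x i => ?_, hQm, funext fun k => ?_⟩
  · have : toTorus (x + EuclideanSpace.single i (1 : ℝ)) = toTorus x := by
      funext j
      rcases eq_or_ne j i with rfl | h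
      · simp [toTorus]
      · simp [toTorus, h]
    simp only [this]
  · have h1 := UnitAddTorus.mFourierBasis_repr Q k
    rw [hQ, LinearIsometryEquiv.apply_symm_apply] at h1
    change p k = _ at h1
    rw [h1, cellCoeff, UnitAddTorus.mFourierCoeff, ← setIntegral_cell_toTorus]
    · simp only [character_eq_mFourier, smul_eq_mul]
      rfl
    · exact (UnitAddTorus.mFourier (-k)).continuous.aestronglyMeasurable.smul (Lp.aestronglyMeasurable _)

end FourierSeries

/-! ### The pressure of a weak gradient, by Fourier series. -/

section Pressure

variable {N : ℕ}

theorem memLp_cell {F : Type} [NormedAddCommGroup F] {f : E N → F} (hf : Continuous f) :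
    MemLp f 2 (volume.restrict (cell N)) := by
  obtain ⟨C, hC⟩ := (isCompact_cube (N := N)).exists_bound_of_continuousOn hf.continuousOn
  exact MemLp.of_bound (integrable_cell hf).aestronglyMeasurable C
    ((ae_restrict_mem measurableSet_cell).mono fun x hx => hC x (cell_subset_cube hx))

/-- The complex valued `m`-th component of a vector field. -/
def component (h : E N → E N) (m : Fin N) (x : E N) : ℂ := ((h x m : ℝ) : ℂ)

theorem continuous_component {h : E N → E N} (hh : Continuous h) (m : Fin N) :
    Continuous (component h m) :=
  Complex.continuous_ofReal.comp ((EuclideanSpace.proj (𝕜 := ℝ) m).continuous.comp hh)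

theorem hasFDerivAt_component {h : E N → E N} {x : E N} (hh : DifferentiableAt ℝ h x) (m : Fin N) :
    HasFDerivAt (component h m)
      (Complex.ofRealCLM.comp ((EuclideanSpace.proj (𝕜 := ℝ) m).comp (fderiv ℝ h x))) x :=
  Complex.ofRealCLM.hasFDerivAt.comp x
    ((EuclideanSpace.proj (𝕜 := ℝ) m).hasFDerivAt.comp x hh.hasFDerivAt)

/-- Parseval's identity for real vector fields on the torus. -/
theorem hasSum_cellCoeff_component {h ψ : E N → E N} (hh : Continuous h) (hψ : Continuous ψ) :
    HasSum (fun k => ∑ m, (starRingEnd ℂ) (cellCoeff (component h m) k) *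
        cellCoeff (component ψ m) k)
      ((∫ x in cell N, inner ℝ (h x) (ψ x) : ℝ) : ℂ) := by
  have h1 := hasSum_sum (s := Finset.univ) fun m _ =>
    hasSum_cellCoeff (memLp_cell (continuous_component hh m))
      (memLp_cell (continuous_component hψ m))
  convert h1 using 1
  rw [← integral_finsetSum, ← integral_complex_ofReal]
  · refine integral_congr_ae (Filter.Eventually.of_forall fun x => ?_)
    simp [component, PiLp.inner_apply, mul_comm]
  · intro m _
    have := continuous_component hh m
    have := continuous_component hψ m
    exact integrable_cell (by fun_prop)

/-- The derivative of `character (-k) * f` integrates to zero, and differentiating the character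
brings down `-2πi k·v`. -/
theorem cellCoeff_fderiv {f : E N → ℂ} (hf : ContDiff ℝ 1 f) (hp : IsPeriodic f)
    (k : Fin N → ℤ) (v : E N) : cellCoeff (fun x => fderiv ℝ f x v) k =
      2 * Real.pi * Complex.I * latticeForm k v * cellCoeff f k := by
  have hc : ContDiff ℝ 1 (character (-k) : E N → ℂ) := (contDiff_character _).of_le (by simp)
  have h1 := setIntegral_cell_fderiv (hc.mul hf)
    (fun x i => by simp only [isPeriodic_character (-k) x i, hp x i]) v
  have h2 : ∀ x, fderiv ℝ (fun x => character (-k) x * f x) x v =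
      character (-k) x * fderiv ℝ f x v -
        2 * Real.pi * Complex.I * latticeForm k v * (character (-k) x * f x) := by
    intro x
    rw [fderiv_fun_mul (hc.differentiable one_ne_zero x) (hf.differentiable one_ne_zero x)]
    have h3 : latticeForm (-k) v = -latticeForm k v := by simp [latticeForm_apply]
    simp only [add_apply, smul_apply, smul_eq_mul,
      fderiv_character, h3]
    push_cast
    ring
  have c1 := hc.continuous
  have c2 := hf.continuous
  have c3 := hf.continuous_fderiv one_ne_zero
  simp only [h2] at h1
  rw [integral_sub (integrable_cell (by fun_prop)) (integrable_cell (by fun_prop)),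
    integral_const_mul, sub_eq_zero] at h1
  exact h1

theorem latticeForm_single (k : Fin N → ℤ) (j : Fin N) :
    latticeForm k (EuclideanSpace.single j (1 : ℝ)) = k j := by
  simp [latticeForm_apply]

theorem cellCoeff_divergence {φ : E N → E N} (hφ : ContDiff ℝ 1 φ) (hp : IsPeriodic φ)
    (k : Fin N → ℤ) : cellCoeff (fun x => (divergence φ x : ℂ)) k =
      ∑ m, 2 * Real.pi * Complex.I * k m * cellCoeff (component φ m) k := by
  have hc : ContDiff ℝ 1 (character (-k) : E N → ℂ) := (contDiff_character _).of_le (by simp)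
  have c1 := hc.continuous
  have c3 := hφ.continuous_fderiv one_ne_zero
  have h1 : ∀ m, ContDiff ℝ 1 (component φ m) := fun m =>
    Complex.ofRealCLM.contDiff.comp ((EuclideanSpace.proj (𝕜 := ℝ) m).contDiff.comp hφ)
  have h2 : ∀ m, 2 * Real.pi * Complex.I * k m * cellCoeff (component φ m) k =
      cellCoeff (fun x => fderiv ℝ (component φ m) x (EuclideanSpace.single m (1 : ℝ))) k := by
    intro m
    rw [cellCoeff_fderiv (h1 m) (fun x i => by simp only [component, hp x i]), latticeForm_single]
    simp
  rw [Finset.sum_congr rfl fun m _ => h2 m]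
  simp only [cellCoeff]
  rw [← integral_finsetSum]
  · refine integral_congr_ae (Filter.Eventually.of_forall fun x => ?_)
    simp only [divergence, ← Finset.mul_sum,
      (hasFDerivAt_component (hφ.differentiable one_ne_zero x) _).fderiv]
    simp
  · intro m _
    have := (h1 m).continuous_fderiv one_ne_zero
    exact integrable_cell (by fun_prop)

/-- The pairing `φ ↦ ∫ ⟨g, φ⟩ + ∑ j, ∫ ⟨W j, ∂_j φ⟩` on the torus. -/
def weakPairing (g : E N → E N) (W : Fin N → E N → E N) (φ : E N → E N) : ℝ :=
  (∫ x in cell N, inner ℝ (g x) (φ x)) +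
    ∑ j, ∫ x in cell N, inner ℝ (W j x) (fderiv ℝ φ x (EuclideanSpace.single j (1 : ℝ)))

/-- The Fourier symbol of `weakPairing g W`. -/
def pairingSymbol (g : E N → E N) (W : Fin N → E N → E N) (k : Fin N → ℤ) (m : Fin N) : ℂ :=
  (starRingEnd ℂ) (cellCoeff (component g m) k) +
    ∑ j, 2 * Real.pi * Complex.I * k j * (starRingEnd ℂ) (cellCoeff (component (W j) m) k)

variable {g : E N → E N} {W : Fin N → E N → E N}

/-- Parseval in each integral, where `∂_j φ` contributes the factor `2πi k_j`. The conjugates fall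
on `g` and `W`, which leaves the sum complex linear in the coefficients of `φ`. -/
theorem hasSum_weakPairing (hg : Continuous g) (hW : ∀ j, Continuous (W j)) {φ : E N → E N}
    (hφ : ContDiff ℝ 1 φ) (hp : IsPeriodic φ) :
    HasSum (fun k => ∑ m, pairingSymbol g W k m * cellCoeff (component φ m) k)
      (weakPairing g W φ : ℂ) := by
  have c3 := hφ.continuous_fderiv one_ne_zero
  have h1 := (hasSum_cellCoeff_component hg hφ.continuous).add
    (hasSum_sum (s := Finset.univ) fun j _ => hasSum_cellCoeff_component (hW j)
      (ψ := fun x => fderiv ℝ φ x (EuclideanSpace.single j (1 : ℝ))) (by fun_prop))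
  convert h1 using 1
  · funext k
    have h2 : ∀ m j, cellCoeff (component (fun x => fderiv ℝ φ x
        (EuclideanSpace.single j (1 : ℝ))) m) k =
        2 * Real.pi * Complex.I * k j * cellCoeff (component φ m) k := by
      intro m j
      have h3 : ContDiff ℝ 1 (component φ m) :=
        Complex.ofRealCLM.contDiff.comp ((EuclideanSpace.proj (𝕜 := ℝ) m).contDiff.comp hφ)
      have h4 := cellCoeff_fderiv h3 (fun x i => by simp only [component, hp x i]) k
        (EuclideanSpace.single j (1 : ℝ))
      rw [latticeForm_single] at h4
      push_cast at h4
      rw [← h4]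
      congr 1
      funext x
      rw [(hasFDerivAt_component (hφ.differentiable one_ne_zero x) _).fderiv]
      rfl
    simp only [h2, pairingSymbol, add_mul, Finset.sum_add_distrib, Finset.sum_mul]
    congr 1
    rw [Finset.sum_comm]
    refine Finset.sum_congr rfl fun j _ => Finset.sum_congr rfl fun m _ => ?_
    ring
  · simp [weakPairing]

theorem setIntegral_cell_inner_smul_character {h : E N → E N} (hh : Continuous h)
    (k : Fin N → ℤ) (a : E N) : ∫ x in cell N, (inner ℝ (h x) a : ℝ) • character k x =
      ∑ m, a m * (starRingEnd ℂ) (cellCoeff (component h m) k) := by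
  have hc : Continuous (character k : E N → ℂ) := (contDiff_character k).continuous
  have h1 : ∀ m, (a m : ℂ) * (starRingEnd ℂ) (cellCoeff (component h m) k) =
      ∫ x in cell N, (a m : ℂ) * (character k x * component h m x) := by
    intro m
    rw [cellCoeff, ← integral_conj, integral_const_mul]
    simp [character_neg, component]
  simp only [h1]
  rw [← integral_finsetSum]
  · refine integral_congr_ae (Filter.Eventually.of_forall fun x => ?_)
    simp only [PiLp.inner_apply, component, Complex.real_smul, Complex.ofReal_sum, Finset.sum_mul]
    refine Finset.sum_congr rfl fun m _ => ?_
    simp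
    ring
  · intro m _
    have := continuous_component hh m
    exact integrable_cell (by fun_prop)

/-- The plane wave with frequency `k` and amplitude `a` is divergence-free when `k·a = 0`. Test
fields must be real, so the wave enters through real linear functionals `L` of the character; real
and imaginary part then suffice. -/
theorem sum_mul_pairingSymbol_eq_zero (hg : Continuous g) (hW : ∀ j, Continuous (W j))
    (hF : ∀ φ : E N → E N, ContDiff ℝ ∞ φ → IsPeriodic φ → (∀ x, divergence φ x = 0) →
      weakPairing g W φ = 0) {k : Fin N → ℤ} {a : E N} (ha : latticeForm k a = 0) :
    ∑ m, (a m : ℂ) * pairingSymbol g W k m = 0 := by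
  have hch : ContDiff ℝ ∞ (character k : E N → ℂ) := contDiff_character k
  have hc : Continuous (character k : E N → ℂ) := hch.continuous
  set Z : ℂ := (∫ x in cell N, (inner ℝ (g x) a : ℝ) • character k x) +
    ∑ j, ∫ x in cell N, (inner ℝ (W j x) a : ℝ) •
      ((2 * Real.pi * Complex.I * k j) * character k x) with hZ
  have hZ1 : Z = ∑ m, (a m : ℂ) * pairingSymbol g W k m := by
    simp only [hZ, ← mul_smul_comm, integral_const_mul, setIntegral_cell_inner_smul_character hg,
      setIntegral_cell_inner_smul_character (hW _), pairingSymbol, mul_add,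
      Finset.sum_add_distrib, Finset.mul_sum]
    congr 1
    rw [Finset.sum_comm]
    refine Finset.sum_congr rfl fun j _ => Finset.sum_congr rfl fun m _ => ?_
    ring
  have hL : ∀ L : ℂ →L[ℝ] ℝ, L Z = 0 := by
    intro L
    have hd : ∀ x, HasFDerivAt (fun x => L (character k x) • a) ((L.comp ((latticeForm k).smulRight
        (2 * Real.pi * Complex.I * character k x))).smulRight a) x := fun x =>
      (L.hasFDerivAt.comp x (hasFDerivAt_character k x)).smul_const a
    have h1 := hF (fun x => L (character k x) • a) ((L.contDiff.comp hch).smul contDiff_const)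
      (fun x i => by simp only [isPeriodic_character k x i]) (fun x => by
        have hL : HasFDerivAt (fun x => L (character k x)) _ x :=
          L.hasFDerivAt.comp x (hasFDerivAt_character k x)
        rw [divergence_smul_const hL.differentiableAt, hL.fderiv]
        simp [ha])
    rw [← h1, hZ, weakPairing, map_add, map_sum, ← L.integral_comp_comm (integrable_cell (by fun_prop))]
    congr 1
    · refine integral_congr_ae (Filter.Eventually.of_forall fun x => ?_)
      simp only [map_smul, inner_smul_right, smul_eq_mul, mul_comm]
    · refine Finset.sum_congr rfl fun j _ => ?_
      have := hW j
      rw [← L.integral_comp_comm (integrable_cell (by fun_prop))]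
      refine integral_congr_ae (Filter.Eventually.of_forall fun x => ?_)
      simp only [(hd x).fderiv, map_smul, ContinuousLinearMap.smulRight_apply,
        ContinuousLinearMap.comp_apply, inner_smul_right, smul_eq_mul, latticeForm_single]
      have h2 : 2 * Real.pi * Complex.I * k j * character k x =
          (k j : ℝ) • (2 * Real.pi * Complex.I * character k x) := by
        rw [Complex.real_smul]
        push_cast
        ring
      rw [h2, map_smul, smul_eq_mul]
      ring
  rw [← hZ1]
  exact Complex.ext (hL Complex.reCLM) (hL Complex.imCLM)

/-- The Fourier coefficients of the pressure. -/
def pressureCoeff (g : E N → E N) (W : Fin N → E N → E N) (k : Fin N → ℤ) : ℂ :=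
  (starRingEnd ℂ) (-(∑ m, k m * pairingSymbol g W k m) /
    (2 * Real.pi * Complex.I * ∑ m, (k m : ℂ) ^ 2))

/-- The symbol annihilates every vector orthogonal to `k`, hence is a multiple of `k`. At `k = 0`
all vectors are orthogonal to `k`, so the symbol vanishes. -/
theorem pairingSymbol_eq (hg : Continuous g) (hW : ∀ j, Continuous (W j))
    (hF : ∀ φ : E N → E N, ContDiff ℝ ∞ φ → IsPeriodic φ → (∀ x, divergence φ x = 0) →
      weakPairing g W φ = 0) (k : Fin N → ℤ) (m : Fin N) :
    pairingSymbol g W k m =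
      -((2 * Real.pi * Complex.I * k m) * (starRingEnd ℂ) (pressureCoeff g W k)) := by
  have hpi : (2 * Real.pi * Complex.I : ℂ) ≠ 0 := Complex.two_pi_I_ne_zero
  rcases eq_or_ne k 0 with rfl | hk
  · have h1 := sum_mul_pairingSymbol_eq_zero hg hW hF (k := 0)
      (a := EuclideanSpace.single m (1 : ℝ)) (by simp [latticeForm_apply])
    have h2 : pairingSymbol g W 0 m = 0 := by
      rw [← h1, Finset.sum_eq_single m] <;> simp +contextual
    simp [h2]
  · have hs : (∑ l, (k l : ℂ) ^ 2) ≠ 0 := by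
      have : (∑ l, k l ^ 2) ≠ 0 := by
        obtain ⟨i, hi⟩ := Function.ne_iff.1 hk
        refine ne_of_gt ((pow_pos (abs_pos.2 hi) 2).trans_le ?_)
        rw [sq_abs]
        exact Finset.single_le_sum (f := fun l => k l ^ 2) (fun l _ => sq_nonneg _)
          (Finset.mem_univ i)
      exact_mod_cast this
    -- The amplitude `|k|² e_m - k_m k` is `|k|²` times the projection of `e_m` onto the orthogonal
    -- complement of `k`.
    have h1 := sum_mul_pairingSymbol_eq_zero hg hW hF (k := k)
      (a := (∑ l, (k l : ℝ) ^ 2) • EuclideanSpace.single m (1 : ℝ) -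
        (k m : ℝ) • WithLp.toLp 2 fun l => (k l : ℝ)) (by
      rw [map_sub, map_smul, map_smul, latticeForm_single]
      simp only [latticeForm_apply, smul_eq_mul, sq]
      ring)
    have h2 : ∑ l, (((∑ l, (k l : ℝ) ^ 2) • EuclideanSpace.single m (1 : ℝ) -
        (k m : ℝ) • WithLp.toLp 2 fun l => (k l : ℝ) : E N) l : ℂ) * pairingSymbol g W k l =
        (∑ l, (k l : ℂ) ^ 2) * pairingSymbol g W k m -
          k m * ∑ l, k l * pairingSymbol g W k l := by
      simp only [PiLp.sub_apply, PiLp.smul_apply, Complex.ofReal_sub, sub_mul,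
        Finset.sum_sub_distrib, Finset.mul_sum]
      congr 1
      · rw [Finset.sum_eq_single m] <;> simp +contextual [Finset.sum_mul]
      · simp [mul_assoc]
    rw [h2, sub_eq_zero] at h1
    rw [pressureCoeff, Complex.conj_conj]
    field_simp
    linear_combination h1

/-- Take `m` maximizing `|k m|` and divide the `m`-th component of the symbol by `2π |k m| ≥ 1`:
this absorbs each factor `2π |k j|` coming from `∂_j W_j`. The derivative therefore costs nothing
and the pressure is square integrable. -/
theorem norm_pressureCoeff_le (hg : Continuous g) (hW : ∀ j, Continuous (W j))
    (hF : ∀ φ : E N → E N, ContDiff ℝ ∞ φ → IsPeriodic φ → (∀ x, divergence φ x = 0) →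
      weakPairing g W φ = 0) (k : Fin N → ℤ) :
    ‖pressureCoeff g W k‖ ≤ ∑ m, (‖cellCoeff (component g m) k‖ +
      ∑ j, ‖cellCoeff (component (W j) m) k‖) := by
  have hpos : ∀ m, 0 ≤ ‖cellCoeff (component g m) k‖ +
      ∑ j, ‖cellCoeff (component (W j) m) k‖ := fun m => by positivity
  rcases eq_or_ne k 0 with rfl | hk
  · simpa [pressureCoeff] using Finset.sum_nonneg fun m _ => hpos m
  obtain ⟨i, hi⟩ := Function.ne_iff.1 hk
  have : Nonempty (Fin N) := ⟨i⟩
  obtain ⟨m, hm⟩ := Finite.exists_max fun m => |k m|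
  have hm1 : (1 : ℝ) ≤ |(k m : ℝ)| := by
    have h1 : 1 ≤ |k m| := (Int.one_le_abs hi).trans (hm i)
    exact_mod_cast h1
  have hmj : ∀ j, |(k j : ℝ)| ≤ |(k m : ℝ)| := fun j => by exact_mod_cast hm j
  refine le_trans ?_ (Finset.single_le_sum (fun m _ => hpos m) (Finset.mem_univ m))
  have hpi : (1 : ℝ) ≤ 2 * Real.pi := by linarith [Real.pi_gt_three]
  have h1 := congrArg norm (pairingSymbol_eq hg hW hF k m)
  have h2 : ‖pairingSymbol g W k m‖ ≤ ‖cellCoeff (component g m) k‖ +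
      ∑ j, 2 * Real.pi * |(k j : ℝ)| * ‖cellCoeff (component (W j) m) k‖ := by
    refine (norm_add_le _ _).trans (add_le_add (by simp) ((norm_sum_le _ _).trans ?_))
    refine Finset.sum_le_sum fun j _ => ?_
    simp [Real.pi_pos.le, abs_of_nonneg]
  have h3 : ‖-((2 * Real.pi * Complex.I * k m) * (starRingEnd ℂ) (pressureCoeff g W k))‖ =
      2 * Real.pi * |(k m : ℝ)| * ‖pressureCoeff g W k‖ := by
    simp [Real.pi_pos.le, abs_of_nonneg]
  rw [h1, h3] at h2
  have hK : (1 : ℝ) ≤ 2 * Real.pi * |(k m : ℝ)| := one_le_mul_of_one_le_of_one_le hpi hm1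
  have hK0 : (0 : ℝ) < 2 * Real.pi * |(k m : ℝ)| := by linarith
  refine le_of_mul_le_mul_left (h2.trans ?_) hK0
  rw [mul_add, Finset.mul_sum]
  refine add_le_add (le_mul_of_one_le_left (norm_nonneg _) hK) (Finset.sum_le_sum fun j _ => ?_)
  exact mul_le_mul_of_nonneg_right (mul_le_mul_of_nonneg_left (hmj j) (by positivity))
    (norm_nonneg _)

theorem memℓp_pressureCoeff (hg : Continuous g) (hW : ∀ j, Continuous (W j))
    (hF : ∀ φ : E N → E N, ContDiff ℝ ∞ φ → IsPeriodic φ → (∀ x, divergence φ x = 0) →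
      weakPairing g W φ = 0) : Memℓp (pressureCoeff g W) 2 := by
  have hmem : ∀ {f : E N → E N}, Continuous f → ∀ m,
      Memℓp (fun k => ‖cellCoeff (component f m) k‖) 2 := fun hf m =>
    memℓp_gen (by simpa using summable_sq_cellCoeff (memLp_cell (continuous_component hf m)))
  have h1 : Memℓp (fun k => ∑ m, (‖cellCoeff (component g m) k‖ +
      ∑ j, ‖cellCoeff (component (W j) m) k‖)) 2 :=
    Memℓp.finsetSum _ fun m _ => (hmem hg m).add (Memℓp.finsetSum _ fun j _ => hmem (hW j) m)
  have h2 := h1.summable (by norm_num)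
  refine memℓp_gen (Summable.of_nonneg_of_le (fun k => by positivity) (fun k => ?_) h2)
  gcongr
  exact (norm_pressureCoeff_le hg hW hF k).trans (le_abs_self _)

/-- A distribution `g - ∑ j, ∂_j (W j)` with continuous `g`, `W j` on the torus which vanishes on
divergence-free fields is the gradient of a square integrable function. -/
theorem exists_pressure (hg : Continuous g) (hW : ∀ j, Continuous (W j))
    (hF : ∀ φ : E N → E N, ContDiff ℝ ∞ φ → IsPeriodic φ → (∀ x, divergence φ x = 0) →
      weakPairing g W φ = 0) :
    ∃ P : E N → ℝ, IsPeriodic P ∧ MemLp P 2 (volume.restrict (cell N)) ∧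
      ∀ φ : E N → E N, ContDiff ℝ ∞ φ → IsPeriodic φ →
        weakPairing g W φ = -∫ x in cell N, P x * divergence φ x := by
  obtain ⟨Q, hQp, hQm, hQ⟩ := exists_cellCoeff_eq (memℓp_pressureCoeff hg hW hF)
  -- The test fields and the pairing are real, so the real part of `Q` already represents the
  -- functional.
  refine ⟨fun x => (Q x).re, fun x i => by simp only [hQp x i], hQm.re, fun φ hφ hp => ?_⟩
  have hφ1 : ContDiff ℝ 1 φ := hφ.of_le (by simp)
  have hdm : MemLp (fun x => (divergence φ x : ℂ)) 2 (volume.restrict (cell N)) :=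
    memLp_cell (Complex.continuous_ofReal.comp (continuous_divergence hφ1))
  have h1 := hasSum_weakPairing hg hW hφ1 hp
  have h2 := (hasSum_cellCoeff hQm hdm).neg
  have h3 : ∀ k, ∑ m, pairingSymbol g W k m * cellCoeff (component φ m) k =
      -((starRingEnd ℂ) (cellCoeff Q k) * cellCoeff (fun x => (divergence φ x : ℂ)) k) := by
    intro k
    rw [hQ, cellCoeff_divergence hφ1 hp, Finset.mul_sum, ← Finset.sum_neg_distrib]
    refine Finset.sum_congr rfl fun m _ => ?_
    rw [pairingSymbol_eq hg hW hF]
    ring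
  simp only [h3] at h1
  have h4 := congrArg Complex.re (h1.unique h2)
  have hint : Integrable (fun x => (starRingEnd ℂ) (Q x) * (divergence φ x : ℂ))
      (volume.restrict (cell N)) := hQm.star.integrable_mul hdm
  rw [Complex.ofReal_re, Complex.neg_re] at h4
  rw [h4, neg_inj]
  have h5 := Complex.reCLM.integral_comp_comm hint
  simp only [Complex.reCLM_apply] at h5
  rw [← h5]
  simp

end Pressure

/-! ### Time-dependent fields and integration by parts in time. -/

section TimeDependent

variable {N : ℕ} {T : ℝ}

theorem continuous_setIntegral_cell {f : ℝ → E N → ℝ}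
    (hf : Continuous fun p : ℝ × E N => f p.1 p.2) : Continuous fun t => ∫ x in cell N, f t x := by
  have h := continuous_parametric_integral_of_continuous (μ := volume.restrict (cell N)) (f := f)
    hf (isCompact_cube (N := N))
  rwa [Measure.restrict_restrict isCompact_cube.measurableSet,
    inter_eq_self_of_subset_right cell_subset_cube] at h

variable {F : Type} [NormedAddCommGroup F] [NormedSpace ℝ F] {f : ℝ → E N → F}

theorem contDiff_slice {n : WithTop ℕ∞} (hf : ContDiff ℝ n fun p : ℝ × E N => f p.1 p.2) (t : ℝ) :
    ContDiff ℝ n (f t) :=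
  hf.comp (contDiff_prodMk_right t)

theorem hasDerivAt_time (hf : ContDiff ℝ 1 fun p : ℝ × E N => f p.1 p.2) (t : ℝ) (x : E N) :
    HasDerivAt (fun s => f s x) (deriv (fun s => f s x) t) t :=
  (hasDerivAt_fst hf t x).differentiableAt.hasDerivAt

theorem continuous_deriv_time (hf : ContDiff ℝ 1 fun p : ℝ × E N => f p.1 p.2) :
    Continuous fun p : ℝ × E N => deriv (fun s => f s p.2) p.1 :=
  (contDiff_deriv_fst (m := 0) hf (by simp)).continuous

theorem continuous_fderiv_space (hf : ContDiff ℝ 1 fun p : ℝ × E N => f p.1 p.2) :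
    Continuous fun p : ℝ × E N => fderiv ℝ (f p.1) p.2 := by
  have h : (fun p : ℝ × E N => fderiv ℝ (f p.1) p.2) = fun p =>
      (fderiv ℝ (fun p : ℝ × E N => f p.1 p.2) p).comp (ContinuousLinearMap.inr ℝ ℝ (E N)) :=
    funext fun p => (hasFDerivAt_prod_snd hf p.1 p.2).fderiv
  rw [h]
  exact (hf.continuous_fderiv one_ne_zero).clm_comp continuous_const

theorem continuous_slice (hf : Continuous fun p : ℝ × E N => f p.1 p.2) (t : ℝ) :
    Continuous (f t) :=
  hf.comp (Continuous.prodMk_right t)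

theorem isPeriodic_deriv_time (hp : ∀ t, IsPeriodic (f t)) (t : ℝ) :
    IsPeriodic fun x => deriv (fun s => f s x) t := fun x i => by
  simp only [fun s => hp s x i]

/-- After Fubini, the integrand at fixed `x` is the time derivative of `⟨w, v⟩`, which vanishes at
both ends. -/
theorem integral_deriv_eq_zero {w v : ℝ → E N → E N} (hT : 0 ≤ T)
    (hw : ContDiff ℝ 1 fun p : ℝ × E N => w p.1 p.2) (hv : ContDiff ℝ 1 fun p : ℝ × E N => v p.1 p.2)
    (h0 : ∀ x, v 0 x = 0) (h1 : ∀ x, v T x = 0) :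
    ∫ t in (0 : ℝ)..T, ∫ x in cell N, (inner ℝ (w t x) (deriv (fun s => v s x) t) +
      inner ℝ (deriv (fun s => w s x) t) (v t x)) = 0 := by
  have c1 := continuous_deriv_time hw
  have c2 := continuous_deriv_time hv
  have c3 := hw.continuous
  have c4 := hv.continuous
  have hc : Continuous fun z : ℝ × E N => (inner ℝ (w z.1 z.2) (deriv (fun s => v s z.2) z.1) +
      inner ℝ (deriv (fun s => w s z.2) z.1) (v z.1 z.2) : ℝ) := by fun_prop
  rw [← integral_spaceTime hT hc, integral_prod_symm _ (integrable_spaceTime hc)]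
  refine integral_eq_zero_of_ae (Filter.Eventually.of_forall fun x => ?_)
  have hd : ∀ t ∈ uIcc 0 T, HasDerivAt (fun t => (inner ℝ (w t x) (v t x) : ℝ))
      (inner ℝ (w t x) (deriv (fun s => v s x) t) + inner ℝ (deriv (fun s => w s x) t) (v t x)) t :=
    fun t _ => (hasDerivAt_time hw t x).inner ℝ (hasDerivAt_time hv t x)
  have h2 := intervalIntegral.integral_eq_sub_of_hasDerivAt hd
    (Continuous.intervalIntegrable (by fun_prop) _ _)
  rw [intervalIntegral.integral_of_le hT, h0, h1, inner_zero_right, inner_zero_right,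
    sub_zero] at h2
  exact h2

end TimeDependent

/-! ### The weak pairing in terms of the Laplacian of the test field. -/

section Pairing

variable {N : ℕ}

theorem weakPairing_smul (g : E N → E N) (W : Fin N → E N → E N) (c : ℝ) {φ : E N → E N}
    (hφ : Differentiable ℝ φ) :
    weakPairing g W (fun x => c • φ x) = c * weakPairing g W φ := by
  simp only [weakPairing, fderiv_fun_const_smul (hφ _) c, smul_apply, inner_smul_right,
    integral_const_mul, mul_add, Finset.mul_sum]

theorem weakPairing_eq {g f φ : E N → E N} (hf : ContDiff ℝ 1 f) (hfp : IsPeriodic f)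
    (hφ : ContDiff ℝ 2 φ) (hφp : IsPeriodic φ) :
    weakPairing g (fun j x => (1 / 2 : ℝ) • fderiv ℝ f x (EuclideanSpace.single j (1 : ℝ))) φ =
      (∫ x in cell N, inner ℝ (g x) (φ x)) -
        (1 / 2) * ∫ x in cell N, inner ℝ (f x) ((Δ φ) x) := by
  rw [weakPairing, setIntegral_cell_inner_laplacian hf hfp hφ hφp]
  simp only [inner_smul_left, integral_const_mul, ← Finset.mul_sum]
  simp

end Pairing

/-! ### From criticality to the equation. -/

section MainTheorem

variable {N : ℕ} {q T : ℝ} {u w : ℝ → E N → E N}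

/-- `(∂_t + u·∇) w`. -/
def transport (u w : ℝ → E N → E N) (t : ℝ) (x : E N) : E N :=
  deriv (fun s => w s x) t + fderiv ℝ (w t) x (u t x)

/-- The weak form of `(∂_t + u·∇ - ½Δ) w`, tested against `φ`. -/
def momentum (u w : ℝ → E N → E N) (t : ℝ) (φ : E N → E N) : ℝ :=
  weakPairing (transport u w t) (fun j x => (1 / 2 : ℝ) •
    fderiv ℝ (w t) x (EuclideanSpace.single j (1 : ℝ))) φ

theorem continuous_transport (hw : ContDiff ℝ 1 fun p : ℝ × E N => w p.1 p.2)
    (hu : IsDivFreeField T 1 u) :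
    Continuous fun p : ℝ × E N => transport u w p.1 p.2 := by
  have c1 := continuous_deriv_time hw
  have c2 := continuous_fderiv_space hw
  have c3 := hu.contDiff.continuous
  exact c1.add (c2.clm_apply c3)

theorem isPeriodic_transport (hwp : ∀ t, IsPeriodic (w t)) (hu : IsDivFreeField T 1 u) (t : ℝ) : IsPeriodic (transport u w t) :=
  fun x i => by
    simp only [transport, isPeriodic_deriv_time hwp t x i,
      (hwp t).fderiv_apply (hu.periodic t) x i]

theorem momentum_eq (hw : ContDiff ℝ 1 fun p : ℝ × E N => w p.1 p.2)
    (hwp : ∀ t, IsPeriodic (w t)) (hu : IsDivFreeField T 1 u) (t : ℝ) {φ : E N → E N}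
    (hφ : ContDiff ℝ 2 φ) (hφp : IsPeriodic φ) :
    momentum u w t φ = (∫ x in cell N, inner ℝ (deriv (fun s => w s x) t) (φ x)) +
      (∫ x in cell N, inner ℝ (fderiv ℝ (w t) x (u t x)) (φ x)) -
      (1 / 2) * ∫ x in cell N, inner ℝ (w t x) ((Δ φ) x) := by
  have c1 := continuous_deriv_time hw
  have c2 := (contDiff_slice hw t).continuous_fderiv one_ne_zero
  have c3 := (contDiff_slice hu.contDiff t).continuous
  have c4 := hφ.continuous
  have c5 : Continuous fun x => deriv (fun s => w s x) t :=
    continuous_slice (f := fun t x => deriv (fun s => w s x) t) c1 t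
  rw [momentum, weakPairing_eq (contDiff_slice hw t)
    (hwp t) hφ hφp, ← integral_add (integrable_cell (by fun_prop))
    (integrable_cell (by fun_prop))]
  simp only [transport, inner_add_left]

theorem continuous_momentum (hw : ContDiff ℝ 1 fun p : ℝ × E N => w p.1 p.2)
    (hu : IsDivFreeField T 1 u) {v : ℝ → E N → E N}
    (hv : ContDiff ℝ 1 fun p : ℝ × E N => v p.1 p.2) :
    Continuous fun t => momentum u w t (v t) := by
  have c1 := continuous_transport hw hu
  have c2 := continuous_fderiv_space hw
  have c3 := continuous_fderiv_space hv
  have c4 := hv.continuous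
  refine (continuous_setIntegral_cell (by fun_prop)).add (continuous_finsetSum _ fun j _ =>
    continuous_setIntegral_cell (by fun_prop))

/-- The transport term moves to `f` by skew-symmetry of `b·∇`; the Laplacian stays on `φ` because
`f` is only `C^1`. -/
theorem setIntegral_cell_inner_generator {b f φ : E N → E N} (hf : ContDiff ℝ 1 f)
    (hfp : IsPeriodic f) (hφ : ContDiff ℝ 2 φ) (hφp : IsPeriodic φ) (hb : ContDiff ℝ 1 b)
    (hbp : IsPeriodic b) (hdiv : ∀ x, divergence b x = 0) :
    ∫ x in cell N, inner ℝ (f x) (generator b φ x) =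
      (1 / 2) * (∫ x in cell N, inner ℝ (f x) ((Δ φ) x)) -
        ∫ x in cell N, inner ℝ (fderiv ℝ f x (b x)) (φ x) := by
  have c1 := hf.continuous
  have c2 := continuous_laplacian hφ
  have c3 := hφ.continuous_fderiv two_ne_zero
  have c4 := hb.continuous
  rw [setIntegral_cell_inner_fderiv hf hfp (hφ.of_le one_le_two) hφp hb hbp hdiv, sub_neg_eq_add,
    ← integral_const_mul, ← integral_add (integrable_cell (by fun_prop))
    (integrable_cell (by fun_prop))]
  simp only [generator, inner_add_right, inner_smul_right]

/-- Add and subtract `⟨∂_t w, v⟩`: the total time derivative of `⟨w, v⟩` integrates to zero, and the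
rest is minus the momentum. -/
theorem integral_inner_generator_eq (hT : 0 < T) (hu : IsDivFreeField T 1 u)
    (hw : ContDiff ℝ 1 fun p : ℝ × E N => w p.1 p.2) (hwp : ∀ t, IsPeriodic (w t))
    {v : ℝ → E N → E N} (hv : IsDivFreeField T ⊤ v) (h0 : ∀ x, v 0 x = 0) (h1 : ∀ x, v T x = 0) :
    ∫ t in (0 : ℝ)..T, ∫ x in cell N,
      inner ℝ (w t x) (deriv (fun s => v s x) t + generator (u t) (v t) x) =
      -∫ t in (0 : ℝ)..T, momentum u w t (v t) := by
  have hv1 : ContDiff ℝ 1 fun p : ℝ × E N => v p.1 p.2 :=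
    hv.contDiff.of_le (WithTop.coe_le_coe.2 le_top)
  have hv2 : ContDiff ℝ 2 fun p : ℝ × E N => v p.1 p.2 :=
    hv.contDiff.of_le (WithTop.coe_le_coe.2 le_top)
  have c1 := continuous_deriv_time hw
  have c2 := continuous_deriv_time hv1
  have c3 := hw.continuous
  have c4 := hv1.continuous
  have c5 := continuous_momentum hw hu hv1
  have key : ∀ t ∈ Icc 0 T, ∫ x in cell N,
      inner ℝ (w t x) (deriv (fun s => v s x) t + generator (u t) (v t) x) =
      (∫ x in cell N, (inner ℝ (w t x) (deriv (fun s => v s x) t) +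
        inner ℝ (deriv (fun s => w s x) t) (v t x))) - momentum u w t (v t) := by
    intro t ht
    have d1 : Continuous fun x => deriv (fun s => w s x) t :=
      continuous_slice (f := fun t x => deriv (fun s => w s x) t) c1 t
    have d2 : Continuous fun x => deriv (fun s => v s x) t := continuous_slice (f := fun t x => deriv (fun s => v s x) t) c2 t
    have d3 : Continuous (w t) := continuous_slice c3 t
    have d4 : Continuous (v t) := continuous_slice c4 t
    have hvt := contDiff_slice hv2 t
    have hut := contDiff_slice hu.contDiff t
    have d5 := continuous_laplacian hvt
    have d6 := hvt.continuous_fderiv two_ne_zero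
    have d7 := hut.continuous
    have d8 : Continuous (generator (u t) (v t)) := by
      unfold generator
      fun_prop
    have h2 := setIntegral_cell_inner_generator (contDiff_slice hw t) (hwp t)
      hvt (hv.periodic t) hut (hu.periodic t) (hu.div_eq_zero t ht)
    simp only [inner_add_right]
    rw [integral_add (integrable_cell (by fun_prop)) (integrable_cell (by fun_prop)),
      integral_add (integrable_cell (by fun_prop)) (integrable_cell (by fun_prop)), h2,
      momentum_eq hw hwp hu t hvt (hv.periodic t)]
    ring
  rw [intervalIntegral.integral_congr (fun t ht => key t (by
    rwa [uIcc_of_le hT.le] at ht)), intervalIntegral.integral_sub, integral_deriv_eq_zero hT.le hw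
    hv1 h0 h1, zero_sub]
  · exact (continuous_setIntegral_cell (by fun_prop)).intervalIntegrable _ _
  · exact c5.intervalIntegrable _ _

theorem firstVariation_eq (hq : 2 ≤ q) (hT : 0 < T) (hu : IsDivFreeField T 1 u)
    {v : ℝ → E N → E N} (hv : IsDivFreeField T ⊤ v) (h0 : ∀ x, v 0 x = 0) (h1 : ∀ x, v T x = 0) :
    firstVariation q T u v = -∫ t in (0 : ℝ)..T, momentum u (weighted q u) t (v t) :=
  integral_inner_generator_eq hT hu (contDiff_weighted hq hu) (isPeriodic_weighted hu) hv h0 h1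

theorem isDivFreeField_smul {a : ℝ → ℝ} (ha : ContDiff ℝ ∞ a) {φ : E N → E N}
    (hφ : ContDiff ℝ ∞ φ) (hφp : IsPeriodic φ) (hφd : ∀ x, divergence φ x = 0) :
    IsDivFreeField T ⊤ fun t x => a t • φ x where
  contDiff := (ha.comp contDiff_fst).smul (hφ.comp contDiff_snd)
  periodic t x i := by simp only [hφp x i]
  div_eq_zero t _ x := by
    have := hφd x
    rw [divergence] at this
    simp only [divergence, fderiv_fun_const_smul (hφ.differentiable (by simp) _) (a t), smul_apply, PiLp.smul_apply,
      ← Finset.smul_sum, this, smul_zero]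

/-- Localization in time: product fields `a(t) φ(x)` are admissible variations, and the fundamental
lemma of the calculus of variations removes the time integral. -/
theorem isCriticalPoint_iff_momentum (hq : 2 ≤ q) (hT : 0 < T) (hu : IsDivFreeField T 1 u) :
    IsCriticalPoint q T u ↔ ∀ t ∈ Icc 0 T, ∀ φ : E N → E N, ContDiff ℝ ∞ φ → IsPeriodic φ →
      (∀ x, divergence φ x = 0) → momentum u (weighted q u) t φ = 0 := by
  constructor
  · intro hcrit t ht φ hφ hφp hφd
    have hc : Continuous fun t => momentum u (weighted q u) t φ :=
      continuous_momentum (contDiff_weighted hq hu) hu (v := fun _ => φ) ((hφ.comp contDiff_snd).of_le (by simp))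
    have hae : ∀ᵐ t, t ∈ Ioo 0 T → momentum u (weighted q u) t φ = 0 := by
      refine isOpen_Ioo.ae_eq_zero_of_integral_contDiff_smul_eq_zero
        (hc.locallyIntegrable.locallyIntegrableOn _) fun a ha _ hsupp => ?_
      have hv : IsDivFreeField T ⊤ fun t x => a t • φ x := isDivFreeField_smul ha hφ hφp hφd
      -- The support of `a` lies in the open interval, so the variation vanishes at times `0` and
      -- `T`.
      have ha0 : ∀ t ∉ Ioo 0 T, a t = 0 := fun t ht => image_eq_zero_of_notMem_tsupport
        fun h => ht (hsupp h)
      have h0 : ∀ x, a 0 • φ x = 0 := fun x => by rw [ha0 0 (by simp), zero_smul]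
      have h1 : ∀ x, a T • φ x = 0 := fun x => by rw [ha0 T (by simp), zero_smul]
      have h2 := (hasDerivAt_energy hq hT hu hv h0).unique (hcrit _ hv h0 h1)
      rw [firstVariation_eq hq hT hu hv h0 h1, neg_eq_zero,
        intervalIntegral.integral_of_le hT.le] at h2
      rw [← setIntegral_eq_integral_of_forall_compl_eq_zero (s := Ioc 0 T)]
      · refine Eq.trans (integral_congr_ae (Filter.Eventually.of_forall fun t => ?_)) h2
        exact (weakPairing_smul _ _ _ (hφ.differentiable (by simp))).symm
      · intro t ht
        rw [ha0 t fun h => ht (Ioo_subset_Ioc_self h), zero_smul]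
    -- Continuity in `t` upgrades almost every time to every time of the closed interval, endpoints
    -- included.
    have hae' : (fun t => momentum u (weighted q u) t φ) =ᵐ[volume.restrict (Icc 0 T)] fun _ => 0 := by
      rw [← restrict_Ioo_eq_restrict_Icc]
      exact (ae_restrict_iff' measurableSet_Ioo).2 hae
    exact Measure.eqOn_Icc_of_ae_eq volume hT.ne hae' hc.continuousOn continuousOn_const ht
  · intro h v hv h0 h1
    refine (hasDerivAt_energy hq hT hu hv h0).congr_deriv ?_
    rw [firstVariation_eq hq hT hu hv h0 h1, neg_eq_zero]
    refine (intervalIntegral.integral_congr fun t ht => ?_).trans intervalIntegral.integral_zero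
    rw [uIcc_of_le hT.le] at ht
    exact h t ht _ (contDiff_slice hv.contDiff t) (hv.periodic t) (hv.div_eq_zero t ht)

/-- The pressure is found at each time separately, so no regularity in time is claimed for it. -/
theorem isCriticalPoint_iff_isWeakSolution (hq : 2 ≤ q) (hT : 0 < T) (hu : IsDivFreeField T 1 u) :
    IsCriticalPoint q T u ↔ ∃ P : ℝ → E N → ℝ, IsWeakSolution q T u P := by
  have hw := contDiff_weighted hq hu
  have hle : (2 : WithTop ℕ∞) ≤ ∞ := WithTop.coe_le_coe.2 le_top
  rw [isCriticalPoint_iff_momentum hq hT hu]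
  constructor
  · intro h
    have hex : ∀ t, ∃ P : E N → ℝ, t ∈ Icc 0 T → IsPeriodic P ∧
        MemLp P 2 (volume.restrict (cell N)) ∧ ∀ φ : E N → E N, ContDiff ℝ ∞ φ → IsPeriodic φ →
          momentum u (weighted q u) t φ = -∫ x in cell N, P x * divergence φ x := by
      intro t
      by_cases ht : t ∈ Icc 0 T
      · have c2 := (contDiff_slice hw t).continuous_fderiv one_ne_zero
        have c3 : Continuous (transport u (weighted q u) t) :=
          continuous_slice (continuous_transport (contDiff_weighted hq hu) hu) t
        obtain ⟨P, hP⟩ := exists_pressure c3 (W := fun j x => (1 / 2 : ℝ) •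
          fderiv ℝ (weighted q u t) x (EuclideanSpace.single j (1 : ℝ))) (fun j => by fun_prop)
          (h t ht)
        exact ⟨P, fun _ => hP⟩
      · exact ⟨0, fun h => (ht h).elim⟩
    choose P hP using hex
    refine ⟨P, fun t ht => ⟨(hP t ht).1, (hP t ht).2.1, fun φ hφ hφp => ?_⟩⟩
    have h1 := (hP t ht).2.2 φ hφ hφp
    rw [momentum_eq hw (isPeriodic_weighted hu) hu t (hφ.of_le hle) hφp] at h1
    linarith
  · rintro ⟨P, hP⟩ t ht φ hφ hφp hφd
    have h1 := (hP t ht).2.2 φ hφ hφp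
    simp only [hφd, mul_zero, integral_zero] at h1
    rw [momentum_eq hw (isPeriodic_weighted hu) hu t (hφ.of_le hle) hφp]
    linarith

/-- With two space derivatives on `w`, Green's identity moves the Laplacian back, and the momentum
becomes the pairing with a continuous field. Vanishing on divergence-free fields then means that
this field is a classical gradient. -/
theorem isCriticalPoint_iff_isClassicalSolution (hq : 2 ≤ q) (hT : 0 < T)
    (hu : IsDivFreeField T 1 u) (hw2 : ∀ t ∈ Icc 0 T, ContDiff ℝ 2 (weighted q u t)) :
    IsCriticalPoint q T u ↔ ∃ P : ℝ → E N → ℝ, IsClassicalSolution q T u P := by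
  have hle : (2 : WithTop ℕ∞) ≤ ∞ := WithTop.coe_le_coe.2 le_top
  have hmom : ∀ t ∈ Icc 0 T, ∀ φ : E N → E N, ContDiff ℝ ∞ φ → IsPeriodic φ →
      momentum u (weighted q u) t φ = ∫ x in cell N,
        inner ℝ (transport u (weighted q u) t x - (1 / 2 : ℝ) • (Δ (weighted q u t)) x) (φ x) := by
    intro t ht φ hφ hφp
    have c1 : Continuous (transport u (weighted q u) t) :=
      continuous_slice (continuous_transport (contDiff_weighted hq hu) hu) t
    have c2 := continuous_laplacian (hw2 t ht)
    have c3 := hφ.continuous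
    rw [momentum, weakPairing_eq ((hw2 t ht).of_le one_le_two) (isPeriodic_weighted hu t)
      (hφ.of_le hle) hφp, ← setIntegral_cell_laplacian_inner (hw2 t ht) (isPeriodic_weighted hu t)
      (hφ.of_le hle) hφp, ← integral_const_mul, ← integral_sub (integrable_cell (by fun_prop))
      (integrable_cell (by fun_prop))]
    simp only [inner_sub_left, real_inner_smul_left]
  rw [isCriticalPoint_iff_momentum hq hT hu]
  constructor
  · intro h
    have hex : ∀ t, ∃ P : E N → ℝ, t ∈ Icc 0 T → IsPeriodic P ∧ ContDiff ℝ 1 P ∧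
        ∀ x, ∇ P x = transport u (weighted q u) t x - (1 / 2 : ℝ) • (Δ (weighted q u t)) x := by
      intro t
      by_cases ht : t ∈ Icc 0 T
      · have c1 : Continuous (transport u (weighted q u) t) :=
          continuous_slice (continuous_transport (contDiff_weighted hq hu) hu) t
        have c2 := continuous_laplacian (hw2 t ht)
        have hG : IsOrthogonalToDivFree fun x =>
            transport u (weighted q u) t x - (1 / 2 : ℝ) • (Δ (weighted q u t)) x := fun φ hφ hφp hφd => by
          rw [← hmom t ht φ hφ hφp, h t ht φ hφ hφp hφd]
        obtain ⟨P, hP⟩ := hG.exists_potential (by fun_prop) fun x i => by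
          simp only [isPeriodic_transport (isPeriodic_weighted hu) hu t x i,
            (isPeriodic_weighted hu t).laplacian (hw2 t ht) x i]
        exact ⟨P, fun _ => hP⟩
      · exact ⟨0, fun h => (ht h).elim⟩
    choose P hP using hex
    refine ⟨P, fun t ht => ⟨(hP t ht).1, (hP t ht).2.1, fun x => ?_⟩⟩
    rw [(hP t ht).2.2 x, transport]
    abel
  · rintro ⟨P, hP⟩ t ht φ hφ hφp hφd
    obtain ⟨hPp, hP1, hPe⟩ := hP t ht
    have hgrad : ∀ x, transport u (weighted q u) t x - (1 / 2 : ℝ) • (Δ (weighted q u t)) x = ∇ (P t) x := by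
      intro x
      rw [transport, hPe x]
      abel
    have h1 := setIntegral_cell_fderiv_field hP1 hPp (hφ.of_le (by simp)) hφp
    simp only [hφd, mul_zero, integral_zero, neg_zero] at h1
    rw [hmom t ht φ hφ hφp, ← h1]
    refine integral_congr_ae (Filter.Eventually.of_forall fun x => ?_)
    simp only [hgrad]
    rw [gradient, InnerProductSpace.toDual_symm_apply]

end MainTheorem

end PorousVariational

end

theorem theorem1 (N : ℕ) (q T : ℝ) (hq : 2 ≤ q) (hT : 0 < T)
    (u : ℝ → PorousVariational.E N → PorousVariational.E N)
    (hu : PorousVariational.IsDivFreeField T 1 u) :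
    (PorousVariational.IsCriticalPoint q T u ↔
        ∃ P : ℝ → PorousVariational.E N → ℝ, PorousVariational.IsWeakSolution q T u P) ∧
      ((∀ t ∈ Set.Icc 0 T, ContDiff ℝ 2 (PorousVariational.weighted q u t)) →
        (PorousVariational.IsCriticalPoint q T u ↔
          ∃ P : ℝ → PorousVariational.E N → ℝ,
            PorousVariational.IsClassicalSolution q T u P)) := by
  exact ⟨PorousVariational.isCriticalPoint_iff_isWeakSolution hq hT hu,
    PorousVariational.isCriticalPoint_iff_isClassicalSolution hq hT hu⟩
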